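/- A knot diagram is a generic projection of a knot to the plane with over/under information at every crossing. It is regarded as a plane graph whose vertices of degree $4$ are the crossings, and which may have additional vertices of degree $2$ subdividing its edges; diagrams are considered up to isotopy of the plane and up to adding and removing such subdivision vertices. Its treewidth is that of the underlying simple graph (loops and multiplicities of edges being forgotten). A diagram is called trivial if it has no crossings (it is then a circle), and it is a diagram of the unknot if a finite sequence of Reidemeister moves (I: twist/untwist, II: poke/unpoke, III: slide) transforms it into a trivial diagram. Theorem. Let $D$ be a knot diagram of treewidth at most $2$ with $n$ crossings, and suppose that $D$ is a diagram of the unknot. Then $D$ can be transformed into the trivial diagram by a sequence of at most $n$ Reidemeister moves, each of which is a twist, an untwist, a poke or an unpoke; no slide moves (type III) are used. -/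

import Mathlib

/-- A tree decomposition of a (finite) graph `G`: a finite tree `tree`, and for every node `i` of the
tree a set `bag i` of vertices of `G`. -/
structure TreeDecomposition {V : Type*} (G : SimpleGraph V) where
  size : ℕ
  tree : SimpleGraph (Fin size)
  bag : Fin size → Set V
  isTree : tree.IsTree
  vertex_mem : ∀ v, ∃ i, v ∈ bag i
  edge_mem : ∀ v w, G.Adj v w → ∃ i, v ∈ bag i ∧ w ∈ bag i
  connected : ∀ v, (tree.induce {i | v ∈ bag i}).Connected

/-- The width `max |bag i| - 1` of a tree decomposition. -/
noncomputable def TreeDecomposition.width {V : Type*} {G : SimpleGraph V}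
    (t : TreeDecomposition G) : ℕ∞ :=
  ⨆ i, ((t.bag i).encard - 1)

/-- The treewidth of a finite graph: the minimum width of a tree decomposition. -/
noncomputable def SimpleGraph.treewidth {V : Type*} (G : SimpleGraph V) : ℕ∞ :=
  ⨅ t : TreeDecomposition G, t.width

/-- A diagram of a knot in the plane, as a plane (multi)graph up to isotopy of the plane, encoded by
its rotation system. The vertices have degree 4 (crossings) or degree 2 (subdivision points).
A dart is an edge together with one of its two ends, and is thought of as leaving the vertex at that
end.
* `next d` is the dart that follows `d` counterclockwise around the vertex of `d`: the vertices are
  the cycles of `next`;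
* `opp d` is the other end of the edge of `d`;
* `isOver d` says whether, at the crossing that `d` leaves, `d` belongs to the upper strand; at a
  subdivision point `isOver` carries no information and is ignored by all notions below;
* the corner between `d` and `next d` is denoted by `d`; the faces are the cycles of
  `next⁻¹ * opp` on corners, and `outer` is some corner of the unbounded face. -/
structure KnotDiagram where
  Dart : Type
  finite : Finite Dart
  next : Equiv.Perm Dart
  opp : Equiv.Perm Dart
  isOver : Dart → Bool
  outer : Dart
  /-- `opp` pairs the darts. -/
  opp_ne : ∀ d, opp d ≠ d
  opp_opp : ∀ d, opp (opp d) = d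
  /-- Every vertex has degree 2 or 4. -/
  next_ne : ∀ d, next d ≠ d
  next_four : ∀ d, next (next (next (next d))) = d
  /-- At a crossing, two opposite ends are over and the two others are under. -/
  isOver_next : ∀ d, next (next d) ≠ d → isOver (next d) = !(isOver d)
  /-- The diagram consists of a single closed strand: every dart is reached from every other one by
  following edges and by going straight across vertices. In particular the graph is connected. -/
  one_strand : ∀ d d', Relation.EqvGen
    (fun x y => y = opp x ∨ (next (next x) = x ∧ y = next x) ∨
      (next (next x) ≠ x ∧ y = next (next x))) d d'
  /-- Euler's formula `V + F = E + 2`: the rotation system is planar. -/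
  euler : Nat.card (Quotient (Equiv.Perm.SameCycle.setoid next)) +
      Nat.card (Quotient (Equiv.Perm.SameCycle.setoid (next⁻¹ * opp))) =
    Nat.card (Quotient (Equiv.Perm.SameCycle.setoid opp)) + 2

namespace KnotDiagram

/-- The vertices of a diagram. -/
abbrev Vertex (D : KnotDiagram) : Type := Quotient (Equiv.Perm.SameCycle.setoid D.next)

/-- The vertex that a dart leaves. -/
def vert (D : KnotDiagram) (d : D.Dart) : D.Vertex :=
  Quotient.mk (Equiv.Perm.SameCycle.setoid D.next) d

/-- The dart `d` leaves a crossing (a vertex of degree 4). -/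
def IsCrossing (D : KnotDiagram) (d : D.Dart) : Prop := D.next (D.next d) ≠ d

/-- The number of crossings. -/
noncomputable def crossingNumber (D : KnotDiagram) : ℕ :=
  {v : D.Vertex | ∃ d, D.vert d = v ∧ D.IsCrossing d}.ncard

/-- The underlying simple graph (loops and multiplicities of edges are forgotten). -/
def graph (D : KnotDiagram) : SimpleGraph D.Vertex :=
  SimpleGraph.fromRel (fun v w => ∃ d, D.vert d = v ∧ D.vert (D.opp d) = w)

/-- A trivial diagram (a circle): there are no crossings, only subdivision points. -/
def IsTrivial (D : KnotDiagram) : Prop := ∀ d, ¬ D.IsCrossing d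

/-- Going to the next corner of the same face. -/
def facePerm (D : KnotDiagram) : Equiv.Perm D.Dart := D.next⁻¹ * D.opp

/-- Two corners belong to the same face. -/
def SameFace (D : KnotDiagram) (d d' : D.Dart) : Prop := D.facePerm.SameCycle d d'

/-- The identification `f` of the darts of `E` with darts of `D` respects the information at the
crossings of `E`. -/
def SameOver (D E : KnotDiagram) (f : E.Dart → D.Dart) : Prop :=
  ∀ e, E.IsCrossing e → E.isOver e = D.isOver (f e)

/-- Isotopy of the plane: an isomorphism of rotation systems which respects the crossings and the
unbounded face. -/
def Isotopic (D E : KnotDiagram) : Prop :=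
  ∃ f : E.Dart ≃ D.Dart,
    (∀ e, f (E.next e) = D.next (f e)) ∧
    (∀ e, f (E.opp e) = D.opp (f e)) ∧
    SameOver D E f ∧
    D.SameFace (f E.outer) D.outer

/-- `E` arises from `D` by removing the subdivision point (vertex of degree 2) with the ends `a` and
`next a`, and joining its two neighbours by an edge. (The only vertex of a circle is not removed.) -/
def RemoveSubdivision (D E : KnotDiagram) : Prop :=
  ∃ (a : D.Dart) (f : E.Dart → D.Dart),
    ¬ D.IsCrossing a ∧ D.opp a ≠ D.next a ∧
    Function.Injective f ∧
    (∀ d, d ∈ Set.range f ↔ (d ≠ a ∧ d ≠ D.next a)) ∧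
    (∀ e, f (E.next e) = D.next (f e)) ∧
    (∀ e, D.opp (f e) ≠ a → D.opp (f e) ≠ D.next a → f (E.opp e) = D.opp (f e)) ∧
    (∀ e, D.opp (f e) = a → f (E.opp e) = D.opp (D.next a)) ∧
    (∀ e, D.opp (f e) = D.next a → f (E.opp e) = D.opp a) ∧
    SameOver D E f ∧
    D.SameFace (f E.outer) D.outer

/-- The untwist (decreasing Reidemeister move of type I). At the crossing with the ends
`a, b, c, d` in counterclockwise order, `a` and `b` are the two ends of a loop which bounds a face
(the face with the only corner `a`). The loop is removed, and the crossing becomes a subdivision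
point with the ends `c` and `d`. The last condition excludes that the face of the loop is the
unbounded face, since `a` is not in the range of `f`. -/
def Untwist (D E : KnotDiagram) : Prop :=
  ∃ (a b c d : D.Dart) (f : E.Dart → D.Dart),
    D.IsCrossing a ∧ b = D.next a ∧ c = D.next b ∧ d = D.next c ∧
    D.opp a = b ∧
    Function.Injective f ∧
    (∀ x, x ∈ Set.range f ↔ (x ≠ a ∧ x ≠ b)) ∧
    (∀ e, f (E.opp e) = D.opp (f e)) ∧
    (∀ e, f e = d → f (E.next e) = c) ∧
    (∀ e, f e ≠ d → f (E.next e) = D.next (f e)) ∧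
    SameOver D E f ∧
    D.SameFace (f E.outer) D.outer

/-- The unpoke (decreasing Reidemeister move of type II). There are two different crossings, with the
ends `a, b, p, q` and `b', a', q', p'` in counterclockwise order, where `a, a'` are the two ends of an
edge, and `b, b'` are the two ends of an edge, so that these edges bound a face (with the corners `a`
and `b'`). The strand `p a a' p'` is over at both crossings or under at both crossings, and so the
strand `q b b' q'` is under, respectively over, at both. The two strands are pulled apart: the edges
are removed, and the crossings are replaced by a subdivision point with the ends `p, p'` and a
subdivision point with the ends `q, q'`. The last condition excludes that the face with the corners
`a` and `b'` is the unbounded face, since these are not in the range of `f`. -/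
def Unpoke (D E : KnotDiagram) : Prop :=
  ∃ (a b p q a' b' p' q' : D.Dart) (f : E.Dart → D.Dart),
    D.IsCrossing a ∧ b = D.next a ∧ p = D.next b ∧ q = D.next p ∧
    D.IsCrossing b' ∧ a' = D.next b' ∧ q' = D.next a' ∧ p' = D.next q' ∧
    D.vert a ≠ D.vert a' ∧
    D.opp a = a' ∧ D.opp b = b' ∧
    D.isOver a = D.isOver a' ∧
    Function.Injective f ∧
    (∀ x, x ∈ Set.range f ↔ (x ≠ a ∧ x ≠ b ∧ x ≠ a' ∧ x ≠ b')) ∧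
    (∀ e, f (E.opp e) = D.opp (f e)) ∧
    (∀ e, f e = p → f (E.next e) = p') ∧
    (∀ e, f e = p' → f (E.next e) = p) ∧
    (∀ e, f e = q → f (E.next e) = q') ∧
    (∀ e, f e = q' → f (E.next e) = q) ∧
    (∀ e, f e ≠ p → f e ≠ p' → f e ≠ q → f e ≠ q' → f (E.next e) = D.next (f e)) ∧
    SameOver D E f ∧
    D.SameFace (f E.outer) D.outer

/-- The slide (Reidemeister move of type III). Three different crossings, with the ends
`a i, b i, c i, d i` in counterclockwise order (`i : Fin 3`), are the corners of a triangular face,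
where `a i` and `b (i + 1)` are the two ends of an edge. The strand through `a 0` and `b 1` is over
at both crossings. After the slide, every one of the three strands meets the two other ones in the
opposite order, while the rotation and the over/under information at every crossing stay the same:
on the strand through the crossings `i` and `i + 1`, the end `c i` trades places with `b (i + 1)`,
and `a i` trades places with `d (i + 1)`; this involution of the darts is `t`. The unbounded face is
marked by a corner that does not belong to one of the three crossings (add a subdivision point if
there is none); such a face is not the triangle. -/
def Slide (D E : KnotDiagram) : Prop :=
  ∃ (a b c d : Fin 3 → D.Dart) (t : Equiv.Perm D.Dart) (f : E.Dart ≃ D.Dart),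
    (∀ i, D.IsCrossing (a i)) ∧
    (∀ i, b i = D.next (a i)) ∧ (∀ i, c i = D.next (b i)) ∧ (∀ i, d i = D.next (c i)) ∧
    (∀ i j, i ≠ j → D.vert (a i) ≠ D.vert (a j)) ∧
    (∀ i, D.opp (a i) = b (i + 1)) ∧
    D.isOver (a 0) = true ∧ D.isOver (b 1) = true ∧
    (∀ i, t (c i) = b (i + 1) ∧ t (b (i + 1)) = c i ∧
      t (a i) = d (i + 1) ∧ t (d (i + 1)) = a i) ∧
    (∀ x, (∀ i, x ≠ a i ∧ x ≠ b i ∧ x ≠ c i ∧ x ≠ d i) → t x = x) ∧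
    (∀ e, f (E.next e) = D.next (f e)) ∧
    (∀ e, f (E.opp e) = t (D.opp (t (f e)))) ∧
    SameOver D E f ∧
    (∀ i, f E.outer ≠ a i ∧ f E.outer ≠ b i ∧ f E.outer ≠ c i ∧ f E.outer ≠ d i) ∧
    D.SameFace (f E.outer) D.outer

/-- Two descriptions of the same plane curve: `D` and `E` differ by an isotopy of the plane, or by
adding or removing one subdivision point. -/
def SameCurve (D E : KnotDiagram) : Prop :=
  Isotopic D E ∨ RemoveSubdivision D E ∨ RemoveSubdivision E D

/-- One Reidemeister move of type I (twist or untwist) or II (poke or unpoke). -/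
def TwistPokeMove (D E : KnotDiagram) : Prop :=
  Untwist D E ∨ Untwist E D ∨ Unpoke D E ∨ Unpoke E D

/-- One Reidemeister move, of type I, II or III. -/
def ReidemeisterMove (D E : KnotDiagram) : Prop :=
  TwistPokeMove D E ∨ Slide D E ∨ Slide E D

/-- Equivalence of diagrams by finite sequences of Reidemeister moves. -/
def Equivalent : KnotDiagram → KnotDiagram → Prop :=
  Relation.ReflTransGen (fun D E => SameCurve D E ∨ ReidemeisterMove D E)

/-- A diagram of the unknot: it is equivalent to a diagram without crossings. -/
def IsUnknot (D : KnotDiagram) : Prop := ∃ E : KnotDiagram, E.IsTrivial ∧ Equivalent D E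

/-- `TwistPokeSequence k D E`: the diagram `E` is obtained from `D` by a sequence of exactly `k`
(un)twist and (un)poke moves. Isotopies of the plane, and adding or removing subdivision points, do
not count as moves. -/
inductive TwistPokeSequence : ℕ → KnotDiagram → KnotDiagram → Prop
  | refl (D : KnotDiagram) : TwistPokeSequence 0 D D
  | same {k : ℕ} {D E F : KnotDiagram} :
      SameCurve D E → TwistPokeSequence k E F → TwistPokeSequence k D F
  | move {k : ℕ} {D E F : KnotDiagram} :
      TwistPokeMove D E → TwistPokeSequence k E F → TwistPokeSequence (k + 1) D F

end KnotDiagram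

/-! Subdivision points can be removed freely, so the diagram may be taken to be a 4-regular plane
graph. If it has treewidth at most 2, it has a twist face (`PlanarPiece.hasTwistFace`): a face with
`m` corners at distinct crossings, all of whose edges but one border bigons. In other words, it is a
chain of `m - 1` bigons closed up by one edge. The face and its bigons can be kept away from any
prescribed edge, here the edge of the outer corner, so that the moves below are legal in the plane.

If `m = 1`, the face is a loop and can be untwisted. If some bigon has the same strand on top at
both crossings, it can be unpoked. Otherwise the chain alternates and carries a nonconstant Fox
coloring modulo `m` that is constant on the rest of the diagram (`IsTwistFace.isColorable`): the
colors along the chain form an arithmetic progression, which closes up modulo `m`. Colorability is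
invariant under all Reidemeister moves, slides included, and a circle is not colorable, so this case
cannot occur for the unknot (`IsUnknot.not_isColorable`). Every move used removes a crossing, whence
the bound.

For the recursion the width must not grow. An unpoke is therefore made next to a second bigon of the
chain; the new graph then arises by contracting the two crossings into a common neighbor
(`IsUnpokeMap.hasTreeModel`). A chain with a single bigon does not occur in a knot, because its face
would carry a strand of its own (`IsTwistFace.next_opp_next_opp_ne`).

The twist face is found by induction. A tree decomposition rooted at the prescribed edge yields a
vertex `z` off that edge whose at most two other neighbors lie in a common bag
(`IsTreeModel.simplicialCover`). A loop at `z`, or three edges to one neighbor, gives a twist face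
directly. Otherwise two consecutive edges go to each of two neighbors. If one of these pairs does
not bound a bigon, some part of the graph hangs on by two edges only, and one recurses into it
(`PlanarPiece.cut`). If both do, `z` is deleted, its edges are spliced, and the face found in the
smaller graph is lifted (`PlanarPiece.smooth`, `hasTwistFace_of_smooth`).

Planarity is given as Euler's formula but used as the Jordan curve theorem modulo 2. The two are
equivalent for connected rotation systems (`euler_iff_jordan`). One direction serves to argue about
curves, the other to verify that the diagrams produced by the moves are planar. -/

set_option linter.unusedSimpArgs false

/-! ### Euler's formula as a Jordan curve theorem modulo 2. -/

section EulerFormula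

variable {α : Type*}

/-- Functions that are constant on the cycles of a permutation. -/
def cycleFun (σ : Equiv.Perm α) : Submodule (ZMod 2) (α → ZMod 2) where
  carrier := {x | ∀ d, x (σ d) = x d}
  add_mem' := by intro x y hx hy d; simp [hx d, hy d]
  zero_mem' := by intro d; rfl
  smul_mem' := by intro c x hx d; simp [hx d]

theorem eq_of_sameCycle {β : Type*} {σ : Equiv.Perm α} {x : α → β} (hx : ∀ d, x (σ d) = x d)
    {d d' : α} (h : σ.SameCycle d d') : x d = x d' := by
  obtain ⟨i, rfl⟩ := h
  induction i using Int.induction_on with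
  | zero => simp
  | succ i ih => rw [add_comm, zpow_add, Equiv.Perm.mul_apply, zpow_one, hx]; exact ih
  | pred i ih =>
    rw [ih, ← hx ((σ ^ (-(i : ℤ) - 1)) d), ← Equiv.Perm.mul_apply, ← zpow_one_add]
    congr 2; ring_nf

/-- Functions that are constant on the cycles are functions on the set of cycles. -/
def cycleFunEquiv (σ : Equiv.Perm α) :
    (Quotient (Equiv.Perm.SameCycle.setoid σ) → ZMod 2) ≃ₗ[ZMod 2] cycleFun σ where
  toFun g := ⟨fun d => g (Quotient.mk _ d), fun d => congrArg g (Quotient.sound ⟨-1, by simp⟩)⟩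
  invFun x := Quotient.lift x.1 (fun _ _ h => eq_of_sameCycle x.2 h)
  map_add' _ _ := rfl
  map_smul' _ _ := rfl
  left_inv g := by
    funext q
    induction q using Quotient.inductionOn
    rfl
  right_inv x := rfl

theorem finrank_cycleFun [Finite α] (σ : Equiv.Perm α) :
    Module.finrank (ZMod 2) (cycleFun σ) =
      Nat.card (Quotient (Equiv.Perm.SameCycle.setoid σ)) := by
  classical
  have := Fintype.ofFinite (Quotient (Equiv.Perm.SameCycle.setoid σ))
  rw [← (cycleFunEquiv σ).finrank_eq, Module.finrank_fintype_fun_eq_card, Nat.card_eq_fintype_card]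

/-- The difference of the values of a function at the two corners beside a dart. -/
def cornerDiff (nx : Equiv.Perm α) : (α → ZMod 2) →ₗ[ZMod 2] (α → ZMod 2) where
  toFun h d := h d + h (nx⁻¹ d)
  map_add' _ _ := by funext d; simp only [Pi.add_apply]; ring
  map_smul' _ _ := by funext d; simp [mul_add]

open Classical in
/-- The sum of a function over the darts at a vertex. -/
noncomputable def vertexSum [Fintype α] (nx : Equiv.Perm α) :
    (α → ZMod 2) →ₗ[ZMod 2] (α → ZMod 2) where
  toFun x d := ∑ d' with nx.SameCycle d d', x d'
  map_add' _ _ := by funext d; simp [Finset.sum_add_distrib]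
  map_smul' _ _ := by funext d; simp [Finset.mul_sum]

open Classical in
theorem vertexSum_apply_next [Fintype α] (nx : Equiv.Perm α) (x : α → ZMod 2) (d : α) :
    vertexSum nx x (nx d) = vertexSum nx x d := by
  exact Finset.sum_congr (Finset.filter_congr fun _ _ => Equiv.Perm.sameCycle_apply_left)
    fun _ _ => rfl

theorem vertexSum_comp_inv [Fintype α] (nx : Equiv.Perm α) (x : α → ZMod 2) :
    vertexSum nx (fun d => x (nx⁻¹ d)) = vertexSum nx x := by
  classical
  funext d
  simp only [vertexSum, LinearMap.coe_mk, AddHom.coe_mk]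
  refine Finset.sum_bij (fun a _ => nx⁻¹ a) ?_ ?_ ?_ ?_
  · intro a ha
    simp only [Finset.mem_filter, Finset.mem_univ, true_and] at ha ⊢
    exact Equiv.Perm.sameCycle_symm_apply_right.2 ha
  · intro a _ b _ h; exact nx⁻¹.injective h
  · intro b hb; exact ⟨nx b, by simpa using hb, by simp⟩
  · intro a _; rfl

theorem eq_of_eqvGen {β : Type*} {r : α → α → Prop} {f : α → β} (hf : ∀ x y, r x y → f x = f y)
    {x y : α} (h : Relation.EqvGen r x y) : f x = f y := by
  induction h with
  | rel x y h => exact hf x y h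
  | refl x => rfl
  | symm x y _ ih => exact ih.symm
  | trans x y z _ _ ih1 ih2 => exact ih1.trans ih2

theorem zmod_two_add_self (a : ZMod 2) : a + a = 0 := by grind

variable [Fintype α] (nx op : Equiv.Perm α) (op_op : ∀ d, op (op d) = d)
  (op_ne : ∀ d, op d ≠ d)
  (conn : ∀ d d', Relation.EqvGen (fun x y => y = op x ∨ y = nx x) d d')

include op_op in
-- Boundaries are cycles: the difference across an edge is the same from both ends, and around a
-- vertex every corner is counted twice.
theorem map_cornerDiff_le :
    (cycleFun (nx⁻¹ * op)).map (cornerDiff nx) ≤ cycleFun op ⊓ LinearMap.ker (vertexSum nx) := by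
  rintro _ ⟨h, hh, rfl⟩
  have hh : ∀ d, h (nx⁻¹ (op d)) = h d := hh
  refine ⟨fun d => ?_, ?_⟩
  · have := hh (op d)
    rw [op_op] at this
    simp only [cornerDiff, LinearMap.coe_mk, AddHom.coe_mk]
    rw [hh d, ← this, add_comm]
  · refine LinearMap.mem_ker.2 ?_
    have : cornerDiff nx h = h + fun d => h (nx⁻¹ d) := rfl
    rw [this, map_add, vertexSum_comp_inv]
    funext d
    exact zmod_two_add_self _

include conn in
-- A face function with zero differences is also constant around vertices, hence constant by
-- connectedness. The kernel is thus one-dimensional, and rank-nullity gives dimension `F - 1` for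
-- the boundaries.
theorem finrank_map_cornerDiff [Nonempty α] :
    Module.finrank (ZMod 2) ((cycleFun (nx⁻¹ * op)).map (cornerDiff nx)) + 1 =
      Nat.card (Quotient (Equiv.Perm.SameCycle.setoid (nx⁻¹ * op))) := by
  rw [← finrank_cycleFun]
  have h1 := LinearMap.finrank_range_add_finrank_ker
    ((cornerDiff nx).domRestrict (cycleFun (nx⁻¹ * op)))
  rw [LinearMap.range_domRestrict] at h1
  rw [← h1]
  congr 1
  symm
  let v : LinearMap.ker ((cornerDiff nx).domRestrict (cycleFun (nx⁻¹ * op))) :=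
    ⟨⟨fun _ => 1, fun _ => rfl⟩, LinearMap.mem_ker.2 (funext fun d => zmod_two_add_self _)⟩
  refine (finrank_eq_one_iff_of_nonzero' v ?_).2 ?_
  · intro h
    have h2 := congrFun (congrArg (fun w => w.1.1) h) (Classical.arbitrary α)
    exact one_ne_zero (α := ZMod 2) h2
  · rintro ⟨⟨h, hh⟩, hk⟩
    have hh : ∀ d, h (nx⁻¹ (op d)) = h d := hh
    have hk : ∀ d, h d + h (nx⁻¹ d) = 0 := fun d => congrFun (LinearMap.mem_ker.1 hk) d
    have hk' : ∀ d, h (nx d) = h d := fun d => by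
      have := hk (nx d)
      simp at this
      grind
    refine ⟨h (Classical.arbitrary α), ?_⟩
    ext d
    change h (Classical.arbitrary α) * 1 = h d
    rw [mul_one]
    refine (eq_of_eqvGen (f := h) ?_ (conn (Classical.arbitrary α) d))
    rintro x y (rfl | rfl)
    · rw [← hh x, ← hk' (nx⁻¹ (op x))]; simp
    · rw [hk']

open Classical in
/-- The indicator function of a vertex. -/
noncomputable def vertexInd (d : α) : α → ZMod 2 := fun d' => if nx.SameCycle d d' then 1 else 0

open Classical in
theorem vertexInd_next (d : α) : vertexInd nx (nx d) = vertexInd nx d := by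
  funext d'
  exact if_congr Equiv.Perm.sameCycle_apply_left rfl rfl

include op_op op_ne in
-- The preimage is the indicator of the single edge of `d`.
theorem vertexInd_add_vertexInd_op (d : α) :
    vertexInd nx d + vertexInd nx (op d) ∈ (cycleFun op).map (vertexSum nx) := by
  classical
  refine ⟨fun d' => if d' = d ∨ d' = op d then 1 else 0, fun d' => ?_, ?_⟩
  · have : op d' = d ↔ d' = op d := by
      constructor
      · rintro rfl; rw [op_op]
      · rintro rfl; rw [op_op]
    simp only [this, op.injective.eq_iff]
    simp only [or_comm]
  · funext d'
    have : ∀ c : α, (if c = d ∨ c = op d then (1 : ZMod 2) else 0) =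
        (if c = d then 1 else 0) + (if c = op d then 1 else 0) := by
      intro c
      by_cases h : c = d
      · subst h; simp [(op_ne c).symm]
      · simp [h]
    simp only [vertexSum, LinearMap.coe_mk, AddHom.coe_mk, this, Finset.sum_add_distrib]
    simp [vertexInd, Equiv.Perm.sameCycle_comm]

include op_op op_ne in
-- The vertex sums add up to the sum over all darts, in which the two ends of every edge cancel.
theorem sum_vertexSum_eq_zero (x : α → ZMod 2) (hx : x ∈ cycleFun op)
    [Fintype (Quotient (Equiv.Perm.SameCycle.setoid nx))] :
    ∑ q : Quotient (Equiv.Perm.SameCycle.setoid nx), vertexSum nx x q.out = 0 := by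
  classical
  have h1 : ∑ d, x d = 0 := by
    refine Finset.sum_involution (fun a _ => op a) ?_ ?_ ?_ ?_
    · intro a _; rw [hx a]; exact zmod_two_add_self _
    · intro a _ _; exact op_ne a
    · intro a _; exact Finset.mem_univ _
    · intro a _; exact op_op a
  rw [← h1, ← Finset.sum_fiberwise Finset.univ
    (fun d => (Quotient.mk (Equiv.Perm.SameCycle.setoid nx) d)) x]
  refine Finset.sum_congr rfl fun q _ => ?_
  simp only [vertexSum, LinearMap.coe_mk, AddHom.coe_mk]
  refine Finset.sum_congr ?_ fun _ _ => rfl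
  ext d
  simp only [Finset.mem_filter, Finset.mem_univ, true_and]
  constructor
  · intro h; rw [← Quotient.out_eq q]; exact (Quotient.sound h).symm
  · rintro rfl; exact Quotient.mk_out (s := Equiv.Perm.SameCycle.setoid nx) d

include op_op op_ne conn in
-- Along a path, vertex indicators agree modulo the image, so the image and one indicator span all
-- vertex functions. That indicator has total 1 and lies outside the image, whose elements have
-- total 0. Hence the image has dimension `V - 1`.
theorem finrank_map_vertexSum [Nonempty α] :
    Module.finrank (ZMod 2) ((cycleFun op).map (vertexSum nx)) + 1 =
      Nat.card (Quotient (Equiv.Perm.SameCycle.setoid nx)) := by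
  classical
  have := Fintype.ofFinite (Quotient (Equiv.Perm.SameCycle.setoid nx))
  set R := (cycleFun op).map (vertexSum nx) with hR
  let d0 : α := Classical.arbitrary α
  have hmem : vertexInd nx d0 ∉ R := by
    rintro ⟨x, hx, hx'⟩
    have h1 := sum_vertexSum_eq_zero nx op op_op op_ne x hx
    rw [hx'] at h1
    rw [Finset.sum_eq_single (Quotient.mk (Equiv.Perm.SameCycle.setoid nx) d0)] at h1
    · have : nx.SameCycle d0 (Quotient.mk (Equiv.Perm.SameCycle.setoid nx) d0).out :=
        (Quotient.mk_out (s := Equiv.Perm.SameCycle.setoid nx) d0).symm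
      simp [vertexInd, this] at h1
    · intro q _ hq
      have : ¬ nx.SameCycle d0 q.out := by
        intro h
        apply hq
        rw [← Quotient.out_eq q]
        exact (Quotient.sound h).symm
      simp [vertexInd, this]
    · simp
  have hall : ∀ d, vertexInd nx d ∈ R ⊔ Submodule.span (ZMod 2) {vertexInd nx d0} := by
    intro d
    have h0 : ∀ {x y}, Relation.EqvGen (fun x y => y = op x ∨ y = nx x) x y →
        vertexInd nx x + vertexInd nx y ∈ R := by
      intro x y h
      induction h with
      | rel x y h =>
        rcases h with rfl | rfl
        · exact vertexInd_add_vertexInd_op nx op op_op op_ne x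
        · rw [vertexInd_next]
          convert R.zero_mem
          funext d; exact zmod_two_add_self _
      | refl x =>
        convert R.zero_mem
        funext d; exact zmod_two_add_self _
      | symm x y _ ih => rw [add_comm]; exact ih
      | trans x y z _ _ h1 h2 =>
        convert R.add_mem h1 h2 using 1
        funext d
        simp only [Pi.add_apply]
        grind
    rw [Submodule.mem_sup]
    refine ⟨_, h0 (conn d d0), vertexInd nx d0, Submodule.mem_span_singleton_self _, ?_⟩
    funext d
    simp only [Pi.add_apply]
    grind
  have hsup : R ⊔ Submodule.span (ZMod 2) {vertexInd nx d0} = cycleFun nx := by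
    apply le_antisymm
    · refine sup_le ?_ ?_
      · rintro _ ⟨x, _, rfl⟩ d
        exact vertexSum_apply_next nx x d
      · rw [Submodule.span_singleton_le_iff_mem]
        intro d
        simp [vertexInd, Equiv.Perm.sameCycle_apply_right]
    · intro y hy
      have : y = ∑ q : Quotient (Equiv.Perm.SameCycle.setoid nx), y q.out • vertexInd nx q.out := by
        funext d
        rw [Finset.sum_apply,
          Finset.sum_eq_single (Quotient.mk (Equiv.Perm.SameCycle.setoid nx) d)]
        · have h1 : nx.SameCycle (Quotient.mk (Equiv.Perm.SameCycle.setoid nx) d).out d :=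
            Quotient.mk_out (s := Equiv.Perm.SameCycle.setoid nx) d
          simp [vertexInd, h1, eq_of_sameCycle hy h1]
        · intro q _ hq
          have : ¬ nx.SameCycle q.out d := by
            intro h
            apply hq
            rw [← Quotient.out_eq q]
            exact (Quotient.sound h)
          simp [vertexInd, this]
        · simp
      rw [this]
      exact Submodule.sum_mem _ fun q _ => Submodule.smul_mem _ _ (hall _)
  have hdisj : R ⊓ Submodule.span (ZMod 2) {vertexInd nx d0} = ⊥ := by
    rw [eq_bot_iff]
    rintro y ⟨hy, hy'⟩
    obtain ⟨c, rfl⟩ := Submodule.mem_span_singleton.1 hy'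
    have : c = 0 ∨ c = 1 := by clear hy hy'; revert c; decide
    rcases this with rfl | rfl
    · simp
    · rw [one_smul] at hy; exact absurd hy hmem
  have h1 := Submodule.finrank_sup_add_finrank_inf_eq R
    (Submodule.span (ZMod 2) {vertexInd nx d0})
  rw [hsup, hdisj, finrank_bot, finrank_cycleFun, finrank_span_singleton] at h1
  · omega
  · intro h; rw [h] at hmem; exact hmem R.zero_mem

include op_op op_ne conn in
/-- A connected rotation system satisfies Euler's formula if and only if it satisfies the Jordan
curve theorem modulo 2: every set of edges that is even at all vertices is a boundary of a set of
faces. -/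
theorem euler_iff_jordan [Nonempty α] :
    Nat.card (Quotient (Equiv.Perm.SameCycle.setoid nx)) +
        Nat.card (Quotient (Equiv.Perm.SameCycle.setoid (nx⁻¹ * op))) =
      Nat.card (Quotient (Equiv.Perm.SameCycle.setoid op)) + 2 ↔
    ∀ x : α → ZMod 2, (∀ d, x (op d) = x d) → (∀ d, vertexSum nx x d = 0) →
      ∃ h : α → ZMod 2, (∀ d, h (nx⁻¹ (op d)) = h d) ∧ ∀ d, h d + h (nx⁻¹ d) = x d := by
  -- The cycles have dimension `E - (V - 1)` and contain the boundaries, of dimension `F - 1`;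
  -- Euler's formula says exactly that the two dimensions agree.
  have hF := finrank_map_cornerDiff nx op conn
  have hV := finrank_map_vertexSum nx op op_op op_ne conn
  have hE := finrank_cycleFun op
  have h1 := LinearMap.finrank_range_add_finrank_ker ((vertexSum nx).domRestrict (cycleFun op))
  rw [LinearMap.range_domRestrict] at h1
  have h2 : Module.finrank (ZMod 2) (LinearMap.ker ((vertexSum nx).domRestrict (cycleFun op))) =
      Module.finrank (ZMod 2) (cycleFun op ⊓ LinearMap.ker (vertexSum nx) :
        Submodule (ZMod 2) (α → ZMod 2)) := by
    rw [← Submodule.finrank_map_subtype_eq, LinearMap.ker_domRestrict,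
      Submodule.map_comap_subtype]
  rw [h2] at h1
  have hle := map_cornerDiff_le nx op op_op
  constructor
  · intro h x hx hx'
    have heq := Submodule.eq_of_le_of_finrank_eq hle (by omega)
    have hmem : x ∈ cycleFun op ⊓ LinearMap.ker (vertexSum nx) :=
      ⟨hx, LinearMap.mem_ker.2 (funext hx')⟩
    rw [← heq] at hmem
    obtain ⟨h, hh, rfl⟩ := hmem
    exact ⟨h, hh, fun d => rfl⟩
  · intro h
    have heq : (cycleFun (nx⁻¹ * op)).map (cornerDiff nx) =
        cycleFun op ⊓ LinearMap.ker (vertexSum nx) := by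
      refine le_antisymm hle ?_
      rintro x ⟨hx, hx'⟩
      obtain ⟨g, hg, hg'⟩ := h x hx (fun d => congrFun (LinearMap.mem_ker.1 hx') d)
      exact ⟨g, hg, funext hg'⟩
    rw [heq] at hF
    omega

end EulerFormula

/-! ### The Jordan curve theorem for vertices of degrees 2 and 4. -/

section DegreeTwoFour

variable {α : Type*}

/-- The Jordan curve theorem modulo 2 for a rotation system with vertices of degrees 2 and 4: every
even set of edges, with indicator function `x`, separates the faces into two classes. -/
def JordanCurve (nx op : α → α) : Prop :=
  ∀ x : α → ZMod 2, (∀ d, x (op d) = x d) →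
    (∀ d, nx (nx d) ≠ d → x d + x (nx d) + x (nx (nx d)) + x (nx (nx (nx d))) = 0) →
    (∀ d, nx (nx d) = d → x d + x (nx d) = 0) →
    ∃ h : α → ZMod 2, ∀ d, h (op (nx d)) = h d ∧ h (nx d) + h d = x (nx d)

variable {nx : Equiv.Perm α} (ne : ∀ d, nx d ≠ d) (four : ∀ d, nx (nx (nx (nx d))) = d)

include four in
theorem sameCycle_iff_of_four {d d' : α} :
    nx.SameCycle d d' ↔ d' = d ∨ d' = nx d ∨ d' = nx (nx d) ∨ d' = nx (nx (nx d)) := by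
  constructor
  · intro h
    have h1 := eq_of_sameCycle
      (x := fun c => (c = d ∨ c = nx d ∨ c = nx (nx d) ∨ c = nx (nx (nx d)))) (σ := nx) ?_ h
    · simpa using h1
    · intro c
      simp only [eq_iff_iff]
      constructor
      · rintro (h | h | h | h)
        · right; right; right; apply nx.injective; rw [four, h]
        · left; exact nx.injective h
        · right; left; exact nx.injective h
        · right; right; left; exact nx.injective h
      · rintro (h | h | h | h) <;> simp [h, four]
  · rintro (rfl | rfl | rfl | rfl)
    · exact Equiv.Perm.SameCycle.refl _ _
    · simp [Equiv.Perm.SameCycle.refl]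
    · simp [Equiv.Perm.SameCycle.refl]
    · simp [Equiv.Perm.SameCycle.refl]

include ne four in
theorem vertexSum_of_crossing [Fintype α] (x : α → ZMod 2) {d : α} (h : nx (nx d) ≠ d) :
    vertexSum nx x d = x d + x (nx d) + x (nx (nx d)) + x (nx (nx (nx d))) := by
  classical
  have h3 : nx (nx (nx d)) ≠ d := fun h3 => by
    have := four d
    rw [h3] at this
    exact ne d this
  have : vertexSum nx x d = ∑ d' ∈ ({d, nx d, nx (nx d), nx (nx (nx d))} : Finset α), x d' := by
    simp only [vertexSum, LinearMap.coe_mk, AddHom.coe_mk]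
    refine Finset.sum_congr ?_ fun _ _ => rfl
    ext d'
    simp [sameCycle_iff_of_four four]
  rw [this, Finset.sum_insert, Finset.sum_insert, Finset.sum_insert, Finset.sum_singleton]
  · ring
  · simpa using (ne _).symm
  · simpa using ⟨(ne _).symm, fun e => h e.symm⟩
  · simpa using ⟨(ne _).symm, fun e => h e.symm, fun e => h3 e.symm⟩

include ne four in
theorem vertexSum_of_not_crossing [Fintype α] (x : α → ZMod 2) {d : α} (h : nx (nx d) = d) :
    vertexSum nx x d = x d + x (nx d) := by
  classical
  have : vertexSum nx x d = ∑ d' ∈ ({d, nx d} : Finset α), x d' := by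
    simp only [vertexSum, LinearMap.coe_mk, AddHom.coe_mk]
    refine Finset.sum_congr ?_ fun _ _ => rfl
    ext d'
    simp [sameCycle_iff_of_four four, h]
    tauto
  rw [this, Finset.sum_insert, Finset.sum_singleton]
  simpa using (ne _).symm

include ne four in
theorem euler_iff_jordanCurve [Finite α] [Nonempty α] (op : Equiv.Perm α)
    (op_op : ∀ d, op (op d) = d) (op_ne : ∀ d, op d ≠ d)
    (conn : ∀ d d', Relation.EqvGen
      (fun x y => y = op x ∨ (nx (nx x) = x ∧ y = nx x) ∨ (nx (nx x) ≠ x ∧ y = nx (nx x))) d d') :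
    Nat.card (Quotient (Equiv.Perm.SameCycle.setoid nx)) +
        Nat.card (Quotient (Equiv.Perm.SameCycle.setoid (nx⁻¹ * op))) =
      Nat.card (Quotient (Equiv.Perm.SameCycle.setoid op)) + 2 ↔ JordanCurve nx op := by
  have := Fintype.ofFinite α
  have conn' : ∀ d d', Relation.EqvGen (fun x y => y = op x ∨ y = nx x) d d' := by
    intro d d'
    induction conn d d' with
    | rel x y h =>
      rcases h with h | ⟨_, h⟩ | ⟨_, h⟩
      · exact .rel _ _ (Or.inl h)
      · exact .rel _ _ (Or.inr h)
      · exact .trans _ _ _ (.rel _ (nx x) (Or.inr rfl)) (.rel _ _ (Or.inr h))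
    | refl x => exact .refl _
    | symm x y _ ih => exact .symm _ _ ih
    | trans x y z _ _ ih1 ih2 => exact .trans _ _ _ ih1 ih2
  rw [euler_iff_jordan nx op op_op op_ne conn']
  refine forall_congr' fun x => forall_congr' fun hx => ?_
  -- The substitution of `nx d` for `d` removes the inverse, so that `JordanCurve` makes sense for
  -- plain functions.
  have key : (∃ h : α → ZMod 2, (∀ d, h (nx⁻¹ (op d)) = h d) ∧ ∀ d, h d + h (nx⁻¹ d) = x d) ↔
      ∃ h : α → ZMod 2, ∀ d, h (op (nx d)) = h d ∧ h (nx d) + h d = x (nx d) := by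
    refine exists_congr fun h => ⟨fun ⟨h1, h2⟩ d => ⟨?_, ?_⟩, fun h1 => ⟨fun d => ?_, fun d => ?_⟩⟩
    · have := h1 (op (nx d))
      rw [op_op] at this
      simpa using this.symm
    · simpa using h2 (nx d)
    · have := (h1 (nx⁻¹ (op d))).1
      simpa [op_op] using this.symm
    · simpa using (h1 (nx⁻¹ d)).2
  rw [key]
  constructor
  · intro H h1 h2
    apply H
    intro d
    by_cases hd : nx (nx d) = d
    · rw [vertexSum_of_not_crossing ne four x hd, h2 d hd]
    · rw [vertexSum_of_crossing ne four x hd, h1 d hd]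
  · intro H h1
    apply H
    · intro d hd
      rw [← vertexSum_of_crossing ne four x hd, h1]
    · intro d hd
      rw [← vertexSum_of_not_crossing ne four x hd, h1]

end DegreeTwoFour

theorem KnotDiagram.jordanCurve (D : KnotDiagram) : JordanCurve D.next D.opp :=
  have := D.finite
  have : Nonempty D.Dart := ⟨D.outer⟩
  (euler_iff_jordanCurve D.next_ne D.next_four D.opp D.opp_opp D.opp_ne D.one_strand).1 D.euler

/-! ### Four-regular planar pieces: parity, loops and parallel edges. -/

section TwistRegions

variable {α V : Type*}

/-- The darts of a 4-regular map, with the rotation `n` and the labelling `μ` by the vertices. -/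
structure FourRegular (n : α → α) (μ : α → V) : Prop where
  four : ∀ d, n (n (n (n d))) = d
  ne_one : ∀ d, n d ≠ d
  ne_two : ∀ d, n (n d) ≠ d
  label_next : ∀ d, μ (n d) = μ d
  eq_of_label : ∀ d d', μ d' = μ d → d' = d ∨ d' = n d ∨ d' = n (n d) ∨ d' = n (n (n d))

/-- A set `S` of darts of a 4-regular map, which is a union of vertices, with a pairing `o` of these
darts into edges such that the Jordan curve theorem modulo 2 holds, and with a root dart `e`. -/
structure PlanarPiece (n : α → α) (μ : α → V) (share : V → V → Prop) (S : Finset α) (o : α → α)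
    (e : α) : Prop where
  next_mem : ∀ d ∈ S, n d ∈ S
  opp_mem : ∀ d ∈ S, o d ∈ S
  opp_opp : ∀ d ∈ S, o (o d) = d
  opp_ne : ∀ d ∈ S, o d ≠ d
  root_mem : e ∈ S
  share_opp : ∀ d ∈ S, share (μ d) (μ (o d))
  jordan : ∀ x : α → ZMod 2, (∀ d ∈ S, x (o d) = x d) →
    (∀ d ∈ S, x d + x (n d) + x (n (n d)) + x (n (n (n d))) = 0) →
    ∃ h : α → ZMod 2, ∀ d ∈ S, h (o d) = h (n (n (n d))) ∧ h d + h (n (n (n d))) = x d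

/-- A face `F` all of whose edges, except possibly the edge of `u`, are adjacent to bigons, while
neither `F` nor these bigons are adjacent to the root edge; moreover the corners of `F` are at
different vertices. -/
def HasTwistFace (n : α → α) (μ : α → V) (S : Finset α) (o : α → α) (e : α) : Prop :=
  ∃ F : Set α, ∃ u ∈ F,
    (∀ c ∈ F, c ∈ S ∧ c ≠ e ∧ c ≠ o e ∧ n (o c) ∈ F) ∧
    (∀ c ∈ F, c ≠ u → n (o (n c)) = o c ∧ n c ≠ e ∧ n c ≠ o e) ∧
    (∀ c ∈ F, ∀ c' ∈ F, μ c = μ c' → c = c')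

theorem card_cast_eq_zero_of_involution (s : Finset α) (g : α → α) (hmem : ∀ d ∈ s, g d ∈ s)
    (hinv : ∀ d ∈ s, g (g d) = d) (hne : ∀ d ∈ s, g d ≠ d) : (s.card : ZMod 2) = 0 := by
  have h : ∑ d ∈ s, (1 : ZMod 2) = 0 :=
    Finset.sum_involution (fun d _ => g d) (fun _ _ => zmod_two_add_self _)
      (fun d hd _ => hne d hd) hmem hinv
  simpa using h

variable {n : α → α} {μ : α → V} {share : V → V → Prop} {S : Finset α} {o : α → α} {e : α}

namespace FourRegular

variable (H : FourRegular n μ)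
include H

theorem ne_three (d : α) : n (n (n d)) ≠ d := fun h => by
  have h1 := H.four d
  rw [h] at h1
  exact H.ne_one d h1

theorem injective : Function.Injective n := fun a b h => by
  rw [← H.four a, ← H.four b, h]

theorem label_two (d : α) : μ (n (n d)) = μ d := by rw [H.label_next, H.label_next]

theorem label_three (d : α) : μ (n (n (n d))) = μ d := by rw [H.label_next, H.label_two]

/-- The sum over the darts of a vertex of the indicator function of a dart. -/
theorem sum_indicator [DecidableEq α] [DecidableEq V] (c d : α) :
    (if d = c then (1 : ZMod 2) else 0) + (if n d = c then 1 else 0) +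
      (if n (n d) = c then 1 else 0) + (if n (n (n d)) = c then 1 else 0) =
    if μ d = μ c then 1 else 0 := by
  have h1 := H.ne_one
  have h2 := H.ne_two
  have h3 := H.ne_three
  have h4 := H.four
  by_cases h : μ d = μ c
  · rcases H.eq_of_label d c h.symm with rfl | rfl | rfl | rfl
    · simp [h1, h2, h3]
    · simp [h1, h2, h3, (h1 _).symm, H.label_next]
    · simp [h1, h2, h3, (h1 _).symm, (h2 _).symm, H.label_next]
    · simp [h1, h2, h3, (h1 _).symm, (h2 _).symm, (h3 _).symm, H.label_next]
  · have h1 : d ≠ c := fun e => h (by rw [e])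
    have h2 : n d ≠ c := fun e => h (by rw [← e, H.label_next])
    have h3 : n (n d) ≠ c := fun e => h (by rw [← e, H.label_two])
    have h4 : n (n (n d)) ≠ c := fun e => h (by rw [← e, H.label_three])
    simp [h, h1, h2, h3, h4]

/-- The involution `n ∘ n` makes the size of `I` even, and `o` makes that of `insert t I` even. In
the applications `I` holds the vertices strictly on one side of a closed curve, and `t` is the only
end on the curve that points to this side. -/
theorem parity_contradiction [DecidableEq α] (I : Finset α) (t : α) (ht : t ∉ I)
    (hn : ∀ d ∈ I, n d ∈ I) (ho : ∀ d ∈ insert t I, o d ∈ insert t I)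
    (ho' : ∀ d ∈ insert t I, o (o d) = d ∧ o d ≠ d) : False := by
  have h1 := card_cast_eq_zero_of_involution I (fun d => n (n d)) (fun d hd => hn _ (hn _ hd))
    (fun d _ => H.four d) (fun d _ => H.ne_two d)
  have h2 := card_cast_eq_zero_of_involution (insert t I) o ho (fun d hd => (ho' d hd).1)
    (fun d hd => (ho' d hd).2)
  rw [Finset.card_insert_of_notMem ht] at h2
  push_cast at h2
  rw [h1, zero_add] at h2
  exact one_ne_zero h2

end FourRegular

namespace PlanarPiece

variable (H : FourRegular n μ) (P : PlanarPiece n μ share S o e)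
include P

theorem opp_eq_iff {c d : α} (hc : c ∈ S) (hd : d ∈ S) : o d = c ↔ d = o c :=
  ⟨fun h => by rw [← h, P.opp_opp d hd], fun h => by rw [h, P.opp_opp c hc]⟩

include H

/-- The Jordan curve theorem for a pair of edges, where each end of one edge is at the same vertex
as some end of the other one. -/
theorem jordan_double [DecidableEq α] {a b : α} (ha : a ∈ S) (hb : b ∈ S) (h1 : μ b = μ a)
    (h2 : μ (o b) = μ (o a)) : ∃ h : α → ZMod 2, ∀ d ∈ S, h (o d) = h (n (n (n d))) ∧
      h d + h (n (n (n d))) = (if d = a then 1 else 0) + (if d = o a then 1 else 0) +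
        ((if d = b then 1 else 0) + (if d = o b then 1 else 0)) := by
  classical
  apply P.jordan
  · intro d hd
    simp only [P.opp_eq_iff ha hd, P.opp_eq_iff hb hd, P.opp_eq_iff (P.opp_mem a ha) hd,
      P.opp_eq_iff (P.opp_mem b hb) hd, P.opp_opp a ha, P.opp_opp b hb]
    ring
  · intro d _
    have e1 := H.sum_indicator a d
    have e2 := H.sum_indicator (o a) d
    have e3 := H.sum_indicator b d
    have e4 := H.sum_indicator (o b) d
    rw [h1] at e3
    rw [h2] at e4
    grind

/-- Such a loop would separate the two remaining ends at its vertex, leaving a single end on either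
side, against parity. -/
theorem opp_ne_next_next [DecidableEq α] {a : α} (ha : a ∈ S) : o a ≠ n (n a) := by
  classical
  intro hoa
  have hl : μ (o a) = μ a := by rw [hoa, H.label_two]
  have hfour := H.four
  obtain ⟨h, hh⟩ : ∃ h : α → ZMod 2, ∀ d ∈ S, h (o d) = h (n (n (n d))) ∧
      h d + h (n (n (n d))) = (if d = a then 1 else 0) + (if d = o a then 1 else 0) := by
    apply P.jordan
    · intro d hd
      simp only [P.opp_eq_iff ha hd, P.opp_eq_iff (P.opp_mem a ha) hd, P.opp_opp a ha]
      ring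
    · intro d _
      have e1 := H.sum_indicator a d
      have e2 := H.sum_indicator (o a) d
      rw [hl] at e2
      grind
  rw [hoa] at hh
  have hb := P.next_mem a ha
  have hc := P.next_mem _ hb
  have hd := P.next_mem _ hc
  have e0 := (hh a ha).2
  have e1 := (hh _ hb).2
  have e2 := (hh _ hc).2
  have e3 := (hh _ hd).2
  have n1 := H.ne_one
  have n2 := H.ne_two
  have n3 := H.ne_three
  simp [hfour, n1, n2, n3, (n1 _).symm, (n2 _).symm, (n3 _).symm] at e0 e1 e2 e3
  -- The side of the loop that contains the corner `a`; the only end at `μ a` pointing there is `n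
  -- a`.
  refine H.parity_contradiction (o := o) {d ∈ S | μ d ≠ μ a ∧ h d = h a} (n a) ?_ ?_ ?_ ?_
  · simp [H.label_next]
  · intro d hd
    simp only [Finset.mem_filter] at hd ⊢
    obtain ⟨hd, hd1, hd2⟩ := hd
    refine ⟨P.next_mem d hd, by rwa [H.label_next], ?_⟩
    have := (hh _ (P.next_mem d hd)).2
    have m1 : n d ≠ a := fun e => hd1 (by rw [← e, H.label_next])
    have m2 : n d ≠ n (n a) := fun e => hd1 (by rw [← H.label_two a, ← e, H.label_next])
    rw [hfour, if_neg m1, if_neg m2] at this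
    grind
  · intro d hd
    have hdS : d ∈ S ∧ h d = h a ∧ (μ d ≠ μ a ∨ d = n a) := by
      simp only [Finset.mem_insert, Finset.mem_filter] at hd
      grind
    obtain ⟨hS, hha, hor⟩ := hdS
    have m1 : d ≠ a := by
      rintro rfl
      rcases hor with h | h
      · exact h rfl
      · exact n1 _ h.symm
    have m2 : d ≠ n (n a) := by
      rintro rfl
      rcases hor with h | h
      · exact h (H.label_two a)
      · exact n1 _ h
    have hod := (hh d hS).1
    have hxd := (hh d hS).2
    rw [if_neg m1, if_neg m2] at hxd
    simp only [Finset.mem_insert, Finset.mem_filter]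
    by_cases hz : μ (o d) = μ a
    · left
      rcases H.eq_of_label a _ hz with e | e | e | e
      · rw [P.opp_eq_iff ha hS, hoa] at e
        exact absurd e m2
      · exact e
      · rw [P.opp_eq_iff hc hS, ← hoa, P.opp_opp a ha] at e
        exact absurd e m1
      · rw [e] at hod
        have := (one_ne_zero : (1 : ZMod 2) ≠ 0)
        grind
    · right
      refine ⟨P.opp_mem d hS, hz, ?_⟩
      grind
  · intro d hd
    have hdS : d ∈ S := by
      simp only [Finset.mem_insert, Finset.mem_filter] at hd
      grind
    exact ⟨P.opp_opp d hdS, P.opp_ne d hdS⟩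

/-- Two consecutive edges with the same ends bound a bigon, or they are twisted: all other edges at
the second end are on the side of the corner between the two edges. -/
theorem bigon_or_twisted [DecidableEq α] {a : α} (ha : a ∈ S) (h2 : μ (o (n a)) = μ (o a))
    (hne : μ (o a) ≠ μ a) : n (o (n a)) = o a ∨ n (o a) = o (n a) := by
  classical
  have hb := P.next_mem a ha
  have hp := P.next_mem _ hb
  have hq := P.next_mem _ hp
  have hfour := H.four
  have n1 := H.ne_one
  have n2 := H.ne_two
  have n3 := H.ne_three
  have ha' := P.opp_mem a ha
  have hs := P.next_mem _ ha'
  have hb' := P.next_mem _ hs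
  have ht := P.next_mem _ hb'
  rcases H.eq_of_label _ _ h2 with e | e | e | e
  · have := P.opp_opp _ hb
    rw [e, P.opp_opp a ha] at this
    exact absurd this.symm (n1 a)
  · exact Or.inr e.symm
  swap
  · left; rw [e, hfour]
  exfalso
  obtain ⟨h, hh⟩ := P.jordan_double H ha hb (H.label_next a) h2
  rw [e] at hh
  have hlab : ∀ c, μ c = μ a → ∀ c', μ c' = μ (o a) → c ≠ c' := by
    intro c hc c' hc' h; rw [h, hc'] at hc; exact hne hc
  have l1 := H.label_next
  have l2 := H.label_two
  have l3 := H.label_three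
  have f1 : ∀ c, (c = a ∨ c = n a ∨ c = n (n a) ∨ c = n (n (n a))) →
      c ≠ o a ∧ c ≠ n (o a) ∧ c ≠ n (n (o a)) ∧ c ≠ n (n (n (o a))) := by
    intro c hc
    have : μ c = μ a := by rcases hc with rfl | rfl | rfl | rfl <;> simp [l1]
    refine ⟨?_, ?_, ?_, ?_⟩ <;> exact hlab _ this _ (by simp [l1])
  have e0 := (hh a ha).2
  have e1 := (hh _ hb).2
  have e2 := (hh _ hp).2
  have e3 := (hh _ hq).2
  have k0 := (hh _ ha').2
  have k1 := (hh _ hs).2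
  have k2 := (hh _ hb').2
  have k3 := (hh _ ht).2
  have g0 := (hh a ha).1
  have g1 := (hh _ hb).1
  have one_ne := (one_ne_zero : (1 : ZMod 2) ≠ 0)
  have F0 := f1 a (by simp)
  have F1 := f1 (n a) (by simp)
  have F2 := f1 (n (n a)) (by simp)
  have F3 := f1 (n (n (n a))) (by simp)
  simp [hfour, n1, n2, n3, (n1 _).symm, (n2 _).symm, (n3 _).symm, F0, F1] at e0 e1 g1
  simp [hfour, n1, n2, n3, (n1 _).symm, (n2 _).symm, (n3 _).symm, F2, F3] at e2 e3
  simp [hfour, n1, n2, n3, (n1 _).symm, (n2 _).symm, (n3 _).symm, F0.1.symm, F0.2.1.symm,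
    F0.2.2.1.symm, F0.2.2.2.symm, F1.1.symm, F1.2.1.symm,
    F1.2.2.1.symm, F1.2.2.2.symm] at k0 k1 k2 k3
  rw [e] at g1
  -- If `o (n a)` is opposite to `o a`, the side of the corner `a` receives no end from `μ a` and
  -- only one, `n (n (n (o a)))`, from `μ (o a)`.
  refine H.parity_contradiction (o := o) {d ∈ S | μ d ≠ μ a ∧ μ d ≠ μ (o a) ∧ h d = h a}
    (n (n (n (o a)))) ?_ ?_ ?_ ?_
  · simp [l3]
  · intro d hd
    simp only [Finset.mem_filter] at hd ⊢
    obtain ⟨hd, hd1, hd2, hd3⟩ := hd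
    refine ⟨P.next_mem d hd, by rwa [l1], by rwa [l1], ?_⟩
    have := (hh _ (P.next_mem d hd)).2
    have m1 : n d ≠ a := fun e => hd1 (by rw [← e, l1])
    have m2 : n d ≠ n a := fun e => hd1 (by rw [← l1 a, ← e, l1])
    have m3 : n d ≠ o a := fun e => hd2 (by rw [← e, l1])
    have m4 : n d ≠ n (n (o a)) := fun e => hd2 (by rw [← l2 (o a), ← e, l1])
    rw [hfour, if_neg m1, if_neg m2, if_neg m3, if_neg m4] at this
    grind
  · intro d hd
    have hdS : d ∈ S ∧ h d = h a ∧ d ≠ a ∧ d ≠ n a ∧ d ≠ o a ∧ d ≠ n (n (o a)) := by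
      simp only [Finset.mem_insert, Finset.mem_filter] at hd
      rcases hd with rfl | ⟨hd, hd1, hd2, hd3⟩
      · exact ⟨ht, by grind, F0.2.2.2.symm, F1.2.2.2.symm, n3 _, n1 _⟩
      · exact ⟨hd, hd3, fun h => hd1 (by rw [h]), fun h => hd1 (by rw [h, l1]),
          fun h => hd2 (by rw [h]), fun h => hd2 (by rw [h, l2])⟩
    obtain ⟨hS, hha, m1, m2, m3, m4⟩ := hdS
    have hod := (hh d hS).1
    have hxd := (hh d hS).2
    rw [if_neg m1, if_neg m2, if_neg m3, if_neg m4] at hxd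
    simp only [Finset.mem_insert, Finset.mem_filter]
    by_cases hz : μ (o d) = μ a
    · exfalso
      rcases H.eq_of_label a _ hz with r | r | r | r
      · rw [P.opp_eq_iff ha hS] at r
        exact m3 r
      · rw [P.opp_eq_iff hb hS, e] at r
        exact m4 r
      · rw [r] at hod
        grind
      · rw [r] at hod
        grind
    by_cases hx : μ (o d) = μ (o a)
    · left
      rcases H.eq_of_label (o a) _ hx with r | r | r | r
      · rw [P.opp_eq_iff ha' hS, P.opp_opp a ha] at r
        exact absurd r m1
      · rw [r] at hod
        grind
      · rw [P.opp_eq_iff hb' hS, ← e, P.opp_opp _ hb] at r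
        exact absurd r m2
      · exact r
    · right
      refine ⟨P.opp_mem d hS, hz, hx, ?_⟩
      grind
  · intro d hd
    have hdS : d ∈ S := by
      simp only [Finset.mem_insert, Finset.mem_filter] at hd
      grind
    exact ⟨P.opp_opp d hdS, P.opp_ne d hdS⟩

end PlanarPiece

end TwistRegions

/-! ### Immediate twist faces, and cutting along a twisted pair of edges. -/

section TwistFaces

variable {α V : Type*} {n : α → α} {μ : α → V} {share : V → V → Prop} {S : Finset α} {o : α → α}
  {e : α}

namespace PlanarPiece

variable (H : FourRegular n μ) (P : PlanarPiece n μ share S o e)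
include P

/-- A loop bounding a face is a twist face with one corner, for which no bigon is required. -/
theorem hasTwistFace_of_opp_eq_next {a : α} (ha : a ∈ S) (h : o a = n a) (h1 : a ≠ e)
    (h2 : o a ≠ e) : HasTwistFace n μ S o e := by
  have hb : o (n a) = a := by rw [← h, P.opp_opp a ha]
  refine ⟨{n a}, n a, rfl, ?_, ?_, ?_⟩
  · rintro c rfl
    refine ⟨P.next_mem a ha, h ▸ h2, ?_, by rw [hb]; rfl⟩
    rw [← h]
    intro h3
    rw [P.opp_eq_iff (P.opp_mem _ P.root_mem) ha, P.opp_opp _ P.root_mem] at h3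
    exact h1 h3
  · rintro c rfl hc
    exact absurd rfl hc
  · rintro c rfl c' rfl _
    rfl

include H

/-- The two ends of a loop are not opposite, so they are consecutive in one of the two orders. -/
theorem hasTwistFace_of_loop [DecidableEq α] {d : α} (hd : d ∈ S) (h : μ (o d) = μ d) (h1 : d ≠ e)
    (h2 : o d ≠ e) : HasTwistFace n μ S o e := by
  rcases H.eq_of_label _ _ h with r | r | r | r
  · exact absurd r (P.opp_ne d hd)
  · exact P.hasTwistFace_of_opp_eq_next hd r h1 h2
  · exact absurd r (P.opp_ne_next_next H hd)
  · refine P.hasTwistFace_of_opp_eq_next (P.opp_mem d hd) ?_ h2 ?_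
    · rw [P.opp_opp d hd, r, H.four]
    · rwa [P.opp_opp d hd]

/-- One side of a pair of twisted edges. -/
theorem exists_region_of_twisted [DecidableEq α] {a : α} (ha : a ∈ S) (ht : n (o a) = o (n a))
    (hne : μ (o a) ≠ μ a) : ∃ R ⊆ S, (∀ d ∈ R, n d ∈ R) ∧ o a ∈ R ∧ o (n a) ∈ R ∧
      (∀ d ∈ R, d ≠ o a → d ≠ o (n a) → o d ∈ R) ∧ ∀ d ∈ R, μ d ≠ μ a := by
  classical
  have hb := P.next_mem a ha
  have hp := P.next_mem _ hb
  have hq := P.next_mem _ hp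
  have hfour := H.four
  have n1 := H.ne_one
  have n2 := H.ne_two
  have n3 := H.ne_three
  have ha' := P.opp_mem a ha
  have hb' := P.next_mem _ ha'
  have hs := P.next_mem _ hb'
  have hs' := P.next_mem _ hs
  have l1 := H.label_next
  have l2 := H.label_two
  have l3 := H.label_three
  have hx2 : μ (o (n a)) = μ (o a) := by rw [← ht, l1]
  obtain ⟨h, hh⟩ := P.jordan_double H ha hb (l1 a) hx2
  have hR : ∀ c, μ c = μ a → c ≠ o a ∧ c ≠ n (o a) ∧ c ≠ n (n (o a)) ∧ c ≠ n (n (n (o a))) := by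
    intro c hc
    refine ⟨?_, ?_, ?_, ?_⟩ <;> rintro rfl <;> first | exact hne hc | (simp [l1] at hc; exact hne hc)
  have one_ne := (one_ne_zero : (1 : ZMod 2) ≠ 0)
  have e0 := (hh a ha).2
  have e1 := (hh _ hb).2
  have e2 := (hh _ hp).2
  have e3 := (hh _ hq).2
  have k1 := (hh _ hb').2
  have k2 := (hh _ hs).2
  have k3 := (hh _ hs').2
  have g1 := (hh _ hb).1
  rw [← ht] at e0 e1 e2 e3 k1 k2 k3 g1
  have F0 := hR a rfl
  have F1 := hR (n a) (by simp [l1])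
  have F2 := hR (n (n a)) (by simp [l1])
  have F3 := hR (n (n (n a))) (by simp [l1])
  simp [hfour, n1, n2, n3, (n1 _).symm, (n2 _).symm, (n3 _).symm, F0, F1] at e0 e1 g1
  simp [hfour, n1, n2, n3, (n1 _).symm, (n2 _).symm, (n3 _).symm, F2, F3] at e2 e3
  simp [hfour, n1, n2, n3, (n1 _).symm, (n2 _).symm, (n3 _).symm, F0.1.symm, F0.2.1.symm,
    F0.2.2.1.symm, F0.2.2.2.symm, F1.1.symm, F1.2.1.symm,
    F1.2.2.1.symm, F1.2.2.2.symm] at k1 k2 k3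
  -- All vertices on the side of the corner `a`, and the whole vertex `μ (o a)`, whose two other
  -- ends point to that side. No end at `μ a` does, so only the edges of `a` and `n a` leave this
  -- region.
  refine ⟨{d ∈ S | μ d ≠ μ a ∧ (μ d = μ (o a) ∨ h d = h a)}, Finset.filter_subset _ _, ?_, ?_, ?_,
    ?_, ?_⟩
  · intro d hd
    simp only [Finset.mem_filter] at hd ⊢
    obtain ⟨hd, hd1, hd2⟩ := hd
    refine ⟨P.next_mem d hd, by rwa [l1], ?_⟩
    rw [l1]
    by_cases hx : μ d = μ (o a)
    · exact Or.inl hx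
    right
    have hd2 := hd2.resolve_left hx
    have := (hh _ (P.next_mem d hd)).2
    have m1 : n d ≠ a := fun e => hd1 (by rw [← e, l1])
    have m2 : n d ≠ n a := fun e => hd1 (by rw [← l1 a, ← e, l1])
    have m3 : n d ≠ o a := fun e => hx (by rw [← e, l1])
    have m4 : n d ≠ o (n a) := fun e => hx (by rw [← hx2, ← e, l1])
    rw [hfour, if_neg m1, if_neg m2, if_neg m3, if_neg m4] at this
    grind
  · simp [ha', hne]
  · simp [hx2, hne, P.opp_mem _ hb]
  · intro d hd m3 m4
    simp only [Finset.mem_filter] at hd ⊢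
    obtain ⟨hd, hd1, hd2⟩ := hd
    have hdh : h d = h a := by
      rcases hd2 with hd2 | hd2
      · rcases H.eq_of_label _ _ hd2 with rfl | rfl | rfl | rfl
        · exact absurd rfl m3
        · exact absurd ht m4
        · grind
        · grind
      · exact hd2
    have m1 : d ≠ a := fun e => hd1 (by rw [e])
    have m2 : d ≠ n a := fun e => hd1 (by rw [e, l1])
    have hod := (hh d hd).1
    have hxd := (hh d hd).2
    rw [if_neg m1, if_neg m2, if_neg m3, if_neg m4] at hxd
    have hoh : h (o d) = h a := by grind
    refine ⟨P.opp_mem d hd, ?_, Or.inr hoh⟩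
    intro hz
    rcases H.eq_of_label a _ hz with r | r | r | r
    · rw [P.opp_eq_iff ha hd] at r
      exact m3 r
    · rw [P.opp_eq_iff hb hd] at r
      exact m4 r
    · rw [r] at hoh
      grind
    · rw [r] at hoh
      grind
  · intro d hd
    simp only [Finset.mem_filter] at hd
    exact hd.2.1

/-- Two of three consecutive edges with the same ends bound a bigon. -/
theorem bigon_of_triple [DecidableEq α] {a c : α} (ha : a ∈ S) (h2 : μ (o (n a)) = μ (o a))
    (hc : μ c = μ a) (hca : c ≠ a) (hcb : c ≠ n a) (hcS : c ∈ S)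
    (h3 : μ (o c) = μ (o a)) (hne : μ (o a) ≠ μ a) : n (o (n a)) = o a := by
  refine (P.bigon_or_twisted H ha h2 hne).resolve_right fun ht => ?_
  -- If the pair were twisted, the edge of `c` would be a third edge leaving the region.
  obtain ⟨R, hRS, hRn, hRa, hRb, hRo, hR⟩ := P.exists_region_of_twisted H ha ht hne
  have hoc : o c ∈ R := by
    rcases H.eq_of_label _ _ h3 with r | r | r | r <;> rw [r]
    · exact hRa
    · exact hRn _ hRa
    · exact hRn _ (hRn _ hRa)
    · exact hRn _ (hRn _ (hRn _ hRa))
  have := hRo _ hoc (fun h => hca (by rw [← P.opp_opp c hcS, h, P.opp_opp a ha]))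
    (fun h => hcb (by rw [← P.opp_opp c hcS, h, P.opp_opp _ (P.next_mem a ha)]))
  rw [P.opp_opp c hcS] at this
  exact hR c this hc

/-- Three parallel edges bound two neighboring bigons. One of them is the twist face, with two
corners, and the other is the bigon beside its edge `n a`. -/
theorem hasTwistFace_of_triple [DecidableEq α] {a : α} (ha : a ∈ S)
    (h2 : μ (o (n a)) = μ (o a)) (h3 : μ (o (n (n a))) = μ (o a)) (hne : μ (o a) ≠ μ a)
    (r1 : a ≠ e ∧ o a ≠ e) (r2 : n a ≠ e ∧ o (n a) ≠ e) (r3 : n (n a) ≠ e ∧ o (n (n a)) ≠ e) :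
    HasTwistFace n μ S o e := by
  have l1 := H.label_next
  have hb := P.next_mem a ha
  have hp := P.next_mem _ hb
  have B1 := P.bigon_of_triple H ha h2 (H.label_two a) (H.ne_two a) (H.ne_one _) hp h3 hne
  have B2 : n (o (n (n a))) = o (n a) := P.bigon_of_triple H hb (by rw [h3, h2]) (l1 a).symm
    (H.ne_one a).symm (H.ne_two a).symm ha h2.symm (by rw [h2, l1]; exact hne)
  have key : ∀ c ∈ S, o c ≠ e → c ≠ o e := fun c hc h h' =>
    h (by rw [h', P.opp_opp _ P.root_mem])
  have hroot : ∀ c ∈ S, c ≠ e → o c ≠ o e := fun c hc h h' =>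
    h (by rw [← P.opp_opp c hc, h', P.opp_opp _ P.root_mem])
  have hba : n a ≠ o a := fun h => hne (by rw [← h, l1])
  refine ⟨{n a, o a}, o a, by simp, ?_, ?_, ?_⟩
  · rintro c (rfl | rfl)
    · exact ⟨hb, r2.1, key _ hb r2.2, by rw [B1]; simp⟩
    · refine ⟨P.opp_mem a ha, r1.2, hroot a ha r1.1, ?_⟩
      rw [P.opp_opp a ha]; simp
  · rintro c (rfl | rfl) hc
    · exact ⟨B2, r3.1, key _ hp r3.2⟩
    · exact absurd rfl hc
  · rintro c (rfl | rfl) c' (rfl | rfl) h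
    · rfl
    · rw [l1] at h; exact absurd h.symm hne
    · rw [l1] at h; exact absurd h hne
    · rfl

/-- The closed curve along the edges of `a` and `n (n a)` separates the ends `n a` and `n (n (n
a))`. If both led to one vertex off the curve, they would be on the same side, since all corners at
such a vertex are. -/
theorem not_alternating [DecidableEq α] {a : α} (ha : a ∈ S)
    (h1 : μ (o (n (n a))) = μ (o a)) (h2 : μ (o (n (n (n a)))) = μ (o (n a)))
    (hx : μ (o a) ≠ μ a) (hy : μ (o (n a)) ≠ μ a) : μ (o (n a)) = μ (o a) := by
  classical
  by_contra hxy
  have hb := P.next_mem a ha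
  have hp := P.next_mem _ hb
  have hq := P.next_mem _ hp
  have hfour := H.four
  have n1 := H.ne_one
  have n2 := H.ne_two
  have n3 := H.ne_three
  have l1 := H.label_next
  have l2 := H.label_two
  have l3 := H.label_three
  have one_ne := (one_ne_zero : (1 : ZMod 2) ≠ 0)
  obtain ⟨h, hh⟩ := P.jordan_double H ha hp (l2 a) h1
  have e1 := (hh _ hb).2
  have e2 := (hh _ hp).2
  have e3 := (hh _ hq).2
  have g1 := (hh _ hb).1
  have g3 := (hh _ hq).1
  have hz : ∀ c, μ c = μ a → c ≠ o a ∧ c ≠ o (n (n a)) := by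
    intro c hc
    refine ⟨?_, ?_⟩ <;> rintro rfl
    · exact hx hc
    · rw [h1] at hc; exact hx hc
  have F1 := hz (n a) (by simp [l1])
  have F2 := hz (n (n a)) (by simp [l1])
  have F3 := hz (n (n (n a))) (by simp [l1])
  simp [hfour, n1, n2, n3, (n1 _).symm, (n2 _).symm, (n3 _).symm, F1] at e1 g1
  simp [hfour, n1, n2, n3, (n1 _).symm, (n2 _).symm, (n3 _).symm, F2] at e2
  simp [hfour, n1, n2, n3, (n1 _).symm, (n2 _).symm, (n3 _).symm, F3] at e3 g3
  have hy' : ∀ c, μ c = μ (o (n a)) → c ≠ a ∧ c ≠ o a ∧ c ≠ n (n a) ∧ c ≠ o (n (n a)) := by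
    intro c hc
    refine ⟨?_, ?_, ?_, ?_⟩ <;> rintro rfl
    · exact hy hc.symm
    · exact hxy hc.symm
    · rw [l2] at hc; exact hy hc.symm
    · rw [h1] at hc; exact hxy hc.symm
  have hconst : ∀ c ∈ S, μ c = μ (o (n a)) → h (n c) = h c := by
    intro c hc hcy
    have := (hh _ (P.next_mem c hc)).2
    obtain ⟨m1, m2, m3, m4⟩ := hy' (n c) (by rw [l1, hcy])
    rw [hfour, if_neg m1, if_neg m2, if_neg m3, if_neg m4] at this
    grind
  have hb' := P.opp_mem _ hb
  have c1 := hconst _ hb' rfl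
  have c2 := hconst _ (P.next_mem _ hb') (l1 _)
  have c3 := hconst _ (P.next_mem _ (P.next_mem _ hb')) (l2 _)
  have : h (o (n (n (n a)))) = h (o (n a)) := by
    rcases H.eq_of_label _ _ h2 with r | r | r | r <;> rw [r]
    · exact c1
    · rw [c2, c1]
    · rw [c3, c2, c1]
  grind

end PlanarPiece

open Classical in
/-- The pairing after cutting the edges of `a` and `b` and joining their other ends. -/
noncomputable def cutOpp (o : α → α) (a b : α) : α → α := fun d =>
  if d = o a then o b else if d = o b then o a else o d

namespace PlanarPiece

variable (H : FourRegular n μ) (P : PlanarPiece n μ share S o e)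
include H P

/-- For the Jordan property, an even function on the piece is extended to `S` with the value of the
new edge on the edges of `a` and `n a`, and with zero elsewhere. This is even at `μ a`, where the
two edges meet, and the face function restricts. -/
theorem cut [DecidableEq α] {a : α} (ha : a ∈ S) {S' : Finset α} (hS : S' ⊆ S)
    (hn : ∀ d ∈ S', n d ∈ S') (ha' : o a ∈ S') (hb' : o (n a) ∈ S')
    (ho : ∀ d ∈ S', d ≠ o a → d ≠ o (n a) → o d ∈ S') (hz : ∀ d ∈ S', μ d ≠ μ a)
    (hxx : μ (o (n a)) = μ (o a)) (hsh : share (μ (o a)) (μ (o a))) :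
    PlanarPiece n μ share S' (cutOpp o a (n a)) (o a) := by
  classical
  have hb := P.next_mem a ha
  have hfour := H.four
  have l1 := H.label_next
  have hab : o (n a) ≠ o a := fun h => H.ne_one a (by
    rw [← P.opp_opp _ hb, h, P.opp_opp a ha])
  have hoo : ∀ d ∈ S', d ≠ o a → d ≠ o (n a) → o d ≠ o a ∧ o d ≠ o (n a) := by
    intro d hd h1 h2
    constructor
    · intro h
      rw [P.opp_eq_iff (P.opp_mem a ha) (hS hd), P.opp_opp a ha] at h
      exact hz d hd (by rw [h])
    · intro h
      rw [P.opp_eq_iff (P.opp_mem _ hb) (hS hd), P.opp_opp _ hb] at h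
      exact hz d hd (by rw [h, l1])
  have hn' : ∀ d, n d ∈ S' → d ∈ S' := fun d hd => by
    rw [← hfour d]; exact hn _ (hn _ (hn _ hd))
  have n1 := H.ne_one
  have n2 := H.ne_two
  have n3 := H.ne_three
  constructor
  · exact hn
  · intro d hd
    simp only [cutOpp]
    split_ifs with h1 h2
    · exact hb'
    · exact ha'
    · exact ho d hd h1 h2
  · intro d hd
    simp only [cutOpp]
    split_ifs with h1 h2
    all_goals simp_all
    exact P.opp_opp d (hS hd)
  · intro d hd
    simp only [cutOpp]
    split_ifs with h1 h2
    · rw [h1]; exact hab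
    · rw [h2]; exact hab.symm
    · exact P.opp_ne d (hS hd)
  · exact ha'
  · intro d hd
    simp only [cutOpp]
    split_ifs with h1 h2
    · rw [h1, hxx]; exact hsh
    · rw [h2, hxx]; exact hsh
    · exact P.share_opp d (hS hd)
  · intro x hx hx4
    have hxa : x (o (n a)) = x (o a) := by simpa [cutOpp] using hx (o a) ha'
    have haS : a ∉ S' := fun h => hz a h rfl
    have hbS : n a ∉ S' := fun h => hz _ h (l1 a)
    have A : ∀ d ∈ S, (fun d => if d ∈ S' then x d else if d = a then x (o a) else
        if d = n a then x (o a) else 0) (o d) = (fun d => if d ∈ S' then x d else if d = a then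
        x (o a) else if d = n a then x (o a) else 0) d := by
      intro d hd
      by_cases hd' : d ∈ S'
      · by_cases h1 : d = o a
        · subst h1; rw [P.opp_opp a ha]; simp [haS, ha']
        by_cases h2 : d = o (n a)
        · subst h2; rw [P.opp_opp _ hb]; simp [hbS, hb', hxa, n1]
        · have := hx d hd'
          simp only [cutOpp, if_neg h1, if_neg h2] at this
          simp [hd', ho d hd' h1 h2, this]
      · by_cases h1 : d = a
        · subst h1; simp [haS, ha']
        by_cases h2 : d = n a
        · subst h2; simp [hbS, hb', hxa, n1]
        have hod : o d ∉ S' := by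
          intro h
          have := ho _ h (fun h' => h1 (by rw [← P.opp_opp d hd, h', P.opp_opp a ha]))
            (fun h' => h2 (by rw [← P.opp_opp d hd, h', P.opp_opp _ hb]))
          rw [P.opp_opp d hd] at this
          exact hd' this
        have m1 : o d ≠ a := fun h => hd' (by rw [← P.opp_opp d hd, h]; exact ha')
        have m2 : o d ≠ n a := fun h => hd' (by rw [← P.opp_opp d hd, h]; exact hb')
        simp [hd', hod, h1, h2, m1, m2]
    have B : ∀ d ∈ S, (fun d => if d ∈ S' then x d else if d = a then x (o a) else
        if d = n a then x (o a) else 0) d + (fun d => if d ∈ S' then x d else if d = a then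
        x (o a) else if d = n a then x (o a) else 0) (n d) + (fun d => if d ∈ S' then x d else
        if d = a then x (o a) else if d = n a then x (o a) else 0) (n (n d)) +
        (fun d => if d ∈ S' then x d else if d = a then x (o a) else
        if d = n a then x (o a) else 0) (n (n (n d))) = 0 := by
      intro d hd
      by_cases hd' : d ∈ S'
      · have := hx4 d hd'
        simpa [hd', hn _ hd', hn _ (hn _ hd'), hn _ (hn _ (hn _ hd'))] using this
      · have d1 : n d ∉ S' := fun h => hd' (hn' _ h)
        have d2 : n (n d) ∉ S' := fun h => d1 (hn' _ h)
        have d3 : n (n (n d)) ∉ S' := fun h => d2 (hn' _ h)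
        simp only [if_neg hd', if_neg d1, if_neg d2, if_neg d3]
        have e1 := H.sum_indicator a d
        have e2 := H.sum_indicator (n a) d
        rw [l1] at e2
        have key : ∀ c, (if c = a then x (o a) else if c = n a then x (o a) else 0) =
            x (o a) * ((if c = a then 1 else 0) + (if c = n a then 1 else 0)) := by
          intro c
          by_cases c1 : c = a
          · subst c1; simp [(n1 _).symm]
          · simp [c1]
        rw [key, key, key, key]
        linear_combination x (o a) * e1 + x (o a) * e2 +
          zmod_two_add_self (x (o a) * if μ d = μ a then 1 else 0)
    · obtain ⟨h, hh⟩ := P.jordan _ A B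
      refine ⟨h, fun d hd => ⟨?_, ?_⟩⟩
      -- At `μ a` the corner `a` lies on one side of the two edges and the three other corners, with
      -- equal values, on the other side. These are the two sides of the new edge, so the corners at
      -- its ends match.
      · have q0 := (hh a ha).2
        have q1 := (hh _ hb).2
        have q2 := (hh _ (P.next_mem _ hb)).2
        have q3 := (hh _ (P.next_mem _ (P.next_mem _ hb))).2
        have hpS : n (n a) ∉ S' := fun h => hz _ h (H.label_two a)
        have hqS : n (n (n a)) ∉ S' := fun h => hz _ h (H.label_three a)
        have r1 := (hh a ha).1
        have r2 := (hh _ hb).1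
        have r3 := (hh _ (hS ha')).1
        have r4 := (hh _ (hS hb')).1
        rw [P.opp_opp a ha] at r3
        rw [P.opp_opp _ hb] at r4
        simp [hfour, haS, hbS, hpS, hqS, n1, n2, n3] at q0 q1 q2 q3 r2
        simp only [cutOpp]
        split_ifs with h1 h2
        · subst h1; grind
        · subst h2; grind
        · exact (hh d (hS hd)).1
      · have := (hh d (hS hd)).2
        rwa [if_pos hd] at this

/-- The new edge is the root of the cut piece, so the face and bigons found there avoid it and exist
unchanged in `S`. They avoid `e` because both ends of the old root edge lie outside `S'`. -/
theorem hasTwistFace_of_cut [DecidableEq α] {a : α} (ha : a ∈ S) {S' : Finset α} (hS : S' ⊆ S)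
    (hn : ∀ d ∈ S', n d ∈ S')
    (ho : ∀ d ∈ S', d ≠ o a → d ≠ o (n a) → o d ∈ S') (hz : μ e ≠ μ a) (heS : e ∉ S')
    (h : HasTwistFace n μ S' (cutOpp o a (n a)) (o a)) : HasTwistFace n μ S o e := by
  have hb := P.next_mem a ha
  have hc1 : cutOpp o a (n a) (o a) = o (n a) := by simp [cutOpp]
  have hc2 : ∀ d, d ≠ o a → d ≠ o (n a) → cutOpp o a (n a) d = o d := fun d h1 h2 => by
    simp [cutOpp, h1, h2]
  have hoe : o e ∉ S' := by
    intro h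
    have := ho _ h
      (fun h' => hz (by rw [← P.opp_opp e P.root_mem, h', P.opp_opp a ha]))
      (fun h' => hz (by rw [← P.opp_opp e P.root_mem, h', P.opp_opp _ hb, H.label_next]))
    rw [P.opp_opp e P.root_mem] at this
    exact heS this
  obtain ⟨F, u, hu, h1, h2, h3⟩ := h
  rw [hc1] at h1 h2
  refine ⟨F, u, hu, ?_, ?_, h3⟩
  · intro c hc
    obtain ⟨m1, m2, m3, m4⟩ := h1 c hc
    rw [hc2 c m2 m3] at m4
    exact ⟨hS m1, fun h => heS (h ▸ m1), fun h => hoe (h ▸ m1), m4⟩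
  · intro c hc hcu
    obtain ⟨m1, m2, m3, m4⟩ := h1 c hc
    obtain ⟨k1, k2, k3⟩ := h2 c hc hcu
    rw [hc2 c m2 m3, hc2 _ k2 k3] at k1
    exact ⟨k1, fun h => heS (h ▸ hn _ m1), fun h => hoe (h ▸ hn _ m1)⟩

end PlanarPiece

end TwistFaces

/-! ### Smoothing a vertex, and the existence of twist faces. -/

section TwistFaceExistence

variable {α V : Type*} {n : α → α} {μ : α → V} {share : V → V → Prop} {S : Finset α} {o : α → α}
  {e : α}

open Classical in
/-- The pairing after removing the vertex of `a` and joining its four edges in two pairs, namely the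
first to the last one and the two others. -/
noncomputable def smoothOpp (n o : α → α) (a : α) : α → α := fun d =>
  if d = o a then o (n (n (n a))) else if d = o (n (n (n a))) then o a
  else if d = o (n a) then o (n (n a)) else if d = o (n (n a)) then o (n a) else o d

namespace PlanarPiece

variable (H : FourRegular n μ) (P : PlanarPiece n μ share S o e)
include H P

/-- Both new edges join the two neighbors of `μ a`, so `share` has to relate these neighbors, as it
does for a simplicial vertex. The Jordan property is inherited by putting `μ a` back in as a
subdivision of the two new edges. -/
theorem smooth [DecidableEq α] [DecidableEq V] {a : α} (ha : a ∈ S) (hb : μ (o (n a)) = μ (o a))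
    (hq : μ (o (n (n (n a)))) = μ (o (n (n a)))) (hx : μ (o a) ≠ μ a)
    (hy : μ (o (n (n a))) ≠ μ a) (hxy : share (μ (o a)) (μ (o (n (n a)))))
    (hyx : share (μ (o (n (n a)))) (μ (o a))) (he : μ e ≠ μ a) :
    PlanarPiece n μ share {d ∈ S | μ d ≠ μ a} (smoothOpp n o a) e := by
  have hbS := P.next_mem a ha
  have hpS := P.next_mem _ hbS
  have hqS := P.next_mem _ hpS
  have hfour := H.four
  have n1 := H.ne_one
  have n2 := H.ne_two
  have n3 := H.ne_three
  have l1 := H.label_next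
  have l2 := H.label_two
  have l3 := H.label_three
  have ha' := P.opp_mem a ha
  have hb' := P.opp_mem _ hbS
  have hp' := P.opp_mem _ hpS
  have hq' := P.opp_mem _ hqS
  have ooa := P.opp_opp a ha
  have oob := P.opp_opp _ hbS
  have oop := P.opp_opp _ hpS
  have ooq := P.opp_opp _ hqS
  have inj : ∀ c ∈ S, ∀ d ∈ S, o c = o d → c = d := fun c hc d hd h => by
    rw [← P.opp_opp c hc, h, P.opp_opp d hd]
  have dab : o a ≠ o (n a) := fun h => n1 a (inj _ ha _ hbS h).symm
  have dap : o a ≠ o (n (n a)) := fun h => n2 a (inj _ ha _ hpS h).symm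
  have daq : o a ≠ o (n (n (n a))) := fun h => n3 a (inj _ ha _ hqS h).symm
  have dbp : o (n a) ≠ o (n (n a)) := fun h => n1 _ (inj _ hbS _ hpS h).symm
  have dbq : o (n a) ≠ o (n (n (n a))) := fun h => n2 _ (inj _ hbS _ hqS h).symm
  have dpq : o (n (n a)) ≠ o (n (n (n a))) := fun h => n1 _ (inj _ hpS _ hqS h).symm
  have hother : ∀ d ∈ S, d ≠ o a → d ≠ o (n (n (n a))) → d ≠ o (n a) → d ≠ o (n (n a)) →
      μ (o d) ≠ μ a := by
    intro d hd h1 h2 h3 h4 h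
    have := P.opp_opp d hd
    rcases H.eq_of_label _ _ h with r | r | r | r <;> rw [r] at this <;> grind
  constructor
  · intro d hd
    simp only [Finset.mem_filter] at hd ⊢
    exact ⟨P.next_mem d hd.1, by rw [l1]; exact hd.2⟩
  · intro d hd
    simp only [Finset.mem_filter] at hd ⊢
    simp only [smoothOpp]
    split_ifs with h1 h2 h3 h4
    · exact ⟨hq', by rw [hq]; exact hy⟩
    · exact ⟨ha', hx⟩
    · exact ⟨hp', hy⟩
    · exact ⟨hb', by rw [hb]; exact hx⟩
    · exact ⟨P.opp_mem d hd.1, hother d hd.1 h1 h2 h3 h4⟩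
  · intro d hd
    simp only [Finset.mem_filter] at hd
    have hz := hother d hd.1
    have h6 : ∀ c ∈ S, μ c = μ a → o d ≠ o c := fun c hc hca h => hd.2 (by rw [inj _ hd.1 _ hc h, hca])
    have k1 := h6 a ha rfl
    have k2 := h6 _ hbS (l1 a)
    have k3 := h6 _ hpS (l2 a)
    have k4 := h6 _ hqS (l3 a)
    have := P.opp_opp d hd.1
    simp only [smoothOpp]
    by_cases h1 : d = o a
    · simp [h1, daq.symm]
    by_cases h2 : d = o (n (n (n a)))
    · simp [h2, daq.symm]
    by_cases h3 : d = o (n a)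
    · simp [h3, dab.symm, dap.symm, dbp.symm, dbq, dpq]
    by_cases h4 : d = o (n (n a))
    · simp [h4, dap.symm, dbp.symm, dpq, dab.symm, dbq]
    simp [h1, h2, h3, h4, k1, k2, k3, k4, this]
  · intro d hd
    simp only [Finset.mem_filter] at hd
    simp only [smoothOpp]
    split_ifs with h1 h2 h3 h4
    · rw [h1]; exact daq.symm
    · rw [h2]; exact daq
    · rw [h3]; exact dbp.symm
    · rw [h4]; exact dbp
    · exact P.opp_ne d hd.1
  · simp [he, P.root_mem]
  · intro d hd
    simp only [Finset.mem_filter] at hd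
    simp only [smoothOpp]
    split_ifs with h1 h2 h3 h4
    · rw [h1, hq]; exact hxy
    · rw [h2, hq]; exact hyx
    · rw [h3, hb]; exact hxy
    · rw [h4, hb]; exact hyx
    · exact P.share_opp d hd.1
  · intro x hx' hx4
    have ma : o a ∈ ({d ∈ S | μ d ≠ μ a} : Finset α) := by simp [ha', hx]
    have mb : o (n a) ∈ ({d ∈ S | μ d ≠ μ a} : Finset α) := by simp [hb', hb, hx]
    have xa : x (o (n (n (n a)))) = x (o a) := by simpa [smoothOpp] using hx' (o a) ma
    have xb : x (o (n (n a))) = x (o (n a)) := by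
      simpa [smoothOpp, dab.symm, dbq] using hx' _ mb
    -- The ends at the removed vertex take the values of the new edges they lie on: `a` and `n (n (n
    -- a))` on one, `n a` and `n (n a)` on the other.
    let f : α → ZMod 2 := fun d => if μ d = μ a then
      x (o a) * ((if d = a then 1 else 0) + (if d = n (n (n a)) then 1 else 0)) +
        x (o (n a)) * ((if d = n a then 1 else 0) + (if d = n (n a) then 1 else 0)) else x d
    have A : ∀ d ∈ S, f (o d) = f d := by
      simp only [f]
      intro d hd
      by_cases hda : μ d = μ a
      · rw [if_pos hda]
        rcases H.eq_of_label _ _ hda with rfl | rfl | rfl | rfl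
        · simp [hx, n1, n2, n3, (n1 _).symm, (n2 _).symm, (n3 _).symm]
        · simp [hb, hx, n1, n2, n3, (n1 _).symm, (n2 _).symm, (n3 _).symm]
        · simp [hy, n1, n2, n3, (n1 _).symm, (n2 _).symm, (n3 _).symm, xb]
        · simp [hq, hy, n1, n2, n3, (n1 _).symm, (n2 _).symm, (n3 _).symm, xa]
      · rw [if_neg hda]
        by_cases h1 : d = o a
        · subst h1; simp [ooa, n1, n2, n3, (n1 _).symm, (n2 _).symm, (n3 _).symm]
        by_cases h2 : d = o (n (n (n a)))
        · subst h2; simp [ooq, l3, n1, n2, n3, (n1 _).symm, (n2 _).symm, (n3 _).symm, xa]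
        by_cases h3 : d = o (n a)
        · subst h3; simp [oob, l1, n1, n2, n3, (n1 _).symm, (n2 _).symm, (n3 _).symm]
        by_cases h4 : d = o (n (n a))
        · subst h4; simp [oop, l2, n1, n2, n3, (n1 _).symm, (n2 _).symm, (n3 _).symm, xb]
        rw [if_neg (hother d hd h1 h2 h3 h4)]
        have := hx' d (by simp [hd, hda])
        simpa [smoothOpp, h1, h2, h3, h4] using this
    have B : ∀ d ∈ S, f d + f (n d) + f (n (n d)) + f (n (n (n d))) = 0 := by
      simp only [f]
      intro d hd
      simp only [l1]
      by_cases hda : μ d = μ a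
      · simp only [if_pos hda]
        have e1 := H.sum_indicator a d
        have e2 := H.sum_indicator (n a) d
        have e3 := H.sum_indicator (n (n a)) d
        have e4 := H.sum_indicator (n (n (n a))) d
        rw [l1] at e2
        rw [l2] at e3
        rw [l3] at e4
        linear_combination x (o a) * e1 + x (o a) * e4 + x (o (n a)) * e2 + x (o (n a)) * e3 +
          zmod_two_add_self ((x (o a) + x (o (n a))) * if μ d = μ a then 1 else 0)
      · simp only [if_neg hda]
        exact hx4 d (by simp [hd, hda])
    · obtain ⟨h, hh⟩ := P.jordan f A B
      simp only [f] at hh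
      have qa := hh a ha
      have qb := hh _ hbS
      have qp := hh _ hpS
      have qq := hh _ hqS
      have ra := (hh _ ha').1
      have rb := (hh _ hb').1
      have rp := (hh _ hp').1
      have rq := (hh _ hq').1
      rw [ooa] at ra
      rw [oob] at rb
      rw [oop] at rp
      rw [ooq] at rq
      simp [hfour, n1, n2, n3, (n1 _).symm, (n2 _).symm, (n3 _).symm, l1] at qa qb qp qq
      refine ⟨h, fun d hd => ⟨?_, ?_⟩⟩
      · simp only [Finset.mem_filter] at hd
        simp only [smoothOpp]
        split_ifs with h1 h2 h3 h4
        · subst h1; grind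
        · subst h2; grind
        · subst h3; grind
        · subst h4; grind
        · exact (hh d hd.1).1
      · simp only [Finset.mem_filter] at hd
        have := (hh d hd.1).2
        rwa [if_neg hd.2] at this

/-- Three vertices in a chain of two bigons, whose ends are joined by an edge. -/
theorem hasTwistFace_of_triangle {a : α} (ha : a ∈ S) (hb : μ (o (n a)) = μ (o a))
    (hq : μ (o (n (n (n a)))) = μ (o (n (n a)))) (hx : μ (o a) ≠ μ a)
    (hy : μ (o (n (n a))) ≠ μ a) (hxy : μ (o a) ≠ μ (o (n (n a)))) (he : μ e ≠ μ a)
    (hoe : μ (o e) ≠ μ a) (B1 : n (o (n a)) = o a) (B2 : n (o (n (n (n a)))) = o (n (n a)))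
    (hk : n (o (n (o a))) = o (n (n (n a)))) (k1 : n (o a) ≠ e) (k2 : n (o a) ≠ o e) :
    HasTwistFace n μ S o e := by
  have hbS := P.next_mem a ha
  have hpS := P.next_mem _ hbS
  have hqS := P.next_mem _ hpS
  have ha' := P.opp_mem a ha
  have hq' := P.opp_mem _ hqS
  have l1 := H.label_next
  have l3 := H.label_three
  have key : ∀ c, μ c = μ a → c ≠ e ∧ c ≠ o e := fun c hc =>
    ⟨fun h => he (by rw [← h, hc]), fun h => hoe (by rw [← h, hc])⟩
  have key' : ∀ c ∈ S, μ c = μ a → o c ≠ e ∧ o c ≠ o e := fun c hcS hc =>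
    ⟨fun h => hoe (by rw [← h, P.opp_opp c hcS, hc]),
      fun h => he (by rw [← P.opp_opp e P.root_mem, ← h, P.opp_opp c hcS, hc])⟩
  refine ⟨{a, n (o a), o (n (n (n a)))}, n (o a), by simp, ?_, ?_, ?_⟩
  · rintro c (rfl | rfl | rfl)
    · exact ⟨ha, (key _ rfl).1, (key _ rfl).2, by simp⟩
    · exact ⟨P.next_mem _ ha', k1, k2, by rw [hk]; simp⟩
    · refine ⟨hq', (key' _ hqS (l3 a)).1, (key' _ hqS (l3 a)).2, ?_⟩
      rw [P.opp_opp _ hqS, H.four]; simp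
  · rintro c (rfl | rfl | rfl) hc
    · exact ⟨B1, (key _ (l1 _)).1, (key _ (l1 _)).2⟩
    · exact absurd rfl hc
    · refine ⟨?_, ?_, ?_⟩
      · rw [B2, P.opp_opp _ hpS, P.opp_opp _ hqS]
      · rw [B2]; exact (key' _ hpS (H.label_two a)).1
      · rw [B2]; exact (key' _ hpS (H.label_two a)).2
  · have d1 : μ (n (o a)) ≠ μ a := by rwa [l1]
    have d2 : μ (o (n (n (n a)))) ≠ μ a := by rwa [hq]
    have d3 : μ (n (o a)) ≠ μ (o (n (n (n a)))) := by rwa [l1, hq]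
    rintro c (rfl | rfl | rfl) c' (rfl | rfl | rfl) h
    · rfl
    · exact absurd h d1.symm
    · exact absurd h d2.symm
    · exact absurd h d1
    · rfl
    · exact absurd h d3
    · exact absurd h d2
    · exact absurd h d3.symm
    · rfl

/-- Splicing merges the two bigons at `μ a` into one bigon between the new edges. If the twist face
is this bigon, or one of its own bigons lies on the outer side of a new edge, then a bigon beside a
new edge was a triangle in `S`, whose two sides at `μ a` border bigons: it is a twist face. In all
other cases the face lifts, and a new edge on it becomes two edges, each beside one of the bigons at
`μ a`. -/
theorem hasTwistFace_of_smooth [DecidableEq α] [DecidableEq V] {a : α} (ha : a ∈ S)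
    (hb : μ (o (n a)) = μ (o a))
    (hq : μ (o (n (n (n a)))) = μ (o (n (n a)))) (hx : μ (o a) ≠ μ a)
    (hy : μ (o (n (n a))) ≠ μ a) (hxy : μ (o a) ≠ μ (o (n (n a)))) (he : μ e ≠ μ a)
    (hoe : μ (o e) ≠ μ a) (B1 : n (o (n a)) = o a) (B2 : n (o (n (n (n a)))) = o (n (n a)))
    (h : HasTwistFace n μ {d ∈ S | μ d ≠ μ a} (smoothOpp n o a) e) : HasTwistFace n μ S o e := by
  have hbS := P.next_mem a ha
  have hpS := P.next_mem _ hbS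
  have hqS := P.next_mem _ hpS
  have hfour := H.four
  have n1 := H.ne_one
  have n2 := H.ne_two
  have n3 := H.ne_three
  have l1 := H.label_next
  have l2 := H.label_two
  have l3 := H.label_three
  have ha' := P.opp_mem a ha
  have hb' := P.opp_mem _ hbS
  have hp' := P.opp_mem _ hpS
  have hq' := P.opp_mem _ hqS
  have ooa := P.opp_opp a ha
  have oob := P.opp_opp _ hbS
  have oop := P.opp_opp _ hpS
  have ooq := P.opp_opp _ hqS
  have inj : ∀ c ∈ S, ∀ d ∈ S, o c = o d → c = d := fun c hc d hd h => by
    rw [← P.opp_opp c hc, h, P.opp_opp d hd]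
  have dab : o a ≠ o (n a) := fun h => n1 a (inj _ ha _ hbS h).symm
  have dap : o a ≠ o (n (n a)) := fun h => n2 a (inj _ ha _ hpS h).symm
  have daq : o a ≠ o (n (n (n a))) := fun h => n3 a (inj _ ha _ hqS h).symm
  have dbp : o (n a) ≠ o (n (n a)) := fun h => n1 _ (inj _ hbS _ hpS h).symm
  have dbq : o (n a) ≠ o (n (n (n a))) := fun h => n2 _ (inj _ hbS _ hqS h).symm
  have dpq : o (n (n a)) ≠ o (n (n (n a))) := fun h => n1 _ (inj _ hpS _ hqS h).symm
  have key : ∀ c, μ c = μ a → c ≠ e ∧ c ≠ o e := fun c hc =>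
    ⟨fun h => he (by rw [← h, hc]), fun h => hoe (by rw [← h, hc])⟩
  have key' : ∀ c ∈ S, μ c = μ a → o c ≠ e ∧ o c ≠ o e := fun c hcS hc =>
    ⟨fun h => hoe (by rw [← h, P.opp_opp c hcS, hc]),
      fun h => he (by rw [← P.opp_opp e P.root_mem, ← h, P.opp_opp c hcS, hc])⟩
  have sa : smoothOpp n o a (o a) = o (n (n (n a))) := by simp [smoothOpp]
  have sq : smoothOpp n o a (o (n (n (n a)))) = o a := by simp [smoothOpp, daq.symm]
  have sb : smoothOpp n o a (o (n a)) = o (n (n a)) := by simp [smoothOpp, dab.symm, dbq]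
  have sp : smoothOpp n o a (o (n (n a))) = o (n a) := by
    simp [smoothOpp, dap.symm, dpq, dbp.symm]
  have so : ∀ d, d ≠ o a → d ≠ o (n (n (n a))) → d ≠ o (n a) → d ≠ o (n (n a)) →
      smoothOpp n o a d = o d := fun d h1 h2 h3 h4 => by simp [smoothOpp, h1, h2, h3, h4]
  have se : smoothOpp n o a e = o e := so e (key' _ ha rfl).1.symm (key' _ hqS (l3 a)).1.symm
    (key' _ hbS (l1 a)).1.symm (key' _ hpS (l2 a)).1.symm
  have tri1 : n (o (n (o a))) = o (n (n (n a))) → n (o a) ≠ e → n (o a) ≠ o e →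
      HasTwistFace n μ S o e :=
    P.hasTwistFace_of_triangle H ha hb hq hx hy hxy he hoe B1 B2
  have tri2 : n (o (n (o (n (n a))))) = o (n a) → n (o (n (n a))) ≠ e → n (o (n (n a))) ≠ o e →
      HasTwistFace n μ S o e := by
    intro k1 k2 k3
    refine P.hasTwistFace_of_triangle H hpS hq (by simp only [hfour, hb]) (by rwa [l2])
      (by rwa [hfour, l2]) (by rw [hfour]; exact hxy.symm) (by rwa [l2]) (by rwa [l2]) B2
      (by simp only [hfour, B1]) (by rw [k1, hfour]) k2 k3
  obtain ⟨F, u, hu, h1, h2, h3⟩ := h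
  rw [se] at h1 h2
  have dna1 : n (o a) ≠ o (n a) := fun h => n2 (o (n a)) (by rw [B1, h])
  have dnp1 : n (o (n (n a))) ≠ o (n (n (n a))) := fun h =>
    n2 (o (n (n (n a)))) (by rw [B2, h])
  have vx : ∀ c c', μ c = μ (o a) → μ c' = μ (o (n (n a))) → c ≠ c' := fun c c' h h' hcc =>
    hxy (by rw [← h, ← h', hcc])
  -- The darts `o a` and `o (n (n a))` run around the merged bigon. Whichever of them is not `u` has
  -- a bigon on its other side, which is a triangle in `S`.
  by_cases haF : o a ∈ F
  · have hpF : o (n (n a)) ∈ F := by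
      have := (h1 _ haF).2.2.2
      rwa [sa, B2] at this
    by_cases hau : o a = u
    · have hpu : o (n (n a)) ≠ u := fun h => dap (by rw [hau, h])
      obtain ⟨k1, k2, k3⟩ := h2 _ hpF hpu
      rw [sp, so] at k1
      · exact tri2 k1 k2 k3
      · exact (vx _ _ rfl (l1 _)).symm
      · exact dnp1
      · exact (vx _ _ hb (l1 _)).symm
      · exact n1 _
    · obtain ⟨k1, k2, k3⟩ := h2 _ haF hau
      rw [sa, so] at k1
      · exact tri1 k1 k2 k3
      · exact n1 _
      · exact vx _ _ (l1 _) hq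
      · exact dna1
      · exact vx _ _ (l1 _) rfl
  have hpF : o (n (n a)) ∉ F := by
    intro hpF
    have := (h1 _ hpF).2.2.2
    rw [sp, B1] at this
    exact haF this
  -- A bigon formed by an edge of `F` and the outer side of a new edge is again a triangle in `S`.
  by_cases hc1 : ∃ c ∈ F, n c = o (n a) ∧ n (o (n (n a))) = o c
  · obtain ⟨c, hcF, hc, hc'⟩ := hc1
    obtain ⟨m1, m2, m3, m4⟩ := h1 c hcF
    simp only [Finset.mem_filter] at m1
    refine tri2 ?_ ?_ ?_
    · rw [hc', P.opp_opp c m1.1, hc]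
    · rw [hc']; intro h; exact m3 (by rw [← h, P.opp_opp c m1.1])
    · rw [hc']; intro h; exact m2 (inj _ m1.1 _ P.root_mem h)
  by_cases hc2 : ∃ c ∈ F, n c = o (n (n (n a))) ∧ n (o a) = o c
  · obtain ⟨c, hcF, hc, hc'⟩ := hc2
    obtain ⟨m1, m2, m3, m4⟩ := h1 c hcF
    simp only [Finset.mem_filter] at m1
    refine tri1 ?_ ?_ ?_
    · rw [hc', P.opp_opp c m1.1, hc]
    · rw [hc']; intro h; exact m3 (by rw [← h, P.opp_opp c m1.1])
    · rw [hc']; intro h; exact m2 (inj _ m1.1 _ P.root_mem h)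
  have hFz : ∀ c ∈ F, c ∈ S ∧ μ c ≠ μ a := fun c hc => by simpa using (h1 c hc).1
  -- A new edge traversed by `F` is split at `μ a`, which adds one dart.
  refine ⟨F ∪ {c | (c = n (n a) ∧ o (n a) ∈ F) ∨ (c = a ∧ o (n (n (n a))) ∈ F)}, u, Or.inl hu,
    ?_, ?_, ?_⟩
  · rintro c (hc | ⟨rfl, hc⟩ | ⟨rfl, hc⟩)
    · obtain ⟨m1, m2, m3, m4⟩ := h1 c hc
      refine ⟨(hFz c hc).1, m2, m3, ?_⟩
      by_cases hcb : c = o (n a)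
      · subst hcb; right; left; exact ⟨by rw [oob], hc⟩
      by_cases hcq : c = o (n (n (n a)))
      · subst hcq; right; right; exact ⟨by rw [ooq, hfour], hc⟩
      left
      rwa [so c (fun h => haF (h ▸ hc)) hcq hcb (fun h => hpF (h ▸ hc))] at m4
    · refine ⟨hpS, (key _ (l2 a)).1, (key _ (l2 a)).2, Or.inl ?_⟩
      have := (h1 _ hc).2.2.2
      rwa [sb] at this
    · refine ⟨ha, (key _ rfl).1, (key _ rfl).2, Or.inl ?_⟩
      have := (h1 _ hc).2.2.2
      rwa [sq] at this
  · rintro c (hc | ⟨rfl, hc⟩ | ⟨rfl, hc⟩) hcu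
    · obtain ⟨m1, m2, m3, m4⟩ := h1 c hc
      obtain ⟨k1, k2, k3⟩ := h2 c hc hcu
      refine ⟨?_, k2, k3⟩
      by_cases hcb : c = o (n a)
      · subst hcb; rw [B1, ooa, oob]
      by_cases hcq : c = o (n (n (n a)))
      · subst hcq; rw [B2, oop, ooq]
      rw [so c (fun h => haF (h ▸ hc)) hcq hcb (fun h => hpF (h ▸ hc))] at k1
      by_cases hnb : n c = o (n a)
      · rw [hnb, sb] at k1
        exact absurd ⟨c, hc, hnb, k1⟩ hc1
      by_cases hnq : n c = o (n (n (n a)))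
      · rw [hnq, sq] at k1
        exact absurd ⟨c, hc, hnq, k1⟩ hc2
      rwa [so _ ?_ hnq hnb ?_] at k1
      · rw [← B1]; exact fun h => hcb (H.injective h)
      · rw [← B2]; exact fun h => hcq (H.injective h)
    · exact ⟨B2, (key _ (l3 a)).1, (key _ (l3 a)).2⟩
    · exact ⟨B1, (key _ (l1 _)).1, (key _ (l1 _)).2⟩
  -- A face running along both new edges would have two corners at `μ (o (n (n a)))`. So `μ a`
  -- contributes at most one corner.
  · have hboth : ¬ (o (n a) ∈ F ∧ o (n (n (n a))) ∈ F) := by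
      rintro ⟨hbF, hqF⟩
      have h4 := (h1 _ hbF).2.2.2
      rw [sb] at h4
      exact dnp1 (h3 _ h4 _ hqF (by rw [l1, hq]))
    rintro c (hc | ⟨rfl, hc⟩ | ⟨rfl, hc⟩) c' (hc' | ⟨rfl, hc'⟩ | ⟨rfl, hc'⟩) hcc
    · exact h3 c hc c' hc' hcc
    · rw [l2] at hcc; exact absurd hcc (hFz c hc).2
    · exact absurd hcc (hFz c hc).2
    · rw [l2] at hcc; exact absurd hcc.symm (hFz c' hc').2
    · rfl
    · exact absurd ⟨hc, hc'⟩ hboth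
    · exact absurd hcc.symm (hFz c' hc').2
    · exact absurd ⟨hc', hc⟩ hboth
    · rfl

end PlanarPiece

/-- A weak form of having treewidth at most 2: given adjacent vertices `r, s`, every set of vertices
not contained in `{r, s}` contains another vertex with at most two neighbours, which are adjacent. -/
def SimplicialCover (share : V → V → Prop) : Prop :=
  ∀ (W : Finset V) (r s : V), share r s → (∃ w ∈ W, w ≠ r ∧ w ≠ s) → ∃ z ∈ W, z ≠ r ∧ z ≠ s ∧
    (∀ v ∈ W, ∀ w ∈ W, share z v → share z w → share v w) ∧
    ∀ u ∈ W, ∀ v ∈ W, ∀ w ∈ W, u ≠ z → v ≠ z → w ≠ z → share z u → share z v → share z w →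
      u = v ∨ u = w ∨ v = w

namespace PlanarPiece

/-- The twisted pair encloses a region `R` attached by its two edges only. If the root is outside
`R`, one recurses into `R`. If it is inside, the vertices outside `R` other than `μ a` are attached
only by the other pair at `μ a`, and one recurses there. -/
theorem hasTwistFace_of_twisted [DecidableEq α] (H : FourRegular n μ)
    (P : PlanarPiece n μ share S o e)
    (IH : ∀ (S' : Finset α) (o' : α → α) (e' : α), S'.card < S.card →
      PlanarPiece n μ share S' o' e' → HasTwistFace n μ S' o' e')
    {a : α} (ha : a ∈ S) (hb : μ (o (n a)) = μ (o a))
    (hq : μ (o (n (n (n a)))) = μ (o (n (n a)))) (hx : μ (o a) ≠ μ a)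
    (hy : μ (o (n (n a))) ≠ μ a) (he : μ e ≠ μ a)
    (hxx : share (μ (o a)) (μ (o a))) (hyy : share (μ (o (n (n a)))) (μ (o (n (n a)))))
    (ht : n (o a) = o (n a)) : HasTwistFace n μ S o e := by
  classical
  have hbS := P.next_mem a ha
  have hpS := P.next_mem _ hbS
  have hqS := P.next_mem _ hpS
  have l1 := H.label_next
  have l2 := H.label_two
  have l3 := H.label_three
  have oop := P.opp_opp _ hpS
  have ooq := P.opp_opp _ hqS
  obtain ⟨R, hRS, hRn, hRa, hRb, hRo, hRz⟩ := P.exists_region_of_twisted H ha ht hx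
  by_cases heR : e ∉ R
  · have hcard : R.card < S.card := Finset.card_lt_card
      (Finset.ssubset_iff_subset_ne.2 ⟨hRS, fun h => hRz a (h ▸ ha) rfl⟩)
    exact P.hasTwistFace_of_cut H ha hRS hRn hRo he heR
      (IH R _ _ hcard (P.cut H ha hRS hRn hRa hRb hRo hRz hb hxx))
  rw [not_not] at heR
  set T : Finset α := {d ∈ S | μ d ≠ μ a ∧ d ∉ R} with hT
  have hTS : T ⊆ S := Finset.filter_subset _ _
  have hnR : ∀ d, n d ∈ R → d ∈ R := fun d hd => by
    rw [← H.four d]; exact hRn _ (hRn _ (hRn _ hd))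
  have hTn : ∀ d ∈ T, n d ∈ T := by
    intro d hd
    simp only [hT, Finset.mem_filter] at hd ⊢
    exact ⟨P.next_mem d hd.1, by rw [l1]; exact hd.2.1, fun h => hd.2.2 (hnR d h)⟩
  have hout : ∀ d ∈ S, d ≠ a → d ≠ n a → d ∉ R → o d ∉ R := by
    intro d hd h1 h2 hdR h
    have := hRo _ h (fun h' => h1 (by rw [← P.opp_opp d hd, h', P.opp_opp a ha]))
      (fun h' => h2 (by rw [← P.opp_opp d hd, h', P.opp_opp _ hbS]))
    rw [P.opp_opp d hd] at this
    exact hdR this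
  have hTp : o (n (n a)) ∈ T := by
    simp only [hT, Finset.mem_filter]
    exact ⟨P.opp_mem _ hpS, hy, hout _ hpS (H.ne_two a) (H.ne_one _) fun h => hRz _ h (l2 a)⟩
  have hTq : o (n (n (n a))) ∈ T := by
    simp only [hT, Finset.mem_filter]
    exact ⟨P.opp_mem _ hqS, by rw [hq]; exact hy, hout _ hqS (H.ne_three a) (H.ne_two _)
      fun h => hRz _ h (l3 a)⟩
  have hTz : ∀ d ∈ T, μ d ≠ μ (n (n a)) := by
    intro d hd
    simp only [hT, Finset.mem_filter] at hd
    rw [l2]; exact hd.2.1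
  have hTo : ∀ d ∈ T, d ≠ o (n (n a)) → d ≠ o (n (n (n a))) → o d ∈ T := by
    intro d hd h1 h2
    simp only [hT, Finset.mem_filter] at hd ⊢
    refine ⟨P.opp_mem d hd.1, fun h => ?_, hout d hd.1 (fun h => hd.2.1 (by rw [h]))
      (fun h => hd.2.1 (by rw [h, l1])) hd.2.2⟩
    have hdd := P.opp_opp d hd.1
    rcases H.eq_of_label _ _ h with r | r | r | r <;> rw [r] at hdd
    · exact hd.2.2 (hdd ▸ hRa)
    · exact hd.2.2 (hdd ▸ hRb)
    · exact h1 hdd.symm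
    · exact h2 hdd.symm
  have hcard : T.card < S.card := Finset.card_lt_card
    (Finset.ssubset_iff_subset_ne.2 ⟨hTS, fun h => hTz a (h ▸ ha) (l2 a).symm⟩)
  have heT : e ∉ T := by simp [hT, heR]
  exact P.hasTwistFace_of_cut H hpS hTS hTn hTo (by rwa [l2]) heT
    (IH T _ _ hcard (P.cut H hpS hTS hTn hTp hTq hTo hTz hq hyy))

/-- The induction is on the number of darts and needs the arbitrary root, since a cut makes the new
edge the one to be avoided. It works with `share` rather than adjacency because edges created by
cuts and smoothings still join vertices that share. -/
theorem hasTwistFace (H : FourRegular n μ) (hshare : SimplicialCover share)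
    (P : PlanarPiece n μ share S o e) : HasTwistFace n μ S o e := by
  classical
  induction hk : S.card using Nat.strong_induction_on generalizing S o e with
  | _ k IH =>
  subst hk
  have l1 := H.label_next
  have l2 := H.label_two
  have l3 := H.label_three
  have heS := P.root_mem
  have hoeS := P.opp_mem e heS
  -- If the root edge covers all vertices: when it is a loop, `n (n e)` lies on another loop;
  -- otherwise the three other ends at `μ e` contain a loop end or belong to three parallel edges.
  by_cases hbase : ∀ d ∈ S, μ d = μ e ∨ μ d = μ (o e)
  · have h1S := P.next_mem e heS
    have h2S := P.next_mem _ h1S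
    have h3S := P.next_mem _ h2S
    by_cases hre : μ (o e) = μ e
    · refine P.hasTwistFace_of_loop H h2S ?_ (H.ne_two e) ?_
      · have := hbase _ (P.opp_mem _ h2S)
        rw [hre] at this
        rw [l2]; tauto
      · intro h
        rw [P.opp_eq_iff heS h2S] at h
        exact P.opp_ne_next_next H heS h.symm
    · have key : ∀ c ∈ S, μ c = μ e → o c ≠ e := fun c hc hce h =>
        hre (by rw [← hce, ← P.opp_opp c hc, h])
      by_cases g1 : μ (o (n e)) = μ e
      · exact P.hasTwistFace_of_loop H h1S (by rw [g1, l1]) (H.ne_one e) (key _ h1S (l1 e))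
      by_cases g2 : μ (o (n (n e))) = μ e
      · exact P.hasTwistFace_of_loop H h2S (by rw [g2, l2]) (H.ne_two e) (key _ h2S (l2 e))
      by_cases g3 : μ (o (n (n (n e)))) = μ e
      · exact P.hasTwistFace_of_loop H h3S (by rw [g3, l3]) (H.ne_three e) (key _ h3S (l3 e))
      have s1 := (hbase _ (P.opp_mem _ h1S)).resolve_left g1
      have s2 := (hbase _ (P.opp_mem _ h2S)).resolve_left g2
      have s3 := (hbase _ (P.opp_mem _ h3S)).resolve_left g3
      exact P.hasTwistFace_of_triple H h1S (by rw [s1, s2]) (by rw [s1, s3])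
        (by rw [l1]; exact g1) ⟨H.ne_one e, key _ h1S (l1 e)⟩ ⟨H.ne_two e, key _ h2S (l2 e)⟩
        ⟨H.ne_three e, key _ h3S (l3 e)⟩
  push Not at hbase
  obtain ⟨d0, hd0, hd1, hd2⟩ := hbase
  obtain ⟨z, hzW, hzr, hzs, hz1, hz2⟩ := hshare (S.image μ) (μ e) (μ (o e)) (P.share_opp e heS)
    ⟨μ d0, Finset.mem_image_of_mem _ hd0, hd1, hd2⟩
  have key : ∀ c ∈ S, μ c = z → c ≠ e ∧ o c ≠ e := fun c hc hcz =>
    ⟨fun h => hzr (by rw [← hcz, h]), fun h => hzs (by rw [← h, P.opp_opp c hc, hcz])⟩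
  by_cases hloop : ∃ d ∈ S, μ d = z ∧ μ (o d) = z
  · obtain ⟨d, hd, h1, h2⟩ := hloop
    exact P.hasTwistFace_of_loop H hd (by rw [h1, h2]) (key d hd h1).1 (key d hd h1).2
  push Not at hloop
  have hW : ∀ d ∈ S, μ (o d) ∈ S.image μ := fun d hd => Finset.mem_image_of_mem _ (P.opp_mem d hd)
  have hsz : ∀ d ∈ S, μ d = z → share z (μ (o d)) := fun d hd h => h ▸ P.share_opp d hd
  have hthree : ∀ c ∈ S, ∀ d ∈ S, ∀ f ∈ S, μ c = z → μ d = z → μ f = z →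
      μ (o c) = μ (o d) ∨ μ (o c) = μ (o f) ∨ μ (o d) = μ (o f) := fun c hc d hd f hf h1 h2 h3 =>
    hz2 _ (hW c hc) _ (hW d hd) _ (hW f hf) (hloop c hc h1) (hloop d hd h2) (hloop f hf h3)
      (hsz c hc h1) (hsz d hd h2) (hsz f hf h3)
  -- Four edges to at most two neighbors: if no two consecutive ones had a common end, they would
  -- alternate.
  have hadj : ∃ a ∈ S, μ a = z ∧ μ (o (n a)) = μ (o a) := by
    by_contra hno
    push Not at hno
    obtain ⟨a, ha, haz⟩ := Finset.mem_image.1 hzW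
    have hb := P.next_mem a ha
    have hp := P.next_mem _ hb
    have hq := P.next_mem _ hp
    have c0 := hno a ha haz
    have c1 := hno _ hb (by rw [l1, haz])
    have c2 := hno _ hp (by rw [l2, haz])
    have c3 := hno _ hq (by rw [l3, haz])
    have t1 := hthree a ha _ hb _ hp haz (by rw [l1, haz]) (by rw [l2, haz])
    have t2 := hthree _ hb _ hp _ hq (by rw [l1, haz]) (by rw [l2, haz]) (by rw [l3, haz])
    have h1 : μ (o (n (n a))) = μ (o a) := by
      rcases t1 with t | t | t
      · exact absurd t.symm c0
      · exact t.symm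
      · exact absurd t.symm c1
    have h2 : μ (o (n (n (n a)))) = μ (o (n a)) := by
      rcases t2 with t | t | t
      · exact absurd t.symm c1
      · exact t.symm
      · exact absurd t.symm c2
    exact c0 (P.not_alternating H ha h1 h2 (by rw [haz]; exact hloop a ha haz)
      (by rw [haz]; exact hloop _ hb (by rw [l1, haz])))
  obtain ⟨a, ha, rfl, hab⟩ := hadj
  have hb := P.next_mem a ha
  have hp := P.next_mem _ hb
  have hq := P.next_mem _ hp
  have ka := key a ha rfl
  have kb := key _ hb (l1 a)
  have kp := key _ hp (l2 a)
  have kq := key _ hq (l3 a)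
  by_cases hpa : μ (o (n (n a))) = μ (o a)
  · exact P.hasTwistFace_of_triple H ha hab hpa (hloop a ha rfl) ka kb kp
  by_cases hqa : μ (o (n (n (n a)))) = μ (o a)
  · refine P.hasTwistFace_of_triple H hq ?_ ?_ (by rw [l3]; exact hloop _ hq (l3 a)) kq ?_ ?_
    · rw [H.four, hqa]
    · rw [H.four, hab, hqa]
    · rw [H.four]; exact ka
    · rw [H.four]; exact kb
  have hqp : μ (o (n (n (n a)))) = μ (o (n (n a))) := by
    rcases hthree a ha _ hp _ hq rfl (l2 a) (l3 a) with t | t | t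
    · exact absurd t.symm hpa
    · exact absurd t.symm hqa
    · exact t.symm
  have hx := hloop a ha rfl
  have hy := hloop _ hp (l2 a)
  have sh : ∀ c ∈ S, ∀ d ∈ S, μ c = μ a → μ d = μ a → share (μ (o c)) (μ (o d)) :=
    fun c hc d hd h1 h2 => hz1 _ (hW c hc) _ (hW d hd) (hsz c hc h1) (hsz d hd h2)
  have IH' : ∀ (S' : Finset α) (o' : α → α) (e' : α), S'.card < S.card →
      PlanarPiece n μ share S' o' e' → HasTwistFace n μ S' o' e' :=
    fun S' o' e' h P' => IH _ h P' rfl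
  -- What remains is one pair of consecutive edges to each of two distinct neighbors.
  rcases P.bigon_or_twisted H ha hab hx with B1 | T1
  swap
  · exact P.hasTwistFace_of_twisted H IH' ha hab hqp hx hy hzr.symm (sh a ha a ha rfl rfl)
      (sh _ hp _ hp (l2 a) (l2 a)) T1
  rcases P.bigon_or_twisted H hp hqp (by rwa [l2]) with B2 | T2
  swap
  · refine P.hasTwistFace_of_twisted H IH' hp hqp ?_ (by rwa [l2]) ?_ ?_
      (sh _ hp _ hp (l2 a) (l2 a)) ?_ T2
    · simp only [H.four, hab]
    · rwa [H.four, l2]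
    · rw [l2]; exact hzr.symm
    · rw [H.four]; exact sh a ha a ha rfl rfl
  refine P.hasTwistFace_of_smooth H ha hab hqp hx hy (fun h => hpa h.symm) hzr.symm hzs.symm B1 B2
    (IH' _ _ _ ?_ (P.smooth H ha hab hqp hx hy (sh _ ha _ hp rfl (l2 a)) (sh _ hp _ ha (l2 a) rfl)
      hzr.symm))
  exact Finset.card_lt_card (Finset.filter_ssubset.2 ⟨a, ha, by simp⟩)

end PlanarPiece

end TwistFaceExistence

/-! ### Tree models and their simplicial vertices. -/

section TreeModels

variable {V : Type*}

/-- A tree with bags of at most three elements, where the nodes whose bags contain a given element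
form a subtree. -/
structure IsTreeModel {k : ℕ} (T : SimpleGraph (Fin k)) (bag : Fin k → Set V) : Prop where
  isTree : T.IsTree
  card_le : ∀ i, (bag i).encard ≤ 3
  connected : ∀ v, (T.induce {i | v ∈ bag i}).Preconnected

/-- Two elements lie in a common bag. -/
def ShareBag {k : ℕ} (bag : Fin k → Set V) (u v : V) : Prop := ∃ i, u ∈ bag i ∧ v ∈ bag i

theorem ShareBag.symm {k : ℕ} {bag : Fin k → Set V} {u v : V} (h : ShareBag bag u v) :
    ShareBag bag v u := by
  obtain ⟨i, h1, h2⟩ := h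
  exact ⟨i, h2, h1⟩

theorem SimpleGraph.dist_le_of_mem_support {W : Type*} {G : SimpleGraph W} {s r x : W}
    (w : G.Walk s r) (hw : w.length = G.dist r s) (hx : x ∈ w.support) (h : G.dist r s ≤ G.dist r x) :
    x = s := by
  classical
  have h1 := congrArg SimpleGraph.Walk.length (w.take_spec hx)
  rw [SimpleGraph.Walk.length_append] at h1
  have h2 : G.dist r x ≤ (w.dropUntil x hx).length := by
    rw [SimpleGraph.dist_comm]; exact SimpleGraph.dist_le _
  have h3 : (w.takeUntil x hx).length = 0 := by omega
  exact (SimpleGraph.Walk.eq_of_length_eq_zero h3).symm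

/-- In a rooted tree, if a subtree contains a node `i` and another node which is not deeper, then it
contains the parent of `i`. -/
theorem SimpleGraph.IsTree.parent_mem {W : Type*} {T : SimpleGraph W} (hT : T.IsTree) {r : W}
    {S : Set W} (hS : (T.induce S).Preconnected) {i s p : W} (hi : i ∈ S) (hs : s ∈ S) (his : i ≠ s)
    (hle : T.dist r s ≤ T.dist r i) (hp : T.Adj i p) (hpi : T.dist r p < T.dist r i) : p ∈ S := by
  classical
  obtain ⟨w0⟩ := hS ⟨i, hi⟩ ⟨s, hs⟩
  let w1 : T.Walk i s := w0.map (SimpleGraph.Embedding.induce S).toHom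
  have hw1 : ∀ x ∈ w1.support, x ∈ S := by
    intro x hx
    have hx : x ∈ (w0.map (SimpleGraph.Embedding.induce S).toHom).support := hx
    rw [SimpleGraph.Walk.support_map] at hx
    obtain ⟨y, _, rfl⟩ := List.mem_map.1 hx
    exact y.2
  obtain ⟨w2, hw2⟩ := hT.connected.exists_walk_length_eq_dist s r
  obtain ⟨w3, hw3, hw3'⟩ := hT.connected.exists_path_of_dist p r
  have hi3 : i ∉ w3.support := by
    intro h
    have := SimpleGraph.dist_le_of_mem_support w3 (by rw [hw3', SimpleGraph.dist_comm]) h hpi.le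
    exact hp.ne this
  have hi2 : i ∉ w2.support := by
    intro h
    exact his (SimpleGraph.dist_le_of_mem_support w2 (by rw [hw2, SimpleGraph.dist_comm]) h hle)
  have hpath : (SimpleGraph.Walk.cons hp w3).IsPath := hw3.cons hi3
  -- The unique path from `i` to the root starts with the edge to `p`. The walk via `s` contains it,
  -- so it uses this edge, and does so inside `S`, because the geodesic from `s` to the root avoids
  -- `i`.
  have heq : (w1.append w2).bypass = SimpleGraph.Walk.cons hp w3 :=
    congrArg Subtype.val ((hT.isAcyclic.subsingleton_path i r).elim
      ⟨_, (w1.append w2).bypass_isPath⟩ ⟨_, hpath⟩)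
  have hmem : s(i, p) ∈ (w1.append w2).edges := by
    apply SimpleGraph.Walk.edges_bypass_subset_edges
    rw [heq]
    simp
  rw [SimpleGraph.Walk.edges_append, List.mem_append] at hmem
  rcases hmem with hmem | hmem
  · exact hw1 _ (SimpleGraph.Walk.snd_mem_support_of_mem_edges _ hmem)
  · exact absurd (SimpleGraph.Walk.fst_mem_support_of_mem_edges _ hmem) hi2

theorem SimpleGraph.Connected.exists_parent {W : Type*} {T : SimpleGraph W} (hT : T.Connected)
    {r i : W} (h : i ≠ r) : ∃ p, T.Adj i p ∧ T.dist r p < T.dist r i := by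
  obtain ⟨w, hw⟩ := hT.exists_walk_length_eq_dist i r
  cases w with
  | nil => exact absurd rfl h
  | @cons _ p _ hadj w' =>
    refine ⟨p, hadj, ?_⟩
    rw [SimpleGraph.Walk.length_cons] at hw
    have := SimpleGraph.dist_le w'
    rw [SimpleGraph.dist_comm, SimpleGraph.dist_comm (u := r) (v := i)]
    omega

/-- Helly property for two subtrees of a rooted tree: if they meet, then the top node of one of them
belongs to the other one. -/
theorem SimpleGraph.IsTree.top_mem {W : Type*} {T : SimpleGraph W} (hT : T.IsTree) {r : W}
    {A B : Set W} (hA : (T.induce A).Preconnected) (hB : (T.induce B).Preconnected) {a b : W}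
    (ha : a ∈ A) (hb : b ∈ B) (ha' : ∀ x ∈ A, T.dist r a ≤ T.dist r x)
    (hb' : ∀ x ∈ B, T.dist r b ≤ T.dist r x) (hab : T.dist r a ≤ T.dist r b) {i : W} (hiA : i ∈ A)
    (hiB : i ∈ B) : b ∈ A := by
  induction hk : T.dist r i using Nat.strong_induction_on generalizing i with
  | _ k IH =>
  subst hk
  by_cases hib : i = b
  · rwa [hib] at hiA
  have hir : i ≠ r := by
    rintro rfl
    have h1 := hb' _ hiB
    rw [SimpleGraph.dist_self, Nat.le_zero] at h1
    exact hib (hT.connected.dist_eq_zero_iff.1 h1)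
  -- Climbing from a common node stays in both subtrees until the top of `B` is reached.
  obtain ⟨p, hp, hpi⟩ := hT.connected.exists_parent hir
  have hpB : p ∈ B := hT.parent_mem hB hiB hb hib (hb' _ hiB) hp hpi
  by_cases hia : i = a
  · subst hia
    have := hb' _ hpB
    omega
  · exact IH _ hpi (hT.parent_mem hA hiA ha hia (ha' _ hiA) hp hpi) hpB rfl

variable {k : ℕ} {T : SimpleGraph (Fin k)} {bag : Fin k → Set V}

/-- Root the tree at a bag containing `r` and `s`, whose subtrees then have their tops at the root,
and take `z` with the deepest top among the other elements of `W`. By the Helly property the top bag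
of `z` contains every element of `W` that shares with `z`, and it has at most three elements. -/
theorem IsTreeModel.simplicialCover (M : IsTreeModel T bag) : SimplicialCover (ShareBag bag) := by
  classical
  intro W r s ⟨root, hr, hs⟩ hW
  -- An element in no bag shares with nothing and can serve as `z`.
  by_cases hempty : ∃ w ∈ W, w ≠ r ∧ w ≠ s ∧ ∀ i, w ∉ bag i
  · obtain ⟨z, hz, h1, h2, h3⟩ := hempty
    exact ⟨z, hz, h1, h2, fun v _ w _ h _ => absurd h.choose_spec.1 (h3 _),
      fun u _ v _ w _ _ _ _ h _ _ => absurd h.choose_spec.1 (h3 _)⟩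
  push Not at hempty
  have htop : ∀ w, (∃ i, w ∈ bag i) → ∃ t, w ∈ bag t ∧ ∀ i, w ∈ bag i → T.dist root t ≤ T.dist root i := by
    intro w hw
    obtain ⟨t, ht, ht'⟩ := Set.exists_min_image {i | w ∈ bag i} (T.dist root) (Set.toFinite _) hw
    exact ⟨t, ht, ht'⟩
  let top : V → Fin k := fun w => if h : ∃ i, w ∈ bag i then (htop w h).choose else root
  have htop1 : ∀ w i, w ∈ bag i → w ∈ bag (top w) := fun w i hi => by
    have h : ∃ i, w ∈ bag i := ⟨i, hi⟩
    simp only [top, dif_pos h]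
    exact (htop w h).choose_spec.1
  have htop2 : ∀ w i, w ∈ bag i → T.dist root (top w) ≤ T.dist root i := fun w i hi => by
    have h : ∃ i, w ∈ bag i := ⟨i, hi⟩
    simp only [top, dif_pos h]
    exact (htop w h).choose_spec.2 i hi
  obtain ⟨z, hz, hmax⟩ := Finset.exists_max_image {w ∈ W | w ≠ r ∧ w ≠ s}
    (fun w => T.dist root (top w)) (by
      obtain ⟨w, h1, h2⟩ := hW
      exact ⟨w, by simp [h1, h2]⟩)
  simp only [Finset.mem_filter] at hz hmax
  obtain ⟨hzW, hzr, hzs⟩ := hz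
  have key : ∀ w ∈ W, ShareBag bag z w → w ∈ bag (top z) := by
    rintro w hw ⟨i, hzi, hwi⟩
    have hle : T.dist root (top w) ≤ T.dist root (top z) := by
      by_cases hw1 : w = r
      · subst hw1
        have := htop2 w root hr
        rw [SimpleGraph.dist_self] at this
        omega
      by_cases hw2 : w = s
      · subst hw2
        have := htop2 w root hs
        rw [SimpleGraph.dist_self] at this
        omega
      exact hmax w ⟨hw, hw1, hw2⟩
    exact M.isTree.top_mem (M.connected w) (M.connected z) (htop1 w i hwi) (htop1 z i hzi)
      (htop2 w) (htop2 z) hle hwi hzi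
  refine ⟨z, hzW, hzr, hzs, fun v hv w hw h1 h2 => ⟨top z, key v hv h1, key w hw h2⟩, ?_⟩
  intro u hu v hv w hw huz hvz hwz h1 h2 h3
  by_contra hne
  push Not at hne
  obtain ⟨i, hzi, _⟩ := h1
  have hsub : (↑({z, u, v, w} : Finset V) : Set V) ⊆ bag (top z) := by
    intro t ht
    simp only [Finset.coe_insert, Finset.coe_singleton, Set.mem_insert_iff,
      Set.mem_singleton_iff] at ht
    rcases ht with rfl | rfl | rfl | rfl
    · exact htop1 _ i hzi
    · exact key _ hu ⟨i, hzi, by assumption⟩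
    · exact key _ hv h2
    · exact key _ hw h3
  have h4 := (Set.encard_le_encard hsub).trans (M.card_le _)
  rw [Set.encard_coe_eq_coe_finsetCard, Finset.card_insert_of_notMem, Finset.card_insert_of_notMem,
    Finset.card_insert_of_notMem, Finset.card_singleton] at h4
  · exact absurd h4 (by decide)
  · simpa using hne.2.2
  · simpa using ⟨hne.1, hne.2.1⟩
  · simpa using ⟨huz.symm, hvz.symm, hwz.symm⟩

/-- Contracting an element of a tree model into another one. -/
theorem IsTreeModel.contract [DecidableEq V] (M : IsTreeModel T bag) {x y : V}
    (h : ShareBag bag x y) :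
    IsTreeModel T (fun i => (fun v => if v = x then y else v) '' bag i) := by
  refine ⟨M.isTree, fun i => (Set.encard_image_le _ _).trans (M.card_le i), fun v => ?_⟩
  by_cases hvy : v = y
  · have : {i | v ∈ (fun v => if v = x then y else v) '' bag i} =
        {i | x ∈ bag i} ∪ {i | y ∈ bag i} := by
      ext i
      simp only [Set.mem_ofPred_eq, Set.mem_image, Set.mem_union]
      constructor
      · rintro ⟨w, hw, hw'⟩
        by_cases hwx : w = x
        · left; rwa [hwx] at hw
        · right; rw [if_neg hwx, hvy] at hw'; rwa [hw'] at hw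
      · rintro (hw | hw)
        · exact ⟨x, hw, by simp [hvy]⟩
        · exact ⟨y, hw, by simp [hvy]⟩
    rw [this]
    obtain ⟨i, h1, h2⟩ := h
    exact (SimpleGraph.induce_union_connected (M.connected x) (M.connected y) ⟨i, h1, h2⟩).preconnected
  by_cases hvx : v = x
  · have : {i | v ∈ (fun v => if v = x then y else v) '' bag i} = ∅ := by
      ext i
      simp only [Set.mem_ofPred_eq, Set.mem_image, Set.mem_empty_iff_false, iff_false]
      rintro ⟨w, hw, hw'⟩
      by_cases hwx : w = x
      · rw [if_pos hwx] at hw'; exact hvy hw'.symm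
      · rw [if_neg hwx] at hw'; exact hwx (hw'.trans hvx)
    rw [this]
    rintro ⟨i, hi⟩
    exact hi.elim
  · have : {i | v ∈ (fun v => if v = x then y else v) '' bag i} = {i | v ∈ bag i} := by
      ext i
      simp only [Set.mem_ofPred_eq, Set.mem_image]
      constructor
      · rintro ⟨w, hw, hw'⟩
        by_cases hwx : w = x
        · rw [if_pos hwx] at hw'; exact absurd hw'.symm hvy
        · rw [if_neg hwx] at hw'; rwa [hw'] at hw
      · intro hv
        exact ⟨v, hv, if_neg hvx⟩
    rw [this]
    exact M.connected v

theorem ShareBag.image {bag : Fin k → Set V} {W : Type*} (π : V → W) {u v : V}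
    (h : ShareBag bag u v) : ShareBag (fun i => π '' bag i) (π u) (π v) := by
  obtain ⟨i, h1, h2⟩ := h
  exact ⟨i, Set.mem_image_of_mem _ h1, Set.mem_image_of_mem _ h2⟩

theorem exists_isTreeModel_of_treewidth_le {G : SimpleGraph V} (h : G.treewidth ≤ 2) :
    ∃ (k : ℕ) (T : SimpleGraph (Fin k)) (bag : Fin k → Set V), IsTreeModel T bag ∧
      (∀ v, ∃ i, v ∈ bag i) ∧ ∀ v w, G.Adj v w → ShareBag bag v w := by
  -- The strict bound lets the infimum be replaced by an actual decomposition; integrality of the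
  -- bag sizes gives the bound 2 back.
  have h3 : G.treewidth < 3 := lt_of_le_of_lt h (by decide)
  obtain ⟨t, ht⟩ := iInf_lt_iff.1 h3
  refine ⟨t.size, t.tree, t.bag, ⟨t.isTree, fun i => ?_, fun v => (t.connected v).preconnected⟩,
    t.vertex_mem, t.edge_mem⟩
  have h1 : (t.bag i).encard - 1 < 3 := lt_of_le_of_lt (le_iSup (fun i => (t.bag i).encard - 1) i) ht
  have h2 : (t.bag i).encard - 1 ≤ 2 := by
    have : (3 : ℕ∞) = 2 + 1 := by norm_num
    rw [this] at h1
    exact Order.le_of_lt_add_one h1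
  rw [tsub_le_iff_right] at h2
  exact h2.trans (by norm_num)

end TreeModels

/-! ### Fox colorings; invariance under isotopy, subdivision and twists. -/

section Colorings

/-- The relation of a Fox coloring at a crossing: the colors of the two ends of the upper strand
agree, and they are the mean of the colors of the two ends of the lower strand. -/
def CrossingRelation {α R : Type*} [CommRing R] (nx : α → α) (ov : α → Bool) (g : α → R)
    (d : α) : Prop :=
  (ov d = true → g (nx (nx d)) = g d ∧ g (nx d) + g (nx (nx (nx d))) = 2 * g d) ∧
  (ov d = false → g (nx (nx (nx d))) = g (nx d) ∧ g d + g (nx (nx d)) = 2 * g (nx d))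

/-- A quarter turn exchanges over and under and with them the two clauses, so the relation belongs
to the crossing and not to the chosen end. -/
theorem CrossingRelation.next {α R : Type*} [CommRing R] {nx : α → α} {ov : α → Bool} {g : α → R}
    {d : α} (h : CrossingRelation nx ov g d) (h4 : nx (nx (nx (nx d))) = d)
    (ho : ov (nx d) = !(ov d)) : CrossingRelation nx ov g (nx d) := by
  obtain ⟨h1, h2⟩ := h
  constructor
  · intro h
    rw [h] at ho
    obtain ⟨e1, e2⟩ := h2 (by simpa using ho.symm)
    rw [h4]
    exact ⟨e1, by rw [add_comm]; exact e2⟩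
  · intro h
    rw [h] at ho
    obtain ⟨e1, e2⟩ := h1 (by simpa using ho.symm)
    rw [h4]
    exact ⟨e1.symm, by rw [e1]; exact e2⟩

namespace KnotDiagram

/-- A Fox coloring of the edges of a diagram. -/
structure IsColoring (D : KnotDiagram) {R : Type*} [CommRing R] (g : D.Dart → R) : Prop where
  opp : ∀ d, g (D.opp d) = g d
  next : ∀ d, ¬ D.IsCrossing d → g (D.next d) = g d
  crossing : ∀ d, D.IsCrossing d → CrossingRelation D.next D.isOver g d

/-- The diagram has a nonconstant Fox coloring modulo `m`. -/
def IsColorable (D : KnotDiagram) (m : ℕ) : Prop :=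
  ∃ g : D.Dart → ZMod m, D.IsColoring g ∧ ∃ d d', g d ≠ g d'

variable {D E : KnotDiagram} {m : ℕ}

theorem isCrossing_next (d : D.Dart) : D.IsCrossing (D.next d) ↔ D.IsCrossing d := by
  simp [IsCrossing, D.next.injective.eq_iff]

theorem next_three_ne (d : D.Dart) : D.next (D.next (D.next d)) ≠ d := fun h => by
  have h1 := D.next_four d
  rw [h] at h1
  exact D.next_ne d h1

theorem crossing_rotate {R : Type*} [CommRing R] {g : D.Dart → R} {a : D.Dart}
    (ha : D.IsCrossing a) (h : CrossingRelation D.next D.isOver g a) {x : D.Dart}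
    (hx : x = a ∨ x = D.next a ∨ x = D.next (D.next a) ∨ x = D.next (D.next (D.next a))) :
    CrossingRelation D.next D.isOver g x := by
  have h1 := h.next (D.next_four a) (D.isOver_next a ha)
  have ha1 := (isCrossing_next a).2 ha
  have h2 := h1.next (D.next_four _) (D.isOver_next _ ha1)
  have ha2 := (isCrossing_next _).2 ha1
  have h3 := h2.next (D.next_four _) (D.isOver_next _ ha2)
  rcases hx with rfl | rfl | rfl | rfl
  · exact h
  · exact h1
  · exact h2
  · exact h3

theorem crossingRelation_map {R : Type*} [CommRing R] {f : E.Dart → D.Dart} {g : D.Dart → R}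
    {g' : E.Dart → R} (hg : ∀ e, g (f e) = g' e) {e : E.Dart} (h1 : f (E.next e) = D.next (f e))
    (h2 : f (E.next (E.next e)) = D.next (D.next (f e)))
    (h3 : f (E.next (E.next (E.next e))) = D.next (D.next (D.next (f e))))
    (ho : E.isOver e = D.isOver (f e)) :
    CrossingRelation E.next E.isOver g' e ↔ CrossingRelation D.next D.isOver g (f e) := by
  simp only [CrossingRelation, ← hg, h1, h2, h3, ho]

theorem Isotopic.isColorable (h : Isotopic D E) (hD : D.IsColorable m) : E.IsColorable m := by
  obtain ⟨f, hn, ho, hs, _⟩ := h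
  obtain ⟨g, hg, x, y, hxy⟩ := hD
  have hc : ∀ e, E.IsCrossing e ↔ D.IsCrossing (f e) := by
    intro e
    simp only [IsCrossing, ← hn, ne_eq, f.injective.eq_iff]
  refine ⟨fun e => g (f e), ⟨fun d => ?_, fun d hd => ?_, fun d hd => ?_⟩, f.symm x, f.symm y, ?_⟩
  · rw [ho, hg.opp]
  · rw [hn, hg.next _ (fun h => hd ((hc d).2 h))]
  · rw [crossingRelation_map (fun _ => rfl) (hn _) (by rw [hn, hn]) (by rw [hn, hn, hn]) (hs d hd)]
    exact hg.crossing _ ((hc d).1 hd)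
  · simpa using hxy

theorem RemoveSubdivision.isColorable_iff (h : RemoveSubdivision D E) :
    D.IsColorable m ↔ E.IsColorable m := by
  obtain ⟨a, f, ha, hloop, hinj, hrange, hn, ho1, ho2, ho3, hs, _⟩ := h
  have haa : D.next (D.next a) = a := not_not.1 ha
  have hc : ∀ e, E.IsCrossing e ↔ D.IsCrossing (f e) := by
    intro e
    simp only [IsCrossing, ← hn, ne_eq, hinj.eq_iff]
  have hb : D.opp (D.next a) ≠ a := fun h => hloop (by rw [← D.opp_opp (D.next a), h])
  constructor
  · rintro ⟨g, hg, x, y, hxy⟩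
    have hga := hg.next a ha
    refine ⟨fun e => g (f e), ⟨fun d => ?_, fun d hd => ?_, fun d hd => ?_⟩, ?_⟩
    · by_cases h1 : D.opp (f d) = a
      · rw [ho2 d h1, hg.opp, hga, ← hg.opp (f d), h1]
      by_cases h2 : D.opp (f d) = D.next a
      · rw [ho3 d h2, hg.opp, ← hga, ← hg.opp (f d), h2]
      rw [ho1 d h1 h2, hg.opp]
    · rw [hn, hg.next _ (fun h => hd ((hc d).2 h))]
    · rw [crossingRelation_map (fun _ => rfl) (hn _) (by rw [hn, hn]) (by rw [hn, hn, hn])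
        (hs d hd)]
      exact hg.crossing _ ((hc d).1 hd)
    · by_contra hcon
      push Not at hcon
      have key : ∀ x, ∃ e, g (f e) = g x := by
        obtain ⟨e0, he0⟩ := (hrange (D.opp a)).2 ⟨D.opp_ne a, hloop⟩
        intro x
        by_cases h1 : x = a
        · exact ⟨e0, by rw [he0, hg.opp, h1]⟩
        by_cases h2 : x = D.next a
        · exact ⟨e0, by rw [he0, hg.opp, h2, hga]⟩
        obtain ⟨e, he⟩ := (hrange x).2 ⟨h1, h2⟩
        exact ⟨e, by rw [he]⟩
      obtain ⟨e1, h1⟩ := key x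
      obtain ⟨e2, h2⟩ := key y
      exact hxy (by rw [← h1, ← h2, hcon e1 e2])
  · rintro ⟨g', hg', x, y, hxy⟩
    obtain ⟨e0, he0⟩ := (hrange (D.opp a)).2 ⟨D.opp_ne a, hloop⟩
    obtain ⟨e1, he1⟩ := (hrange (D.opp (D.next a))).2 ⟨hb, D.opp_ne _⟩
    have h01 : E.opp e0 = e1 := hinj (by rw [ho2 e0 (by rw [he0, D.opp_opp]), he1])
    have hg01 : g' e1 = g' e0 := by rw [← h01, hg'.opp]
    have hmem : ∀ x, x = a ∨ x = D.next a ∨ ∃ e, f e = x := by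
      intro x
      by_cases h1 : x = a
      · exact Or.inl h1
      by_cases h2 : x = D.next a
      · exact Or.inr (Or.inl h2)
      exact Or.inr (Or.inr ((hrange x).2 ⟨h1, h2⟩))
    let g := Function.extend f g' (fun _ => g' e0)
    have hgf : ∀ e, g (f e) = g' e := fun e => hinj.extend_apply _ _ e
    have hga : g a = g' e0 := Function.extend_apply' _ _ _ (fun h => ((hrange a).1 h).1 rfl)
    have hgb : g (D.next a) = g' e0 :=
      Function.extend_apply' _ _ _ (fun h => ((hrange _).1 h).2 rfl)
    refine ⟨g, ⟨fun d => ?_, fun d hd => ?_, fun d hd => ?_⟩, f x, f y, by rwa [hgf, hgf]⟩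
    · rcases hmem d with rfl | rfl | ⟨e, rfl⟩
      · rw [hga, ← he0, hgf]
      · rw [hgb, ← he1, hgf, hg01]
      · by_cases h1 : D.opp (f e) = a
        · have : e = e0 := hinj (by rw [he0, ← h1, D.opp_opp])
          rw [h1, hga, hgf, this]
        by_cases h2 : D.opp (f e) = D.next a
        · have : e = e1 := hinj (by rw [he1, ← h2, D.opp_opp])
          rw [h2, hgb, hgf, this, hg01]
        rw [← ho1 e h1 h2, hgf, hgf, hg'.opp]
    · rcases hmem d with rfl | rfl | ⟨e, rfl⟩
      · rw [hga, hgb]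
      · rw [haa, hga, hgb]
      · rw [← hn, hgf, hgf, hg'.next _ (fun h => hd ((hc e).1 h))]
    · rcases hmem d with rfl | rfl | ⟨e, rfl⟩
      · exact absurd hd ha
      · exact absurd hd (fun h => ha ((isCrossing_next a).1 h))
      · have hce := (hc e).2 hd
        rw [← crossingRelation_map hgf (hn _) (by rw [hn, hn]) (by rw [hn, hn, hn]) (hs e hce)]
        exact hg'.crossing _ hce

/-- Both ends of the loop have one color, which forces all four colors at the crossing to agree.
Conversely the loop takes the color of the strand. -/
theorem Untwist.isColorable_iff (h : Untwist D E) : D.IsColorable m ↔ E.IsColorable m := by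
  obtain ⟨a, b, c, d, f, ha, rfl, rfl, rfl, hab, hinj, hrange, ho, hn1, hn2, hs, _⟩ := h
  have n1 := D.next_ne
  have n2 : D.next (D.next a) ≠ a := ha
  have n3 := next_three_ne a
  have n4 := D.next_four
  have n2' : D.next (D.next (D.next a)) ≠ D.next a := fun h => n2 (D.next.injective h)
  have nn : ∀ x y, D.next x = y → x = D.next (D.next (D.next y)) := fun x y h => by
    rw [← h, n4]
  obtain ⟨ec, hec⟩ := (hrange (D.next (D.next a))).2 ⟨n2, n1 _⟩
  obtain ⟨ed, hed⟩ := (hrange (D.next (D.next (D.next a)))).2 ⟨n3, n2'⟩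
  have hcn : E.next ec = ed := hinj (by
    rw [hn2 ec (by rw [hec]; exact (n1 _).symm), hec, hed])
  have hdn : E.next ed = ec := hinj (by rw [hn1 ed hed, hec])
  have hnc : ¬ E.IsCrossing ec := by simp [IsCrossing, hcn, hdn]
  have hnd : ¬ E.IsCrossing ed := by simp [IsCrossing, hcn, hdn]
  have hn3 : ∀ e, e ≠ ec → e ≠ ed → f (E.next e) = D.next (f e) ∧ E.next e ≠ ec ∧ E.next e ≠ ed := by
    intro e h1 h2
    refine ⟨hn2 e (fun h => h2 (hinj (by rw [h, hed]))), fun h => h2 ?_, fun h => h1 ?_⟩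
    · exact E.next.injective (by rw [h, hdn])
    · exact E.next.injective (by rw [h, hcn])
  have hc : ∀ e, e ≠ ec → e ≠ ed → (E.IsCrossing e ↔ D.IsCrossing (f e)) := by
    intro e h1 h2
    obtain ⟨k1, k2, k3⟩ := hn3 e h1 h2
    obtain ⟨k4, k5, k6⟩ := hn3 _ k2 k3
    simp only [IsCrossing, ← k1, ← k4, ne_eq, hinj.eq_iff]
  have hrel : ∀ (g : D.Dart → ZMod m) (g' : E.Dart → ZMod m), (∀ e, g (f e) = g' e) →
      ∀ e, E.IsCrossing e → e ≠ ec → e ≠ ed → (CrossingRelation E.next E.isOver g' e ↔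
        CrossingRelation D.next D.isOver g (f e)) := by
    intro g g' hgg e he h1 h2
    obtain ⟨k1, k2, k3⟩ := hn3 e h1 h2
    obtain ⟨k4, k5, k6⟩ := hn3 _ k2 k3
    obtain ⟨k7, _, _⟩ := hn3 _ k5 k6
    exact crossingRelation_map hgg k1 (by rw [k4, k1]) (by rw [k7, k4, k1]) (hs e he)
  constructor
  · rintro ⟨g, hg, x, y, hxy⟩
    have hcr := hg.crossing a ha
    have hgab : g (D.next a) = g a := by rw [← hab, hg.opp]
    have hgc : g (D.next (D.next a)) = g a ∧ g (D.next (D.next (D.next a))) = g a := by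
      cases hov : D.isOver a
      · obtain ⟨e1, e2⟩ := hcr.2 hov
        exact ⟨by linear_combination e2 + 2 * hgab, by rw [e1, hgab]⟩
      · obtain ⟨e1, e2⟩ := hcr.1 hov
        exact ⟨e1, by linear_combination e2 - hgab⟩
    refine ⟨fun e => g (f e), ⟨fun d => ?_, fun d hd => ?_, fun d hd => ?_⟩, ?_⟩
    · rw [ho, hg.opp]
    · by_cases h1 : d = ec
      · rw [h1, hcn, hec, hed, hgc.1, hgc.2]
      by_cases h2 : d = ed
      · rw [h2, hdn, hec, hed, hgc.1, hgc.2]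
      rw [(hn3 d h1 h2).1, hg.next _ (fun h => hd ((hc d h1 h2).2 h))]
    · have h1 : d ≠ ec := fun h => hnc (h ▸ hd)
      have h2 : d ≠ ed := fun h => hnd (h ▸ hd)
      rw [hrel g _ (fun _ => rfl) d hd h1 h2]
      exact hg.crossing _ ((hc d h1 h2).1 hd)
    · by_contra hcon
      push Not at hcon
      have key : ∀ x, ∃ e, g (f e) = g x := by
        intro x
        by_cases h1 : x = a
        · exact ⟨ec, by rw [hec, hgc.1, h1]⟩
        by_cases h2 : x = D.next a
        · exact ⟨ec, by rw [hec, hgc.1, h2, hgab]⟩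
        obtain ⟨e, he⟩ := (hrange x).2 ⟨h1, h2⟩
        exact ⟨e, by rw [he]⟩
      obtain ⟨e1, h1⟩ := key x
      obtain ⟨e2, h2⟩ := key y
      exact hxy (by rw [← h1, ← h2, hcon e1 e2])
  · rintro ⟨g', hg', x, y, hxy⟩
    have hmem : ∀ x, x = a ∨ x = D.next a ∨ ∃ e, f e = x := by
      intro x
      by_cases h1 : x = a
      · exact Or.inl h1
      by_cases h2 : x = D.next a
      · exact Or.inr (Or.inl h2)
      exact Or.inr (Or.inr ((hrange x).2 ⟨h1, h2⟩))
    let g := Function.extend f g' (fun _ => g' ec)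
    have hgf : ∀ e, g (f e) = g' e := fun e => hinj.extend_apply _ _ e
    have hga : g a = g' ec := Function.extend_apply' _ _ _ (fun h => ((hrange a).1 h).1 rfl)
    have hgb : g (D.next a) = g' ec :=
      Function.extend_apply' _ _ _ (fun h => ((hrange _).1 h).2 rfl)
    have hgd : g' ed = g' ec := by rw [← hcn]; exact hg'.next _ hnc
    have hrela : CrossingRelation D.next D.isOver g a := by
      rw [CrossingRelation, ← hec, ← hed.trans (by rw [hec] : _ = D.next (f ec)), hed,
        ← hed, hgf, hgf, hga, hgb, hgd]
      constructor
      · intro _; exact ⟨rfl, by ring⟩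
      · intro _; exact ⟨rfl, by ring⟩
    refine ⟨g, ⟨fun d => ?_, fun d hd => ?_, fun d hd => ?_⟩, f x, f y, by rwa [hgf, hgf]⟩
    · rcases hmem d with rfl | rfl | ⟨e, rfl⟩
      · rw [hab, hga, hgb]
      · rw [← hab, D.opp_opp, hga, hab, hgb]
      · rw [← ho, hgf, hgf, hg'.opp]
    · rcases hmem d with rfl | rfl | ⟨e, rfl⟩
      · rw [hga, hgb]
      · exact absurd ((isCrossing_next a).2 ha) hd
      · have h1 : e ≠ ec := by
          rintro rfl; rw [hec, isCrossing_next, isCrossing_next] at hd; exact hd ha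
        have h2 : e ≠ ed := by
          rintro rfl; rw [hed, isCrossing_next, isCrossing_next, isCrossing_next] at hd; exact hd ha
        rw [← (hn3 e h1 h2).1, hgf, hgf, hg'.next _ (fun h => hd ((hc e h1 h2).1 h))]
    · rcases hmem d with rfl | rfl | ⟨e, rfl⟩
      · exact hrela
      · exact crossing_rotate ha hrela (by simp)
      · by_cases h1 : e = ec
        · rw [h1, hec]; exact crossing_rotate ha hrela (by simp)
        by_cases h2 : e = ed
        · rw [h2, hed]; exact crossing_rotate ha hrela (by simp)
        have hce := (hc e h1 h2).2 hd
        rw [← hrel g g' hgf e hce h1 h2]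
        exact hg'.crossing _ hce

end KnotDiagram

end Colorings

/-! ### Invariance of Fox colorings under pokes. -/

namespace KnotDiagram

variable {D E : KnotDiagram} {m : ℕ}

theorem vert_next (d : D.Dart) : D.vert (D.next d) = D.vert d :=
  Quotient.sound (show D.next.SameCycle (D.next d) d from
    (Equiv.Perm.sameCycle_apply_left).2 (Equiv.Perm.SameCycle.refl _ _))

theorem vert_eq_iff {d d' : D.Dart} : D.vert d = D.vert d' ↔
    d' = d ∨ d' = D.next d ∨ d' = D.next (D.next d) ∨ d' = D.next (D.next (D.next d)) := by
  rw [← sameCycle_iff_of_four D.next_four]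
  exact Quotient.eq (r := Equiv.Perm.SameCycle.setoid D.next)

/-- The lower strand is reflected twice in the color of the upper one, so each strand has the same
color before and after the bigon. Conversely the colors of the two inner edges are determined by the
outer ones. -/
theorem Unpoke.isColorable_iff (h : Unpoke D E) : D.IsColorable m ↔ E.IsColorable m := by
  classical
  obtain ⟨a, b, p, q, a', b', p', q', f, ha, hb, hp, hq, hb', ha', hq', hp', hv, hoa, hob, hov,
    hinj, hrange, ho, hnp, hnp', hnq, hnq', hn, hs, _⟩ := h
  have n1 := D.next_ne
  have n4 := D.next_four
  have va : D.vert b = D.vert a ∧ D.vert p = D.vert a ∧ D.vert q = D.vert a := by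
    simp only [hq, hp, hb, vert_next, and_self]
  have va' : D.vert b' = D.vert a' ∧ D.vert p' = D.vert a' ∧ D.vert q' = D.vert a' := by
    simp only [hp', hq', ha', vert_next, and_self]
  have hqa : D.next q = a := by rw [hq, hp, hb, n4]
  have hpb' : D.next p' = b' := by rw [hp', hq', ha', n4]
  have hca' : D.IsCrossing a' := by rw [ha']; exact (isCrossing_next _).2 hb'
  have d1 : a ≠ b ∧ a ≠ p ∧ a ≠ q ∧ b ≠ p ∧ b ≠ q ∧ p ≠ q := by
    have := next_three_ne a
    have h2 : D.next (D.next a) ≠ a := ha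
    subst hb hp hq
    exact ⟨(n1 _).symm, h2.symm, this.symm, (n1 _).symm,
      fun h => h2 (D.next.injective h.symm), (n1 _).symm⟩
  have d2 : b' ≠ a' ∧ b' ≠ q' ∧ b' ≠ p' ∧ a' ≠ q' ∧ a' ≠ p' ∧ q' ≠ p' := by
    have := next_three_ne b'
    have h2 : D.next (D.next b') ≠ b' := hb'
    subst ha' hq' hp'
    exact ⟨(n1 _).symm, h2.symm, this.symm, (n1 _).symm,
      fun h => h2 (D.next.injective h.symm), (n1 _).symm⟩
  have dv : ∀ x y, D.vert x = D.vert a → D.vert y = D.vert a' → x ≠ y := by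
    rintro x y h1 h2 rfl
    exact hv (h1.symm.trans h2)
  obtain ⟨ep, hep⟩ := (hrange p).2 ⟨d1.2.1.symm, d1.2.2.2.1.symm, dv _ _ va.2.1 rfl,
    dv _ _ va.2.1 va'.1⟩
  obtain ⟨eq, heq⟩ := (hrange q).2 ⟨d1.2.2.1.symm, d1.2.2.2.2.1.symm, dv _ _ va.2.2 rfl,
    dv _ _ va.2.2 va'.1⟩
  obtain ⟨ep', hep'⟩ := (hrange p').2 ⟨(dv _ _ rfl va'.2.1).symm, (dv _ _ va.1 va'.2.1).symm,
    d2.2.2.2.2.1.symm, d2.2.2.1.symm⟩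
  obtain ⟨eq', heq'⟩ := (hrange q').2 ⟨(dv _ _ rfl va'.2.2).symm, (dv _ _ va.1 va'.2.2).symm,
    d2.2.2.2.1.symm, d2.2.1.symm⟩
  have kp : E.next ep = ep' := hinj (by rw [hnp _ hep, hep'])
  have kp' : E.next ep' = ep := hinj (by rw [hnp' _ hep', hep])
  have kq : E.next eq = eq' := hinj (by rw [hnq _ heq, heq'])
  have kq' : E.next eq' = eq := hinj (by rw [hnq' _ heq', heq])
  have hspec : ∀ e, (e = ep ∨ e = ep' ∨ e = eq ∨ e = eq') → ¬ E.IsCrossing e := by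
    rintro e (rfl | rfl | rfl | rfl) <;> simp [IsCrossing, kp, kp', kq, kq']
  have hn3 : ∀ e, ¬ (e = ep ∨ e = ep' ∨ e = eq ∨ e = eq') →
      f (E.next e) = D.next (f e) ∧
        ¬ (E.next e = ep ∨ E.next e = ep' ∨ E.next e = eq ∨ E.next e = eq') := by
    intro e h
    push Not at h
    obtain ⟨h1, h2, h3, h4⟩ := h
    refine ⟨hn e (fun h => h1 (hinj (by rw [h, hep]))) (fun h => h2 (hinj (by rw [h, hep'])))
      (fun h => h3 (hinj (by rw [h, heq]))) (fun h => h4 (hinj (by rw [h, heq']))), ?_⟩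
    rintro (h | h | h | h)
    · exact h2 (E.next.injective (by rw [h, kp']))
    · exact h1 (E.next.injective (by rw [h, kp]))
    · exact h4 (E.next.injective (by rw [h, kq']))
    · exact h3 (E.next.injective (by rw [h, kq]))
  have hc : ∀ e, ¬ (e = ep ∨ e = ep' ∨ e = eq ∨ e = eq') →
      (E.IsCrossing e ↔ D.IsCrossing (f e)) := by
    intro e h1
    obtain ⟨k1, k2⟩ := hn3 e h1
    obtain ⟨k4, k5⟩ := hn3 _ k2
    simp only [IsCrossing, ← k1, ← k4, ne_eq, hinj.eq_iff]
  have hrel : ∀ (g : D.Dart → ZMod m) (g' : E.Dart → ZMod m), (∀ e, g (f e) = g' e) →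
      ∀ e, E.IsCrossing e → ¬ (e = ep ∨ e = ep' ∨ e = eq ∨ e = eq') →
      (CrossingRelation E.next E.isOver g' e ↔ CrossingRelation D.next D.isOver g (f e)) := by
    intro g g' hgg e he h1
    obtain ⟨k1, k2⟩ := hn3 e h1
    obtain ⟨k4, k5⟩ := hn3 _ k2
    obtain ⟨k7, _⟩ := hn3 _ k5
    exact crossingRelation_map hgg k1 (by rw [k4, k1]) (by rw [k7, k4, k1]) (hs e he)
  have hmem : ∀ x, x = a ∨ x = b ∨ x = a' ∨ x = b' ∨ ∃ e, f e = x := by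
    intro x
    by_cases h1 : x = a
    · exact Or.inl h1
    by_cases h2 : x = b
    · exact Or.inr (Or.inl h2)
    by_cases h3 : x = a'
    · exact Or.inr (Or.inr (Or.inl h3))
    by_cases h4 : x = b'
    · exact Or.inr (Or.inr (Or.inr (Or.inl h4)))
    exact Or.inr (Or.inr (Or.inr (Or.inr ((hrange x).2 ⟨h1, h2, h3, h4⟩))))
  have rela : ∀ g : D.Dart → ZMod m, CrossingRelation D.next D.isOver g a ↔
      (D.isOver a = true → g p = g a ∧ g b + g q = 2 * g a) ∧
      (D.isOver a = false → g q = g b ∧ g a + g p = 2 * g b) := by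
    intro g; rw [CrossingRelation, ← hb, ← hp, ← hq]
  have rela' : ∀ g : D.Dart → ZMod m, CrossingRelation D.next D.isOver g a' ↔
      (D.isOver a = true → g p' = g a' ∧ g q' + g b' = 2 * g a') ∧
      (D.isOver a = false → g b' = g q' ∧ g a' + g p' = 2 * g q') := by
    intro g; rw [CrossingRelation, ← hq', ← hp', hpb', hov]
  constructor
  · rintro ⟨g, hg, x, y, hxy⟩
    have r1 := (rela g).1 (hg.crossing a ha)
    have r2 := (rela' g).1 (hg.crossing a' hca')
    have ga' : g a' = g a := by rw [← hoa, hg.opp]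
    have gb' : g b' = g b := by rw [← hob, hg.opp]
    have gpq : g p = g p' ∧ g q = g q' := by
      cases hh : D.isOver a
      · obtain ⟨e1, e2⟩ := r1.2 hh
        obtain ⟨e3, e4⟩ := r2.2 hh
        have : g q' = g b := by rw [← e3, gb']
        exact ⟨by linear_combination e2 - e4 + ga' - 2 * this, by rw [e1, this]⟩
      · obtain ⟨e1, e2⟩ := r1.1 hh
        obtain ⟨e3, e4⟩ := r2.1 hh
        exact ⟨by rw [e1, e3, ga'], by linear_combination e2 - e4 - 2 * ga' + gb'⟩
    refine ⟨fun e => g (f e), ⟨fun d => ?_, fun d hd => ?_, fun d hd => ?_⟩, ?_⟩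
    · rw [ho, hg.opp]
    · by_cases h1 : d = ep ∨ d = ep' ∨ d = eq ∨ d = eq'
      · rcases h1 with rfl | rfl | rfl | rfl
        · rw [kp, hep, hep', gpq.1]
        · rw [kp', hep, hep', gpq.1]
        · rw [kq, heq, heq', gpq.2]
        · rw [kq', heq, heq', gpq.2]
      · rw [(hn3 d h1).1, hg.next _ (fun h => hd ((hc d h1).2 h))]
    · have h1 := fun h => hspec d h hd
      rw [hrel g _ (fun _ => rfl) d hd h1]
      exact hg.crossing _ ((hc d h1).1 hd)
    · by_contra hcon
      push Not at hcon
      have hab : g a = g p ∧ g b = g p := by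
        have := hcon ep eq
        rw [hep, heq] at this
        cases hh : D.isOver a
        · obtain ⟨e1, e2⟩ := r1.2 hh
          exact ⟨by linear_combination e2 - 2 * e1 - 2 * this, by rw [← e1, this]⟩
        · obtain ⟨e1, e2⟩ := r1.1 hh
          exact ⟨e1.symm, by linear_combination e2 - 2 * e1 + this⟩
      have key : ∀ x, ∃ e, g (f e) = g x := by
        intro x
        rcases hmem x with rfl | rfl | rfl | rfl | ⟨e, rfl⟩
        · exact ⟨ep, by rw [hep, hab.1]⟩
        · exact ⟨ep, by rw [hep, hab.2]⟩
        · exact ⟨ep, by rw [hep, ga', hab.1]⟩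
        · exact ⟨ep, by rw [hep, gb', hab.2]⟩
        · exact ⟨e, rfl⟩
      obtain ⟨e1, h1⟩ := key x
      obtain ⟨e2, h2⟩ := key y
      exact hxy (by rw [← h1, ← h2, hcon e1 e2])
  · rintro ⟨g', hg', x, y, hxy⟩
    -- `A` and `B` color the edges of `a` and `b`: the upper edge keeps the color of its strand, the
    -- lower one gets the reflected color.
    obtain ⟨A, B, hAB1, hAB2⟩ : ∃ A B : ZMod m,
        (D.isOver a = true → g' ep = A ∧ B + g' eq = 2 * A) ∧
        (D.isOver a = false → g' eq = B ∧ A + g' ep = 2 * B) := by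
      cases D.isOver a
      · exact ⟨2 * g' eq - g' ep, g' eq, by simp, by simp⟩
      · exact ⟨g' ep, 2 * g' ep - g' eq, by simp, by simp⟩
    let g := Function.extend f g' (fun x => if x = a ∨ x = a' then A else B)
    have hgf : ∀ e, g (f e) = g' e := fun e => hinj.extend_apply _ _ e
    have hgx : ∀ x, (¬ ∃ e, f e = x) → g x = if x = a ∨ x = a' then A else B := fun x hx =>
      Function.extend_apply' _ _ _ hx
    have hga : g a = A := by
      rw [hgx _ (fun h => ((hrange a).1 h).1 rfl)]
      simp
    have hga' : g a' = A := by
      rw [hgx _ (fun h => ((hrange a').1 h).2.2.1 rfl)]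
      simp
    have hgb : g b = B := by
      rw [hgx _ (fun h => ((hrange b).1 h).2.1 rfl)]
      simp [d1.1.symm, dv b a' va.1 rfl]
    have hgb' : g b' = B := by
      rw [hgx _ (fun h => ((hrange b').1 h).2.2.2 rfl)]
      simp [d2.1, (dv a b' rfl va'.1).symm]
    have hgp : g p = g' ep := by rw [← hep, hgf]
    have hgq : g q = g' eq := by rw [← heq, hgf]
    have hgp' : g p' = g' ep := by
      rw [← hep', hgf, ← kp, hg'.next _ (hspec _ (by simp))]
    have hgq' : g q' = g' eq := by
      rw [← heq', hgf, ← kq, hg'.next _ (hspec _ (by simp))]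
    have ra : CrossingRelation D.next D.isOver g a := by
      rw [rela, hgp, hgq, hga, hgb]
      exact ⟨hAB1, hAB2⟩
    have ra' : CrossingRelation D.next D.isOver g a' := by
      rw [rela', hgp', hgq', hga', hgb', add_comm (g' eq)]
      exact ⟨hAB1, fun h => by rw [(hAB2 h).1]; exact ⟨rfl, (hAB2 h).2⟩⟩
    have hoa' : D.opp a' = a := by rw [← hoa, D.opp_opp]
    have hob' : D.opp b' = b := by rw [← hob, D.opp_opp]
    have hcr : ∀ x, (D.vert a = D.vert x ∨ D.vert a' = D.vert x) →
        CrossingRelation D.next D.isOver g x ∧ D.IsCrossing x := by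
      rintro x (h | h)
      · rw [vert_eq_iff] at h
        refine ⟨crossing_rotate ha ra h, ?_⟩
        rcases h with rfl | rfl | rfl | rfl <;> simpa [isCrossing_next] using ha
      · rw [vert_eq_iff] at h
        refine ⟨crossing_rotate hca' ra' h, ?_⟩
        rcases h with rfl | rfl | rfl | rfl <;> simpa [isCrossing_next] using hca'
    have hmem' : ∀ x, (D.vert a = D.vert x ∨ D.vert a' = D.vert x) ∨
        ∃ e, f e = x ∧ ¬ (e = ep ∨ e = ep' ∨ e = eq ∨ e = eq') := by
      intro x
      rcases hmem x with rfl | rfl | rfl | rfl | ⟨e, rfl⟩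
      · simp
      · simp [va]
      · simp
      · simp [va']
      · by_cases h : e = ep ∨ e = ep' ∨ e = eq ∨ e = eq'
        · rcases h with rfl | rfl | rfl | rfl <;> simp [hep, hep', heq, heq', va, va']
        · exact Or.inr ⟨e, rfl, h⟩
    refine ⟨g, ⟨fun d => ?_, fun d hd => ?_, fun d hd => ?_⟩, f x, f y, by rwa [hgf, hgf]⟩
    · rcases hmem d with h | h | h | h | ⟨e, h⟩
      · rw [h, hoa, hga, hga']
      · rw [h, hob, hgb, hgb']
      · rw [h, hoa', hga, hga']
      · rw [h, hob', hgb, hgb']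
      · rw [← h, ← ho, hgf, hgf, hg'.opp]
    · rcases hmem' d with h | ⟨e, rfl, h⟩
      · exact absurd (hcr d h).2 hd
      · rw [← (hn3 e h).1, hgf, hgf, hg'.next _ (fun h' => hd ((hc e h).1 h'))]
    · rcases hmem' d with h | ⟨e, rfl, h⟩
      · exact (hcr d h).1
      · have hce := (hc e h).2 hd
        rw [← hrel g g' hgf e hce h]
        exact hg'.crossing _ hce

end KnotDiagram

/-! ### Invariance of Fox colorings under slides. -/

namespace KnotDiagram

variable {D E : KnotDiagram} {m : ℕ}

/-- A Fox coloring of the diagram that has the vertices of `D` and the edges given by `o`. -/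
def IsColoringFor (D : KnotDiagram) (o : D.Dart → D.Dart) {R : Type*} [CommRing R]
    (g : D.Dart → R) : Prop :=
  (∀ d, g (o d) = g d) ∧ (∀ d, ¬ D.IsCrossing d → g (D.next d) = g d) ∧
    (∀ d, D.IsCrossing d → CrossingRelation D.next D.isOver g d)

theorem isOver_next_next {d : D.Dart} (h : D.IsCrossing d) :
    D.isOver (D.next (D.next d)) = D.isOver d := by
  rw [D.isOver_next _ ((isCrossing_next d).2 h), D.isOver_next _ h, Bool.not_not]

/-- The edges entering the triangle keep their colors, moved by `t`; only the three inner edges are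
recolored. The pairing `o` is arbitrary so that the lemma also applies to the reverse slide, and the
last clause transports nonconstancy. -/
theorem exists_isColoringFor_slide {R : Type*} [CommRing R] {o : D.Dart → D.Dart}
    (oo : ∀ x, o (o x) = x) {a b c d : Fin 3 → D.Dart} {t : Equiv.Perm D.Dart}
    (ha : ∀ i, D.IsCrossing (a i))
    (hb : ∀ i, b i = D.next (a i)) (hc : ∀ i, c i = D.next (b i)) (hd : ∀ i, d i = D.next (c i))
    (hv : ∀ i j, i ≠ j → D.vert (a i) ≠ D.vert (a j))
    (ho : ∀ i, o (a i) = b (i + 1))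
    (h0 : D.isOver (a 0) = true) (h1 : D.isOver (b 1) = true)
    (ht : ∀ i, t (c i) = b (i + 1) ∧ t (b (i + 1)) = c i ∧
      t (a i) = d (i + 1) ∧ t (d (i + 1)) = a i)
    (ht' : ∀ x, (∀ i, x ≠ a i ∧ x ≠ b i ∧ x ≠ c i ∧ x ≠ d i) → t x = x)
    {g : D.Dart → R} (hg : D.IsColoringFor o g) :
    ∃ g' : D.Dart → R, D.IsColoringFor (fun x => t (o (t x))) g' ∧
      ∀ K, (∀ x, g' x = K) → ∀ x, g x = K := by
  obtain ⟨hgo, hgn, hgc⟩ := hg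
  have i3 : ∀ i : Fin 3, i + 2 + 1 = i := by decide
  have vb : ∀ i, D.vert (b i) = D.vert (a i) := fun i => by rw [hb, vert_next]
  have vc : ∀ i, D.vert (c i) = D.vert (a i) := fun i => by rw [hc, vert_next, vb]
  have vd : ∀ i, D.vert (d i) = D.vert (a i) := fun i => by rw [hd, vert_next, vc]
  have sep : ∀ {i j x y}, D.vert x = D.vert (a i) → D.vert y = D.vert (a j) → x = y → i = j := by
    rintro i j x y h h' rfl
    by_contra hne
    exact hv i j hne (h.symm.trans h')
  have hne : ∀ i, a i ≠ c i ∧ a i ≠ d i ∧ b i ≠ c i ∧ b i ≠ d i ∧ c i ≠ d i := by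
    intro i
    have h2 : D.next (D.next (a i)) ≠ a i := ha i
    have n1 := D.next_ne
    have n3 := next_three_ne (a i)
    rw [hd, hc, hb]
    exact ⟨h2.symm, n3.symm, (n1 _).symm, fun h => h2 (D.next.injective h.symm), (n1 _).symm⟩
  have nac : ∀ i j, a i ≠ c j := fun i j h => by
    obtain rfl := sep rfl (vc j) h; exact (hne i).1 h
  have nad : ∀ i j, a i ≠ d j := fun i j h => by
    obtain rfl := sep rfl (vd j) h; exact (hne i).2.1 h
  have nbc : ∀ i j, b i ≠ c j := fun i j h => by
    obtain rfl := sep (vb i) (vc j) h; exact (hne i).2.2.1 h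
  have nbd : ∀ i j, b i ≠ d j := fun i j h => by
    obtain rfl := sep (vb i) (vd j) h; exact (hne i).2.2.2.1 h
  have ncd : ∀ i j, c i ≠ d j := fun i j h => by
    obtain rfl := sep (vc i) (vd j) h; exact (hne i).2.2.2.2 h
  have tt : ∀ x, t (t x) = x := by
    intro x
    by_cases h : ∀ i, x ≠ a i ∧ x ≠ b i ∧ x ≠ c i ∧ x ≠ d i
    · rw [ht' x h, ht' x h]
    · push Not at h
      obtain ⟨i, hi⟩ := h
      by_cases k1 : x = a i
      · rw [k1, (ht i).2.2.1, (ht i).2.2.2]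
      by_cases k2 : x = b i
      · have := ht (i + 2)
        rw [i3 i] at this
        rw [k2, this.2.1, this.1]
      by_cases k3 : x = c i
      · rw [k3, (ht i).1, (ht i).2.1]
      have := ht (i + 2)
      rw [i3 i] at this
      rw [hi k1 k2 k3, this.2.2.2, this.2.2.1]
  let δ : Fin 3 × Bool → D.Dart := fun p => if p.2 then d (p.1 + 1) else c p.1
  have hδ : Function.Injective δ := by
    rintro ⟨i, x⟩ ⟨j, y⟩ h
    cases x <;> cases y
    · have h : c i = c j := h
      rw [sep (vc i) (vc j) h]
    · exact absurd h (ncd _ _)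
    · exact absurd h.symm (ncd _ _)
    · have h : d (i + 1) = d (j + 1) := h
      rw [add_right_cancel (sep (vd _) (vd _) h)]
  -- After the slide the inner edge `i` joins `c i` to `d (i + 1)`. Edge 0 is on the top strand. The
  -- two others pass under it, so their colors are reflections, in the color of the top strand, of
  -- the colors that arrive at `a 1` and `b 0`.
  let ζ : Fin 3 → R := ![g (a 0), 2 * g (a 0) - g (d 2), 2 * g (a 0) - g (c 2)]
  let g' : D.Dart → R := Function.extend δ (fun p => ζ p.1) (fun x => g (t x))
  have gc : ∀ i, g' (c i) = ζ i := fun i => hδ.extend_apply _ _ (i, false)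
  have gd : ∀ i, g' (d (i + 1)) = ζ i := fun i => hδ.extend_apply _ _ (i, true)
  have gx : ∀ x, (∀ i, x ≠ c i ∧ x ≠ d i) → g' x = g (t x) := by
    intro x hx
    refine Function.extend_apply' _ _ _ ?_
    rintro ⟨⟨i, y⟩, h⟩
    cases y
    · exact (hx i).1 h.symm
    · exact (hx (i + 1)).2 h.symm
  have ga : ∀ i, g' (a i) = g (d (i + 1)) := fun i => by
    rw [gx _ fun j => ⟨nac i j, nad i j⟩, (ht i).2.2.1]
  have gb : ∀ i, g' (b (i + 1)) = g (c i) := fun i => by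
    rw [gx _ fun j => ⟨nbc _ j, nbd _ j⟩, (ht i).2.1]
  have hob : ∀ i, o (b (i + 1)) = a i := fun i => by rw [← ho, oo]
  have gt : ∀ y, (∀ i, y ≠ a i ∧ y ≠ b i) → g' (t y) = g y := by
    intro y hy
    rw [gx, tt]
    refine fun i => ⟨fun h => (hy (i + 1)).2 ?_, fun h => (hy (i + 2)).1 ?_⟩
    · rw [← tt y, h, (ht i).1]
    · have := ht (i + 2)
      rw [i3 i] at this
      rw [← tt y, h, this.2.2.2]
  have hgab : ∀ i, g (b (i + 1)) = g (a i) := fun i => by rw [← ho, hgo]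
  have eqs : ∀ i, (D.isOver (a i) = true → g (c i) = g (a i) ∧ g (b i) + g (d i) = 2 * g (a i)) ∧
      (D.isOver (a i) = false → g (d i) = g (b i) ∧ g (a i) + g (c i) = 2 * g (b i)) := by
    intro i
    rw [hd, hc, hb]
    exact hgc _ (ha i)
  have h1' : D.isOver (a 1) = false := by
    have := D.isOver_next (a 1) (ha 1)
    rw [← hb, h1] at this
    simpa using this.symm
  have r0 := (eqs 0).1 h0
  have r1 := (eqs 1).2 h1'
  have e0 : g (b 1) = g (a 0) := hgab 0
  have e1 : g (b 2) = g (a 1) := hgab 1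
  have e2 : g (b 0) = g (a 2) := hgab 2
  have rel' : ∀ i, CrossingRelation D.next D.isOver g' (a i) := by
    suffices ∀ i, (D.isOver (a i) = true → g' (c i) = g' (a i) ∧ g' (b i) + g' (d i) = 2 * g' (a i)) ∧
      (D.isOver (a i) = false → g' (d i) = g' (b i) ∧ g' (a i) + g' (c i) = 2 * g' (b i)) by
      intro i
      have := this i
      rwa [hd, hc, hb] at this
    have a0 : g' (a 0) = g (d 1) := ga 0
    have a1 : g' (a 1) = g (d 2) := ga 1
    have a2 : g' (a 2) = g (d 0) := ga 2
    have b0 : g' (b 0) = g (c 2) := gb 2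
    have b1 : g' (b 1) = g (c 0) := gb 0
    have b2 : g' (b 2) = g (c 1) := gb 1
    have c0 : g' (c 0) = g (a 0) := gc 0
    have c1 : g' (c 1) = 2 * g (a 0) - g (d 2) := gc 1
    have c2 : g' (c 2) = 2 * g (a 0) - g (c 2) := gc 2
    have d0 : g' (d 0) = 2 * g (a 0) - g (c 2) := gd 2
    have d1 : g' (d 1) = g (a 0) := gd 0
    have d2 : g' (d 2) = 2 * g (a 0) - g (d 2) := gd 1
    have q1 : g (d 1) = g (a 0) := r1.1.trans e0
    intro i
    fin_cases i
    · refine ⟨fun _ => ?_, fun h => ?_⟩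
      · change g' (c 0) = g' (a 0) ∧ g' (b 0) + g' (d 0) = 2 * g' (a 0)
        rw [c0, a0, b0, d0, q1]
        exact ⟨rfl, by ring⟩
      · exact absurd (h0.symm.trans h) (by simp)
    · refine ⟨fun h => ?_, fun _ => ?_⟩
      · exact absurd (h1'.symm.trans h) (by simp)
      · change g' (d 1) = g' (b 1) ∧ g' (a 1) + g' (c 1) = 2 * g' (b 1)
        rw [d1, b1, a1, c1, r0.1]
        exact ⟨rfl, by ring⟩
    -- At the crossing 2 of the two lower strands either one may be over, and both cases have to be
    -- checked.
    · refine ⟨fun h => ?_, fun h => ?_⟩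
      · have r2 := (eqs 2).1 h
        change g' (c 2) = g' (a 2) ∧ g' (b 2) + g' (d 2) = 2 * g' (a 2)
        rw [c2, a2, b2, d2]
        exact ⟨by linear_combination e2 - r0.2 - r2.1,
          by linear_combination r1.2 - r2.2 - 2 * r0.2 + e1 + 2 * e2 + 2 * e0⟩
      · have r2 := (eqs 2).2 h
        change g' (d 2) = g' (b 2) ∧ g' (a 2) + g' (c 2) = 2 * g' (b 2)
        rw [c2, a2, b2, d2]
        exact ⟨by linear_combination -r1.2 - r2.1 - e1 - 2 * e0,
          by linear_combination r0.2 - r2.2 - e2 - 2 * r1.2 - 2 * e1 - 4 * e0⟩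
  have hcr : ∀ x i, D.vert (a i) = D.vert x → CrossingRelation D.next D.isOver g' x ∧
      D.IsCrossing x := by
    intro x i h
    rw [vert_eq_iff] at h
    refine ⟨crossing_rotate (ha i) (rel' i) h, ?_⟩
    rcases h with rfl | rfl | rfl | rfl <;> simpa [isCrossing_next] using ha i
  have hmem : ∀ x, (∃ i, D.vert (a i) = D.vert x) ∨
      ∀ y, D.vert x = D.vert y → g' y = g y := by
    intro x
    by_cases h : ∃ i, D.vert (a i) = D.vert x
    · exact Or.inl h
    refine Or.inr fun y hy => ?_
    have : ∀ i, y ≠ a i ∧ y ≠ b i ∧ y ≠ c i ∧ y ≠ d i := by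
      intro i
      refine ⟨?_, ?_, ?_, ?_⟩ <;> rintro rfl <;> refine h ⟨i, ?_⟩
      · exact hy.symm
      · rw [hy, vb]
      · rw [hy, vc]
      · rw [hy, vd]
    rw [gx y (fun i => (this i).2.2), ht' y this]
  refine ⟨g', ⟨fun x => ?_, fun x hx => ?_, fun x hx => ?_⟩, ?_⟩
  · change g' (t (o (t x))) = g' x
    by_cases h : ∃ i, x = c i ∨ x = d (i + 1)
    · obtain ⟨i, rfl | rfl⟩ := h
      · rw [(ht i).1, hob, (ht i).2.2.1, gd, gc]
      · rw [(ht i).2.2.2, ho, (ht i).2.1, gd, gc]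
    · push Not at h
      have hx : ∀ i, x ≠ c i ∧ x ≠ d i := fun i => ⟨(h i).1, by
        have := (h (i + 2)).2
        rwa [i3 i] at this⟩
      rw [gx x hx, gt, hgo]
      intro i
      refine ⟨fun hi => (h i).1 ?_, fun hi => (h (i + 2)).2 ?_⟩
      · rw [← tt x, ← oo (t x), hi, ho, (ht i).2.1]
      · have h2 := hob (i + 2)
        rw [i3 i] at h2
        rw [← tt x, ← oo (t x), hi, h2, (ht _).2.2.1]
  · rcases hmem x with ⟨i, h⟩ | h
    · exact absurd (hcr x i h).2 hx
    · rw [h _ rfl, h _ (vert_next x).symm, hgn x hx]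
  · rcases hmem x with ⟨i, h⟩ | h
    · exact (hcr x i h).1
    · have k1 := h _ rfl
      have k2 := h _ (vert_next x).symm
      have k3 := h (D.next (D.next x)) (by simp [vert_next])
      have k4 := h (D.next (D.next (D.next x))) (by simp [vert_next])
      have := hgc x hx
      rw [CrossingRelation] at this ⊢
      rwa [k1, k2, k3, k4]
  · intro K hK
    have kc : ∀ i, g (c i) = K := fun i => by rw [← gb, hK]
    have kd : ∀ i, g (d (i + 1)) = K := fun i => by rw [← ga, hK]
    have ka : ∀ i, g (a i) = K := by
      have k0 : g (a 0) = K := by rw [← r0.1, kc]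
      intro i
      fin_cases i
      · exact k0
      · change g (a 1) = K
        linear_combination r1.2 - kc 1 + 2 * e0 + 2 * k0
      · change g (a 2) = K
        have := kd 2
        change g (d 0) = K at this
        linear_combination r0.2 - this - e2 + 2 * k0
    intro x
    by_cases h : ∀ i, x ≠ a i ∧ x ≠ b i
    · rw [← gt x h, hK]
    · push Not at h
      obtain ⟨i, hi⟩ := h
      by_cases k1 : x = a i
      · rw [k1, ka]
      · have h2 := hgab (i + 2)
        rw [i3 i] at h2
        rw [hi k1, h2, ka]

end KnotDiagram

namespace KnotDiagram

variable {D E : KnotDiagram} {m : ℕ}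

theorem isColorable_iff_isColoringFor : D.IsColorable m ↔
    ∃ g : D.Dart → ZMod m, D.IsColoringFor D.opp g ∧ ∃ d d', g d ≠ g d' :=
  ⟨fun ⟨g, hg, h⟩ => ⟨g, ⟨hg.opp, hg.next, hg.crossing⟩, h⟩,
    fun ⟨g, ⟨h1, h2, h3⟩, h⟩ => ⟨g, ⟨h1, h2, h3⟩, h⟩⟩

theorem Slide.isColorable_iff (h : Slide D E) : D.IsColorable m ↔ E.IsColorable m := by
  obtain ⟨a, b, c, d, t, f, ha, hb, hc, hd, hv, hab, h0, h1, ht, ht', hn, ho, hs, -, -⟩ := h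
  have tt : ∀ x, t (t x) = x := by
    have i3 : ∀ i : Fin 3, i + 2 + 1 = i := by decide
    intro x
    by_cases h : ∀ i, x ≠ a i ∧ x ≠ b i ∧ x ≠ c i ∧ x ≠ d i
    · rw [ht' x h, ht' x h]
    · push Not at h
      obtain ⟨i, hi⟩ := h
      have h2 := ht (i + 2)
      rw [i3 i] at h2
      by_cases k1 : x = a i
      · rw [k1, (ht i).2.2.1, (ht i).2.2.2]
      by_cases k2 : x = b i
      · rw [k2, h2.2.1, h2.1]
      by_cases k3 : x = c i
      · rw [k3, (ht i).1, (ht i).2.1]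
      rw [hi k1 k2 k3, h2.2.2.2, h2.2.2.1]
  have hcr : ∀ e, E.IsCrossing e ↔ D.IsCrossing (f e) := by
    intro e
    simp only [IsCrossing, ← hn, ne_eq, f.injective.eq_iff]
  have hE : ∀ g : D.Dart → ZMod m, D.IsColoringFor (fun x => t (D.opp (t x))) g ↔
      E.IsColoringFor E.opp (fun e => g (f e)) := by
    intro g
    simp only [IsColoringFor, ho, hn]
    refine and_congr f.surjective.forall (and_congr ?_ ?_)
    · rw [f.surjective.forall]
      exact forall_congr' fun e => by rw [hcr]
    · rw [f.surjective.forall]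
      refine forall_congr' fun e => ?_
      rw [← hcr]
      refine imp_congr_right fun he => ?_
      rw [crossingRelation_map (fun _ => rfl) (hn e) (by rw [hn, hn]) (by rw [hn, hn, hn]) (hs e he)]
  have hE' : E.IsColorable m ↔ ∃ g : D.Dart → ZMod m,
      D.IsColoringFor (fun x => t (D.opp (t x))) g ∧ ∃ d d', g d ≠ g d' := by
    rw [isColorable_iff_isColoringFor]
    constructor
    · rintro ⟨g, hg, x, y, hxy⟩
      refine ⟨fun x => g (f.symm x), ?_, f x, f y, by simpa using hxy⟩
      rw [hE]
      simpa using hg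
    · rintro ⟨g, hg, x, y, hxy⟩
      exact ⟨fun e => g (f e), (hE g).1 hg, f.symm x, f.symm y, by simpa using hxy⟩
  rw [hE', isColorable_iff_isColoringFor]
  have nonconst : ∀ g g' : D.Dart → ZMod m, (∀ K, (∀ x, g' x = K) → ∀ x, g x = K) →
      (∃ d d', g d ≠ g d') → ∃ d d', g' d ≠ g' d' := by
    rintro g g' h ⟨x, y, hxy⟩
    by_contra hcon
    push Not at hcon
    have := h (g' x) (fun y => hcon y x)
    exact hxy (by rw [this, this])
  have ht2 : ∀ x, (∀ i, x ≠ c i ∧ x ≠ d i ∧ x ≠ a i ∧ x ≠ b i) → t x = x := fun x hx =>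
    ht' x fun i => ⟨(hx i).2.2.1, (hx i).2.2.2, (hx i).1, (hx i).2.1⟩
  constructor
  · rintro ⟨g, hg, hne⟩
    obtain ⟨g', hg', hK⟩ := exists_isColoringFor_slide D.opp_opp ha hb hc hd hv hab h0 h1 ht ht' hg
    exact ⟨g', hg', nonconst g g' hK hne⟩
  · rintro ⟨g, hg, hne⟩
    -- The reverse slide is a slide of the new pairing, with the opposite ends `c`, `d` in the roles
    -- of `a`, `b`.
    obtain ⟨g', hg', hK⟩ := exists_isColoringFor_slide (o := fun x => t (D.opp (t x)))
      (a := c) (b := d) (c := a) (d := b) (t := t)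
      (fun x => by rw [tt, D.opp_opp, tt]) (fun i => by
        rw [hc, isCrossing_next, hb, isCrossing_next]; exact ha i) hd
      (fun i => by rw [hd, hc, hb, D.next_four]) hb (fun i j hij => by
        simpa [hc, hb, vert_next] using hv i j hij)
      (fun i => by
        have : D.opp (b (i + 1)) = a i := by rw [← hab, D.opp_opp]
        rw [(ht i).1, this, (ht i).2.2.1])
      (by rw [hc, hb, isOver_next_next (ha 0), h0])
      (by
        have hb1 : D.IsCrossing (b 1) := by rw [hb, isCrossing_next]; exact ha 1
        rw [hd, hc, isOver_next_next hb1, h1])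
      (fun i => ⟨(ht i).2.2.1, (ht i).2.2.2, (ht i).1, (ht i).2.1⟩)
      ht2 hg
    refine ⟨g', ?_, nonconst g g' hK hne⟩
    simpa only [tt] using hg'

theorem IsTrivial.not_isColorable (h : D.IsTrivial) : ¬ D.IsColorable m := by
  rintro ⟨g, hg, x, y, hxy⟩
  refine hxy ?_
  have := D.one_strand x y
  induction this with
  | rel x y h' =>
    rcases h' with rfl | ⟨-, rfl⟩ | ⟨h', -⟩
    · rw [hg.opp]
    · rw [hg.next _ (h x)]
    · exact absurd h' (h x)
  | refl => rfl
  | symm _ _ _ ih => exact (ih (Ne.symm hxy)).symm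
  | trans x y z _ _ ih1 ih2 =>
    by_contra hne
    by_cases hxy' : g x = g y
    · exact hne (hxy'.trans (ih2 (fun h => hne (hxy'.trans h))))
    · exact hxy' (ih1 hxy')

theorem isColorable_iff_of_step (h : SameCurve D E ∨ ReidemeisterMove D E) :
    D.IsColorable m → E.IsColorable m := by
  rcases h with (h | h | h) | ((h | h | h | h) | h | h)
  · exact h.isColorable
  · exact h.isColorable_iff.1
  · exact h.isColorable_iff.2
  · exact h.isColorable_iff.1
  · exact h.isColorable_iff.2
  · exact h.isColorable_iff.1
  · exact h.isColorable_iff.2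
  · exact h.isColorable_iff.1
  · exact h.isColorable_iff.2

theorem IsUnknot.not_isColorable (h : D.IsUnknot) : ¬ D.IsColorable m := by
  obtain ⟨E, hE, hDE⟩ := h
  induction hDE using Relation.ReflTransGen.head_induction_on with
  | refl => exact hE.not_isColorable
  | head h _ ih => exact fun h' => ih (isColorable_iff_of_step h h')

end KnotDiagram

/-! ### Constructing diagrams; removal of a subdivision point. -/

namespace KnotDiagram

/-- The diagram with the rotation system `nx`, `op`. -/
def ofJordanCurve {β : Type} [Finite β] (nx op : β → β) (ov : β → Bool) (o : β)
    (op_ne : ∀ d, op d ≠ d) (op_op : ∀ d, op (op d) = d) (nx_ne : ∀ d, nx d ≠ d)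
    (nx_four : ∀ d, nx (nx (nx (nx d))) = d) (ov_nx : ∀ d, nx (nx d) ≠ d → ov (nx d) = !(ov d))
    (strand : ∀ d d', Relation.EqvGen
      (fun x y => y = op x ∨ (nx (nx x) = x ∧ y = nx x) ∨ (nx (nx x) ≠ x ∧ y = nx (nx x))) d d')
    (J : JordanCurve nx op) : KnotDiagram where
  Dart := β
  finite := inferInstance
  next := ⟨nx, fun d => nx (nx (nx d)), nx_four, nx_four⟩
  opp := ⟨op, op, op_op, op_op⟩
  isOver := ov
  outer := o
  opp_ne := op_ne
  opp_opp := op_op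
  next_ne := nx_ne
  next_four := nx_four
  isOver_next := ov_nx
  one_strand := strand
  euler := by
    have : Nonempty β := ⟨o⟩
    exact (euler_iff_jordanCurve (nx := ⟨nx, fun d => nx (nx (nx d)), nx_four, nx_four⟩)
      nx_ne nx_four ⟨op, op, op_op, op_op⟩ op_op op_ne strand).2 J

variable {D : KnotDiagram}

/-- A rotation system onto which a diagram retracts has a single strand. -/
theorem strand_of_retraction {β : Type} (r : D.Dart → β)
    (hr : Function.Surjective r) {s : β → β → Prop}
    (hopp : ∀ d, Relation.EqvGen s (r d) (r (D.opp d)))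
    (hnext : ∀ d, ¬ D.IsCrossing d → Relation.EqvGen s (r d) (r (D.next d)))
    (hcross : ∀ d, D.IsCrossing d → Relation.EqvGen s (r d) (r (D.next (D.next d))))
    (x y : β) : Relation.EqvGen s x y := by
  obtain ⟨x, rfl⟩ := hr x
  obtain ⟨y, rfl⟩ := hr y
  have := eq_of_eqvGen (f := fun d => Quotient.mk (Relation.EqvGen.setoid s) (r d)) ?_
    (D.one_strand x y)
  · exact Quotient.exact this
  · rintro x y (rfl | ⟨h, rfl⟩ | ⟨h, rfl⟩)
    · exact Quotient.sound (hopp x)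
    · exact Quotient.sound (hnext x (not_not.2 h))
    · exact Quotient.sound (hcross x h)

theorem facePerm_apply_eq_iff {d d' : D.Dart} : D.facePerm d = d' ↔ D.opp d = D.next d' := by
  rw [facePerm, Equiv.Perm.mul_apply, Equiv.Perm.inv_eq_iff_eq]

theorem sameFace_facePerm (d : D.Dart) : D.SameFace (D.facePerm d) d :=
  (Equiv.Perm.sameCycle_apply_left).2 (Equiv.Perm.SameCycle.refl _ _)

/-- Both the single strand and the Jordan property come from the retraction `r`, which pushes each
removed end across its edge: even functions pull back along it, and the face function restricts. -/
theorem exists_removeSubdivision {a : D.Dart} (ha : ¬ D.IsCrossing a)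
    (hl : D.opp a ≠ D.next a) : ∃ E, RemoveSubdivision D E := by
  classical
  have n1 := D.next_ne
  have haa : D.next (D.next a) = a := not_not.1 ha
  have hlb : D.opp (D.next a) ≠ a := fun h => hl (by rw [← D.opp_opp (D.next a), h])
  have nnext : ∀ x, D.next x = a → x = D.next a := fun x h => D.next.injective (by rw [h, haa])
  have oinj : ∀ {x y}, D.opp x = y → x = D.opp y := fun h => by rw [← h, D.opp_opp]
  let p : D.Dart → Prop := fun x => x ≠ a ∧ x ≠ D.next a
  have : Finite D.Dart := D.finite
  -- If the marked outer corner disappears with the vertex, the next corner of its face survives.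
  obtain ⟨o, hop, ho⟩ : ∃ o, p o ∧ D.SameFace o D.outer := by
    by_cases h : p D.outer
    · exact ⟨_, h, Equiv.Perm.SameCycle.refl _ _⟩
    · refine ⟨D.facePerm D.outer, ?_, sameFace_facePerm _⟩
      have : D.outer = a ∨ D.outer = D.next a := by
        by_contra h'
        push Not at h'
        exact h h'
      rcases this with h | h <;> rw [h] <;> refine ⟨fun h => ?_, fun h => ?_⟩ <;>
        rw [facePerm_apply_eq_iff] at h
      · exact hl h
      · rw [haa] at h; exact D.opp_ne _ h
      · exact D.opp_ne _ h
      · rw [haa] at h; exact hlb h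
  let nx : {x // p x} → {x // p x} := fun x =>
    ⟨D.next x.1, fun h => x.2.2 (nnext _ h), fun h => x.2.1 (D.next.injective h)⟩
  let op0 : D.Dart → D.Dart := fun x => if D.opp x = a then D.opp (D.next a) else
    if D.opp x = D.next a then D.opp a else D.opp x
  have hop0 : ∀ x, p x → p (op0 x) := by
    intro x hx
    simp only [op0]
    split_ifs with h1 h2
    · exact ⟨hlb, D.opp_ne _⟩
    · exact ⟨D.opp_ne _, hl⟩
    · exact ⟨h1, h2⟩
  let op : {x // p x} → {x // p x} := fun x => ⟨op0 x.1, hop0 _ x.2⟩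
  have o1 : ∀ x, D.opp x = a → op0 x = D.opp (D.next a) := fun x h => by simp [op0, h]
  have o2 : ∀ x, D.opp x = D.next a → op0 x = D.opp a := fun x h => by simp [op0, h, n1]
  have o3 : ∀ x, D.opp x ≠ a → D.opp x ≠ D.next a → op0 x = D.opp x := fun x h h' => by
    simp [op0, h, h']
  have op_op : ∀ x, op (op x) = x := by
    rintro ⟨x, hx⟩
    refine Subtype.ext ?_
    change op0 (op0 x) = x
    by_cases h1 : D.opp x = a
    · rw [o1 x h1, o2 _ (by rw [D.opp_opp]), oinj h1]
    by_cases h2 : D.opp x = D.next a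
    · rw [o2 x h2, o1 _ (by rw [D.opp_opp]), oinj h2]
    · rw [o3 x h1 h2, o3 _ (by rw [D.opp_opp]; exact hx.1) (by rw [D.opp_opp]; exact hx.2),
        D.opp_opp]
  have op_ne : ∀ x, op x ≠ x := by
    rintro ⟨x, hx⟩ h
    have h : op0 x = x := congrArg Subtype.val h
    by_cases h1 : D.opp x = a
    · rw [o1 x h1, oinj h1] at h
      exact n1 a (D.opp.injective h)
    by_cases h2 : D.opp x = D.next a
    · rw [o2 x h2, oinj h2] at h
      exact n1 a (D.opp.injective h.symm)
    · rw [o3 x h1 h2] at h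
      exact D.opp_ne _ h
  have cr : ∀ x : {x // p x}, nx (nx x) = x ↔ ¬ D.IsCrossing x.1 := by
    intro x
    rw [IsCrossing, not_not, Subtype.ext_iff]
  let r : D.Dart → {x // p x} := fun x => if h : x = a then ⟨D.opp a, D.opp_ne _, hl⟩ else
    if h' : x = D.next a then ⟨D.opp (D.next a), hlb, D.opp_ne _⟩ else ⟨x, h, h'⟩
  have ra : r a = ⟨D.opp a, D.opp_ne _, hl⟩ := by simp [r]
  have rb : r (D.next a) = ⟨D.opp (D.next a), hlb, D.opp_ne _⟩ := by simp [r, n1]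
  have rx : ∀ x (hx : p x), r x = ⟨x, hx⟩ := fun x hx => by simp [r, hx.1, hx.2]
  have roa : r (D.opp a) = r a := by rw [ra, rx]
  have rob : r (D.opp (D.next a)) = r (D.next a) := by rw [rb, rx]
  have hcase : ∀ x, x = a ∨ x = D.next a ∨ p x := by
    intro x
    by_cases h1 : x = a
    · exact Or.inl h1
    by_cases h2 : x = D.next a
    · exact Or.inr (Or.inl h2)
    · exact Or.inr (Or.inr ⟨h1, h2⟩)
  refine ⟨ofJordanCurve nx op (fun x => D.isOver x.1) ⟨o, hop⟩ op_ne op_op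
    (fun x h => n1 _ (congrArg Subtype.val h)) (fun x => Subtype.ext (D.next_four _))
    (fun x hx => D.isOver_next _ (fun h => hx (Subtype.ext h))) ?_ ?_, a, Subtype.val, ha, hl,
    Subtype.val_injective, ?_, fun _ => rfl, fun e h1 h2 => o3 _ h1 h2, fun e h => o1 _ h,
    fun e h => o2 _ h, fun _ _ => rfl, ho⟩
  · refine strand_of_retraction r (fun x => ⟨x.1, rx _ x.2⟩) ?_ ?_ ?_
    · intro x
      rcases hcase x with rfl | rfl | hx
      · rw [roa]; exact .refl _
      · rw [rob]; exact .refl _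
      by_cases h1 : D.opp x = a
      · rw [oinj h1, roa, D.opp_opp]; exact .refl _
      by_cases h2 : D.opp x = D.next a
      · rw [oinj h2, rob, D.opp_opp]; exact .refl _
      rw [rx x hx, rx _ ⟨h1, h2⟩]
      exact .rel _ _ (Or.inl (Subtype.ext (o3 _ h1 h2).symm))
    · intro x hx
      have key : ∀ y, y = op (r a) → Relation.EqvGen (fun x y => y = op x ∨
          (nx (nx x) = x ∧ y = nx x) ∨ (nx (nx x) ≠ x ∧ y = nx (nx x))) (r a) y := fun y h =>
        .rel _ _ (Or.inl h)
      have hab : r (D.next a) = op (r a) := by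
        rw [ra, rb]
        exact Subtype.ext (o1 _ (D.opp_opp _)).symm
      rcases hcase x with rfl | rfl | hx'
      · exact key _ hab
      · rw [haa]
        exact .symm _ _ (key _ hab)
      · have := (nx ⟨x, hx'⟩).2
        rw [rx x hx', rx _ this]
        exact .rel _ _ (Or.inr (Or.inl ⟨(cr _).2 hx, rfl⟩))
    · intro x hx
      rcases hcase x with rfl | rfl | hx'
      · exact absurd hx ha
      · exact absurd ((isCrossing_next _).1 hx) ha
      · have := (nx (nx ⟨x, hx'⟩)).2
        rw [rx x hx', rx _ this]
        exact .rel _ _ (Or.inr (Or.inr ⟨fun h => (cr _).1 h hx, rfl⟩))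
  · intro x hxo hx4 hx2
    have j0 : ∀ d, x (r (D.opp d)) = x (r d) := by
      intro d
      rcases hcase d with rfl | rfl | hx
      · rw [roa]
      · rw [rob]
      by_cases h1 : D.opp d = a
      · rw [oinj h1, roa, D.opp_opp]
      by_cases h2 : D.opp d = D.next a
      · rw [oinj h2, rob, D.opp_opp]
      have : r (D.opp d) = op (r d) := by
        rw [rx d hx, rx _ ⟨h1, h2⟩]
        exact Subtype.ext (o3 _ h1 h2).symm
      rw [this, hxo]
    have j1 : ∀ d, D.next (D.next d) ≠ d → x (r d) + x (r (D.next d)) + x (r (D.next (D.next d))) +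
        x (r (D.next (D.next (D.next d)))) = 0 := by
      intro d hd
      rcases hcase d with rfl | rfl | hx
      · exact absurd hd ha
      · exact absurd ((isCrossing_next _).1 hd) ha
      · rw [rx d hx, rx _ (nx ⟨d, hx⟩).2, rx _ (nx (nx ⟨d, hx⟩)).2, rx _ (nx (nx (nx ⟨d, hx⟩))).2]
        exact hx4 ⟨d, hx⟩ (fun h => (cr _).1 h hd)
    have j2 : ∀ d, D.next (D.next d) = d → x (r d) + x (r (D.next d)) = 0 := by
      intro d hd
      have hab : x (r (D.next a)) = x (r a) := by
        have : r (D.next a) = op (r a) := by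
          rw [ra, rb]
          exact Subtype.ext (o1 _ (D.opp_opp _)).symm
        rw [this, hxo]
      rcases hcase d with rfl | rfl | hx
      · rw [hab, zmod_two_add_self]
      · rw [haa, hab, zmod_two_add_self]
      · rw [rx d hx, rx _ (nx ⟨d, hx⟩).2]
        exact hx2 ⟨d, hx⟩ ((cr _).2 (not_not.2 hd))
    obtain ⟨h, hh⟩ := D.jordanCurve (fun d => x (r d)) j0 j1 j2
    refine ⟨fun e => h e.1, fun e => ⟨?_, ?_⟩⟩
    · change h (op0 (D.next e.1)) = h e.1
      by_cases h1 : D.opp (D.next e.1) = a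
      · rw [o1 _ h1, (hh a).1, ← (hh e.1).1, h1]
      by_cases h2 : D.opp (D.next e.1) = D.next a
      · have := (hh (D.next a)).1
        rw [haa] at this
        rw [o2 _ h2, this, ← (hh e.1).1, h2]
      rw [o3 _ h1 h2, (hh e.1).1]
    · change h (D.next e.1) + h e.1 = _
      have := (nx e).2
      rw [(hh e.1).2, rx _ this]
  · exact fun d => ⟨fun ⟨y, hy⟩ => hy ▸ y.2, fun h => ⟨⟨d, h⟩, rfl⟩⟩

end KnotDiagram

/-! ### Construction of the untwisted diagram. -/

namespace KnotDiagram

variable {D : KnotDiagram}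

/-- The loop retracts onto the two remaining ends by going straight across the crossing. For the
Jordan property, functions are instead extended by zero over the loop. -/
theorem exists_untwist {a : D.Dart} (ha : D.IsCrossing a) (hab : D.opp a = D.next a)
    (h1 : D.outer ≠ a) (h2 : D.outer ≠ D.next a) : ∃ E, Untwist D E := by
  classical
  have : Finite D.Dart := D.finite
  have n1 := D.next_ne
  have n4 := D.next_four
  have m2 : D.next (D.next a) ≠ a := ha
  have m3 := next_three_ne a
  have m2' : D.next (D.next (D.next a)) ≠ D.next a := fun h => m2 (D.next.injective h)
  have hba : D.opp (D.next a) = a := by rw [← hab, D.opp_opp]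
  let p : D.Dart → Prop := fun x => x ≠ a ∧ x ≠ D.next a
  let c : {x // p x} := ⟨D.next (D.next a), m2, n1 _⟩
  let d : {x // p x} := ⟨D.next (D.next (D.next a)), m3, m2'⟩
  have nnext : ∀ {x y}, D.next x = y → x = D.next (D.next (D.next y)) := fun h => by rw [← h, n4]
  have nxp : ∀ x, p x → x ≠ d → p (D.next x) := fun x hx hd =>
    ⟨fun h => hd (nnext h), fun h => hx.1 (D.next.injective h)⟩
  let nx : {x // p x} → {x // p x} := fun x =>
    if h : x.1 = d.1 then c else ⟨D.next x.1, nxp _ x.2 h⟩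
  let op : {x // p x} → {x // p x} := fun x => ⟨D.opp x.1,
    fun h => x.2.2 (by rw [← hab, ← h, D.opp_opp]), fun h => x.2.1 (by rw [← hba, ← h, D.opp_opp])⟩
  have nd : nx d = c := by simp [nx]
  have nn : ∀ x, x ≠ d → (nx x).1 = D.next x.1 := fun x hx => by
    have : x.1 ≠ d.1 := fun h => hx (Subtype.ext h)
    simp [nx, this]
  have cd : c ≠ d := fun h => n1 _ (congrArg Subtype.val h).symm
  have nc : nx c = d := Subtype.ext (nn c cd)
  have inv : ∀ x, x ≠ c → x ≠ d → nx x ≠ c ∧ nx x ≠ d := by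
    refine fun x hc hd => ⟨fun h => ?_, fun h => ?_⟩
    · have := (nn x hd).symm.trans (congrArg Subtype.val h)
      exact x.2.2 (D.next.injective this)
    · have := (nn x hd).symm.trans (congrArg Subtype.val h)
      exact hc (Subtype.ext (D.next.injective this))
  have nn2 : ∀ x, x ≠ c → x ≠ d → (nx (nx x)).1 = D.next (D.next x.1) := fun x hc hd => by
    rw [nn _ (inv x hc hd).2, nn x hd]
  have nn3 : ∀ x, x ≠ c → x ≠ d → (nx (nx (nx x))).1 = D.next (D.next (D.next x.1)) :=
    fun x hc hd => by
    rw [nn2 _ (inv x hc hd).1 (inv x hc hd).2, nn x hd]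
  have cr : ∀ x, x ≠ c → x ≠ d → (nx (nx x) = x ↔ ¬ D.IsCrossing x.1) := fun x hc hd => by
    rw [IsCrossing, not_not, Subtype.ext_iff, nn2 x hc hd]
  have four : ∀ x, nx (nx (nx (nx x))) = x := by
    intro x
    by_cases hc : x = c
    · rw [hc, nc, nd, nc, nd]
    by_cases hd : x = d
    · rw [hd, nd, nc, nd, nc]
    obtain ⟨i1, i2⟩ := inv x hc hd
    exact Subtype.ext (by rw [nn3 _ i1 i2, nn x hd, n4])
  let r : D.Dart → {x // p x} := fun x => if h : x = a then c else
    if h' : x = D.next a then d else ⟨x, h, h'⟩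
  have ra : r a = c := by simp [r]
  have rb : r (D.next a) = d := by simp [r, n1]
  have rx : ∀ x : {x // p x}, r x.1 = x := fun x => by simp [r, x.2.1, x.2.2]
  have rc : r (D.next (D.next a)) = c := rx c
  have rd : r (D.next (D.next (D.next a))) = d := rx d
  have ro : ∀ x : {x // p x}, r (D.opp x) = op x := fun x => rx (op x)
  have hcase : ∀ x, x = a ∨ x = D.next a ∨ x = D.next (D.next a) ∨
      x = D.next (D.next (D.next a)) ∨ ∃ y : {x // p x}, y.1 = x ∧ y ≠ c ∧ y ≠ d := by
    intro x
    by_cases h1 : x = a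
    · exact Or.inl h1
    by_cases h2 : x = D.next a
    · exact Or.inr (Or.inl h2)
    by_cases h3 : x = D.next (D.next a)
    · exact Or.inr (Or.inr (Or.inl h3))
    by_cases h4 : x = D.next (D.next (D.next a))
    · exact Or.inr (Or.inr (Or.inr (Or.inl h4)))
    exact Or.inr (Or.inr (Or.inr (Or.inr ⟨⟨x, h1, h2⟩, rfl,
      fun h => h3 (congrArg Subtype.val h), fun h => h4 (congrArg Subtype.val h)⟩)))
  have hcase' : ∀ x, x = a ∨ x = D.next a ∨ ∃ y : {x // p x}, y.1 = x := by
    intro x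
    by_cases h1 : x = a
    · exact Or.inl h1
    by_cases h2 : x = D.next a
    · exact Or.inr (Or.inl h2)
    exact Or.inr (Or.inr ⟨⟨x, h1, h2⟩, rfl⟩)
  have hcra : ∀ x, x = a ∨ x = D.next a ∨ x = D.next (D.next a) ∨
      x = D.next (D.next (D.next a)) → D.IsCrossing x := by
    rintro x (rfl | rfl | rfl | rfl) <;> simpa [isCrossing_next] using ha
  have strand : ∀ x y, Relation.EqvGen (fun x y => y = op x ∨ (nx (nx x) = x ∧ y = nx x) ∨
      (nx (nx x) ≠ x ∧ y = nx (nx x))) x y := by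
    have hcd : Relation.EqvGen (fun x y => y = op x ∨ (nx (nx x) = x ∧ y = nx x) ∨
        (nx (nx x) ≠ x ∧ y = nx (nx x))) c d :=
      .rel _ _ (Or.inr (Or.inl ⟨by rw [nc, nd], nc.symm⟩))
    refine strand_of_retraction r (fun x => ⟨x.1, rx x⟩) ?_ ?_ ?_
    · intro x
      rcases hcase' x with rfl | rfl | ⟨x, rfl⟩
      · rw [hab, ra, rb]; exact hcd
      · rw [hba, ra, rb]; exact .symm _ _ hcd
      · rw [ro, rx]
        exact .rel _ _ (Or.inl rfl)
    · intro x hx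
      rcases hcase x with h | h | h | h | ⟨x, rfl, xc, xd⟩
      · exact absurd (hcra x (by simp [h])) hx
      · exact absurd (hcra x (by simp [h])) hx
      · exact absurd (hcra x (by simp [h])) hx
      · exact absurd (hcra x (by simp [h])) hx
      · rw [← nn x xd, rx, rx]
        exact .rel _ _ (Or.inr (Or.inl ⟨(cr x xc xd).2 hx, rfl⟩))
    · intro x hx
      rcases hcase x with rfl | rfl | rfl | rfl | ⟨x, rfl, xc, xd⟩
      · rw [ra, rc]; exact .refl _
      · rw [rb, rd]; exact .refl _
      · rw [n4, ra, rc]; exact .refl _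
      · rw [n4, rb, rd]; exact .refl _
      · rw [← nn2 x xc xd, rx, rx]
        exact .rel _ _ (Or.inr (Or.inr ⟨fun h => (cr x xc xd).1 h hx, rfl⟩))
  have J : JordanCurve nx op := by
    intro x hxo hx4 hx2
    -- Zero on the loop is compatible with evenness at the crossing, since the two remaining ends
    -- carry equal values.
    let X : D.Dart → ZMod 2 := fun y => if h : p y then x ⟨y, h⟩ else 0
    have Xa : X a = 0 := by simp [X, p]
    have Xb : X (D.next a) = 0 := by simp [X, p]
    have Xx : ∀ y : {x // p x}, X y.1 = x y := fun y => by simp [X, y.2]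
    have Xc : X (D.next (D.next a)) = x c := Xx c
    have Xd : X (D.next (D.next (D.next a))) = x d := Xx d
    have xcd : x c + x d = 0 := by
      have := hx2 c (by rw [nc, nd])
      rwa [nc] at this
    have j0 : ∀ y, X (D.opp y) = X y := by
      intro y
      rcases hcase' y with rfl | rfl | ⟨y, rfl⟩
      · rw [hab, Xa, Xb]
      · rw [hba, Xa, Xb]
      · exact (Xx (op y)).trans ((hxo y).trans (Xx y).symm)
    have j1 : ∀ y, D.next (D.next y) ≠ y → X y + X (D.next y) + X (D.next (D.next y)) +
        X (D.next (D.next (D.next y))) = 0 := by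
      intro y hy
      rcases hcase y with rfl | rfl | rfl | rfl | ⟨y, rfl, yc, yd⟩
      · rw [Xa, Xb, Xc, Xd]; linear_combination xcd
      · rw [n4, Xa, Xb, Xc, Xd]; linear_combination xcd
      · rw [n4, Xa, Xb, Xc, Xd]; linear_combination xcd
      · rw [n4, Xa, Xb, Xc, Xd]; linear_combination xcd
      · rw [← nn3 y yc yd, ← nn2 y yc yd, ← nn y yd, Xx, Xx, Xx, Xx]
        exact hx4 y (fun h => (cr y yc yd).1 h hy)
    have j2 : ∀ y, D.next (D.next y) = y → X y + X (D.next y) = 0 := by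
      intro y hy
      rcases hcase y with h | h | h | h | ⟨y, rfl, yc, yd⟩
      · exact absurd hy (hcra y (by simp [h]))
      · exact absurd hy (hcra y (by simp [h]))
      · exact absurd hy (hcra y (by simp [h]))
      · exact absurd hy (hcra y (by simp [h]))
      · rw [← nn y yd, Xx, Xx]
        exact hx2 y ((cr y yc yd).2 (not_not.2 hy))
    obtain ⟨h, hh⟩ := D.jordanCurve X j0 j1 j2
    refine ⟨fun e => h e.1, fun e => ?_⟩
    by_cases hd : e = d
    · subst hd
      have e1 := (hh a).2
      have e2 := (hh (D.next a)).1
      have e3 := (hh (D.next a)).2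
      have e4 := (hh (D.next (D.next (D.next a)))).2
      rw [Xb] at e1
      rw [Xc] at e3
      rw [n4, Xa] at e4
      rw [nd]
      change h (D.opp (D.next (D.next a))) = h (D.next (D.next (D.next a))) ∧
        h (D.next (D.next a)) + h (D.next (D.next (D.next a))) = x c
      rw [e2]
      constructor <;> grind
    · constructor
      · change h (D.opp (nx e).1) = h e.1
        rw [nn e hd, (hh e.1).1]
      · change h (nx e).1 + h e.1 = x (nx e)
        rw [← Xx (nx e), nn e hd, (hh e.1).2]
  have hrange : ∀ x, x ∈ Set.range (Subtype.val : {x // p x} → D.Dart) ↔ p x :=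
    fun d => ⟨fun ⟨y, hy⟩ => hy ▸ y.2, fun h => ⟨⟨d, h⟩, rfl⟩⟩
  refine ⟨ofJordanCurve nx op (fun x => D.isOver x.1) ⟨D.outer, h1, h2⟩
    (fun x h => D.opp_ne _ (congrArg Subtype.val h)) (fun x => Subtype.ext (D.opp_opp _))
    ?_ four ?_ strand J, a, _, _, _, Subtype.val, ha, rfl, rfl, rfl, hab, Subtype.val_injective,
    hrange, fun _ => rfl,
    fun e he => ?_, fun e he => ?_, fun _ _ => rfl, Equiv.Perm.SameCycle.refl _ _⟩
  · intro x h
    by_cases hd : x = d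
    · rw [hd, nd] at h; exact cd h
    · exact n1 _ ((nn x hd).symm.trans (congrArg Subtype.val h))
  · intro x hx
    by_cases hd : x = d
    · exact absurd (by rw [hd, nd, nc]) hx
    by_cases hc : x = c
    · exact absurd (by rw [hc, nc, nd]) hx
    rw [nn x hd]
    exact D.isOver_next _ (not_not.1 (fun h => hx ((cr x hc hd).2 h)))
  · obtain rfl : e = d := Subtype.ext he
    exact congrArg Subtype.val nd
  · exact nn e (fun h => he (congrArg Subtype.val h))

end KnotDiagram

/-! ### Construction of the unpoked diagram. -/

namespace KnotDiagram

variable {D E : KnotDiagram}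

/-- The place of an unpoke: two crossings that are joined by two edges, with one strand over the
other one at both crossings. -/
structure UnpokeSite (D : KnotDiagram) (a b p q a' b' p' q' : D.Dart) : Prop where
  cross : D.IsCrossing a
  next_a : b = D.next a
  next_b : p = D.next b
  next_p : q = D.next p
  cross' : D.IsCrossing b'
  next_b' : a' = D.next b'
  next_a' : q' = D.next a'
  next_q' : p' = D.next q'
  vert_ne : D.vert a ≠ D.vert a'
  opp_a : D.opp a = a'
  opp_b : D.opp b = b'
  isOver_eq : D.isOver a = D.isOver a'

/-- The identification of the darts after an unpoke with darts before it. -/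
structure IsUnpokeMap (D E : KnotDiagram) (a b p q a' b' p' q' : D.Dart) (f : E.Dart → D.Dart) :
    Prop where
  injective : Function.Injective f
  range : ∀ x, x ∈ Set.range f ↔ (x ≠ a ∧ x ≠ b ∧ x ≠ a' ∧ x ≠ b')
  map_opp : ∀ e, f (E.opp e) = D.opp (f e)
  map_p : ∀ e, f e = p → f (E.next e) = p'
  map_p' : ∀ e, f e = p' → f (E.next e) = p
  map_q : ∀ e, f e = q → f (E.next e) = q'
  map_q' : ∀ e, f e = q' → f (E.next e) = q
  map_next : ∀ e, f e ≠ p → f e ≠ p' → f e ≠ q → f e ≠ q' → f (E.next e) = D.next (f e)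
  sameOver : SameOver D E f
  outer : D.SameFace (f E.outer) D.outer

variable {a b p q a' b' p' q' : D.Dart}

theorem UnpokeSite.unpoke (S : UnpokeSite D a b p q a' b' p' q') {f : E.Dart → D.Dart}
    (M : IsUnpokeMap D E a b p q a' b' p' q' f) : Unpoke D E :=
  ⟨a, b, p, q, a', b', p', q', f, S.1, S.2, S.3, S.4, S.5, S.6, S.7, S.8, S.9, S.10, S.11, S.12,
    M.1, M.2, M.3, M.4, M.5, M.6, M.7, M.8, M.9, M.10⟩

theorem UnpokeSite.distinct (S : UnpokeSite D a b p q a' b' p' q') :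
    (a ≠ b ∧ a ≠ p ∧ a ≠ q ∧ b ≠ p ∧ b ≠ q ∧ p ≠ q) ∧
    (b' ≠ a' ∧ b' ≠ q' ∧ b' ≠ p' ∧ a' ≠ q' ∧ a' ≠ p' ∧ q' ≠ p') ∧
    (a ≠ a' ∧ a ≠ b' ∧ a ≠ p' ∧ a ≠ q') ∧ (b ≠ a' ∧ b ≠ b' ∧ b ≠ p' ∧ b ≠ q') ∧
    (p ≠ a' ∧ p ≠ b' ∧ p ≠ p' ∧ p ≠ q') ∧ (q ≠ a' ∧ q ≠ b' ∧ q ≠ p' ∧ q ≠ q') := by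
  have n1 := D.next_ne
  have va : D.vert b = D.vert a ∧ D.vert p = D.vert a ∧ D.vert q = D.vert a := by
    simp only [S.next_p, S.next_b, S.next_a, vert_next, and_self]
  have va' : D.vert b' = D.vert a' ∧ D.vert p' = D.vert a' ∧ D.vert q' = D.vert a' := by
    simp only [S.next_q', S.next_a', S.next_b', vert_next, and_self]
  have dv : ∀ x y, D.vert x = D.vert a → D.vert y = D.vert a' → x ≠ y := by
    rintro x y h1 h2 rfl
    exact S.vert_ne (h1.symm.trans h2)
  refine ⟨?_, ?_, ?_, ?_, ?_, ?_⟩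
  · have := next_three_ne a
    have h2 : D.next (D.next a) ≠ a := S.cross
    have hb := S.next_a
    have hp := S.next_b
    have hq := S.next_p
    clear va va' dv
    clear S
    subst hb hp hq
    exact ⟨(n1 _).symm, h2.symm, this.symm, (n1 _).symm,
      fun h => h2 (D.next.injective h.symm), (n1 _).symm⟩
  · have := next_three_ne b'
    have h2 : D.next (D.next b') ≠ b' := S.cross'
    have hb := S.next_b'
    have hp := S.next_a'
    have hq := S.next_q'
    clear va va' dv
    clear S
    subst hb hp hq
    exact ⟨(n1 _).symm, h2.symm, this.symm, (n1 _).symm,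
      fun h => h2 (D.next.injective h.symm), (n1 _).symm⟩
  · exact ⟨dv _ _ rfl rfl, dv _ _ rfl va'.1, dv _ _ rfl va'.2.1, dv _ _ rfl va'.2.2⟩
  · exact ⟨dv _ _ va.1 rfl, dv _ _ va.1 va'.1, dv _ _ va.1 va'.2.1, dv _ _ va.1 va'.2.2⟩
  · exact ⟨dv _ _ va.2.1 rfl, dv _ _ va.2.1 va'.1, dv _ _ va.2.1 va'.2.1, dv _ _ va.2.1 va'.2.2⟩
  · exact ⟨dv _ _ va.2.2 rfl, dv _ _ va.2.2 va'.1, dv _ _ va.2.2 va'.2.1, dv _ _ va.2.2 va'.2.2⟩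

/-- The letters are values of a face function: `h` at a corner and `o` at the other end of its edge,
with capitals for `p'` and `q'`. The values on the two strands are `xp` and `xq`. The conclusions
are the Jordan conditions at the two new subdivision points. -/
theorem unpoke_corners {ha hb hp hq ha' hb' hP hQ oP op oQ oq xp xq : ZMod 2}
    (ea : hb' = ha ∧ hb + ha = xq) (eb : op = hb ∧ hp + hb = xp) (ep : oq = hp ∧ hq + hp = xq)
    (eq : ha' = hq ∧ ha + hq = xp) (ea' : oQ = ha' ∧ hQ + ha' = xq)
    (eP : hb = hP ∧ hb' + hP = xq)
    (eQ : oP = hQ ∧ hP + hQ = xp) :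
    (oP = hp ∧ hP + hp = xp) ∧ (op = hP ∧ hp + hP = xp) ∧ (oQ = hq ∧ hQ + hq = xq) ∧
      (oq = hQ ∧ hq + hQ = xq) := by
  grind

/-- The inner edges retract along their strands, that of `a` onto `p` and that of `b` onto `q`.
Strand connectivity and even functions are transported along this retraction. -/
theorem UnpokeSite.exists_isUnpokeMap (S : UnpokeSite D a b p q a' b' p' q')
    (ho : D.outer ≠ a ∧ D.outer ≠ b ∧ D.outer ≠ a' ∧ D.outer ≠ b') :
    ∃ E f, IsUnpokeMap D E a b p q a' b' p' q' f := by
  classical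
  have : Finite D.Dart := D.finite
  have n1 := D.next_ne
  have n4 := D.next_four
  obtain ⟨⟨d01, d02, d03, d12, d13, d23⟩, ⟨e01, e02, e03, e12, e13, e23⟩, ⟨f0, f1, f2, f3⟩,
    ⟨g0, g1, g2, g3⟩, ⟨h0, h1, h2, h3⟩, i0, i1, i2, i3⟩ := S.distinct
  have nq : D.next q = a := by rw [S.next_p, S.next_b, S.next_a, n4]
  have np' : D.next p' = b' := by rw [S.next_q', S.next_a', S.next_b', n4]
  have oa' : D.opp a' = a := by rw [← S.opp_a, D.opp_opp]
  have ob' : D.opp b' = b := by rw [← S.opp_b, D.opp_opp]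
  let P : D.Dart → Prop := fun x => x ≠ a ∧ x ≠ b ∧ x ≠ a' ∧ x ≠ b'
  let P' : {x // P x} := ⟨p', f2.symm, g2.symm, e13.symm, e03.symm⟩
  let Q' : {x // P x} := ⟨q', f3.symm, g3.symm, e12.symm, e02.symm⟩
  let p : {x // P x} := ⟨p, d02.symm, d12.symm, h0, h1⟩
  let q : {x // P x} := ⟨q, d03.symm, d13.symm, i0, i1⟩
  have pq : p ≠ q := fun h => d23 (congrArg Subtype.val h)
  have pP : p ≠ P' := fun h => h2 (congrArg Subtype.val h)
  have pQ : p ≠ Q' := fun h => h3 (congrArg Subtype.val h)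
  have qP : q ≠ P' := fun h => i2 (congrArg Subtype.val h)
  have qQ : q ≠ Q' := fun h => i3 (congrArg Subtype.val h)
  have PQ : P' ≠ Q' := fun h => e23 (congrArg Subtype.val h).symm
  have nb : D.next b = p.1 := S.next_b.symm
  have np : D.next p.1 = q.1 := S.next_p.symm
  have nq : D.next q.1 = a := nq
  have na' : D.next a' = Q'.1 := S.next_a'.symm
  have nq' : D.next Q'.1 = P'.1 := S.next_q'.symm
  have np' : D.next P'.1 = b' := np'
  have na := S.next_a
  have nb' := S.next_b'
  have oa := S.opp_a
  have ob := S.opp_b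
  have ca := S.cross
  have cb' := S.cross'
  clear S
  let sp : {x // P x} → Prop := fun x => x = p ∨ x = P' ∨ x = q ∨ x = Q'
  have nxp : ∀ x : {x // P x}, ¬ sp x → P (D.next x.1) := fun x hx =>
    ⟨fun h => hx (Or.inr (Or.inr (Or.inl (Subtype.ext (D.next.injective (h.trans nq.symm)))))),
      fun h => x.2.1 (D.next.injective (h.trans na)),
      fun h => x.2.2.2.2 (D.next.injective (h.trans nb')),
      fun h => hx (Or.inr (Or.inl (Subtype.ext (D.next.injective (h.trans np'.symm)))))⟩
  let nx : {x // P x} → {x // P x} := fun x =>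
    if h : sp x then (if x = p then P' else if x = P' then p else if x = q then Q' else q)
    else ⟨D.next x.1, nxp x h⟩
  let op : {x // P x} → {x // P x} := fun x => ⟨D.opp x.1,
    fun h => x.2.2.2.1 (by rw [← D.opp_opp x.1, h, oa]),
    fun h => x.2.2.2.2 (by rw [← D.opp_opp x.1, h, ob]),
    fun h => x.2.1 (by rw [← D.opp_opp x.1, h, oa']),
    fun h => x.2.2.1 (by rw [← D.opp_opp x.1, h, ob'])⟩
  have kp : nx p = P' := by simp [nx, sp]
  have kP : nx P' = p := by simp [nx, sp, pP.symm]
  have kq : nx q = Q' := by simp [nx, sp, qP, pq.symm]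
  have kQ : nx Q' = q := by simp [nx, sp, pQ.symm, PQ.symm, qQ.symm]
  have ksp : ∀ x, sp x → nx (nx x) = x := by
    rintro x (rfl | rfl | rfl | rfl)
    · rw [kp, kP]
    · rw [kP, kp]
    · rw [kq, kQ]
    · rw [kQ, kq]
  have nn : ∀ x, ¬ sp x → (nx x).1 = D.next x.1 := fun x hx => by simp [nx, hx]
  have inv : ∀ x, ¬ sp x → ¬ sp (nx x) := by
    rintro x hx (h | h | h | h) <;> have := (nn x hx).symm.trans (congrArg Subtype.val h)
    · exact x.2.2.1 (D.next.injective (this.trans nb.symm))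
    · exact hx (Or.inr (Or.inr (Or.inr (Subtype.ext (D.next.injective (this.trans nq'.symm))))))
    · exact hx (Or.inl (Subtype.ext (D.next.injective (this.trans np.symm))))
    · exact x.2.2.2.1 (D.next.injective (this.trans na'.symm))
  have nn2 : ∀ x, ¬ sp x → (nx (nx x)).1 = D.next (D.next x.1) := fun x hx => by
    rw [nn _ (inv x hx), nn x hx]
  have nn3 : ∀ x, ¬ sp x → (nx (nx (nx x))).1 = D.next (D.next (D.next x.1)) := fun x hx => by
    rw [nn2 _ (inv x hx), nn x hx]
  have cr : ∀ x, ¬ sp x → (nx (nx x) = x ↔ ¬ D.IsCrossing x.1) := fun x hx => by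
    rw [IsCrossing, not_not, Subtype.ext_iff, nn2 x hx]
  have four : ∀ x, nx (nx (nx (nx x))) = x := by
    intro x
    by_cases hx : sp x
    · rw [ksp x hx, ksp x hx]
    · exact Subtype.ext (by rw [nn3 _ (inv x hx), nn x hx, n4])
  let r : D.Dart → {x // P x} := fun x => if h : P x then ⟨x, h⟩ else
    if x = a ∨ x = a' then p else q
  have ra : r a = p := by simp [r, P]
  have ra' : r a' = p := by simp [r, P]
  have rb : r b = q := by simp [r, P, d01.symm, g0]
  have rb' : r b' = q := by simp [r, P, e01, f1.symm]
  have rx : ∀ x : {x // P x}, r x.1 = x := fun x => by simp [r, x.2]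
  have rp := rx p
  have rq := rx q
  have rP := rx P'
  have rQ := rx Q'
  have ro : ∀ x : {x // P x}, r (D.opp x) = op x := fun x => rx (op x)
  have hcase' : ∀ x, x = a ∨ x = b ∨ x = a' ∨ x = b' ∨ ∃ y : {x // P x}, y.1 = x := by
    intro x
    by_cases h : P x
    · exact Or.inr (Or.inr (Or.inr (Or.inr ⟨⟨x, h⟩, rfl⟩)))
    · simp only [P] at h
      tauto
  have hcase : ∀ x, x = a ∨ x = b ∨ x = p.1 ∨ x = q.1 ∨ x = a' ∨ x = b' ∨ x = P'.1 ∨ x = Q'.1 ∨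
      ∃ y : {x // P x}, y.1 = x ∧ ¬ sp y := by
    intro x
    rcases hcase' x with h | h | h | h | ⟨y, rfl⟩
    · simp [h]
    · simp [h]
    · simp [h]
    · simp [h]
    · by_cases hy : sp y
      · rcases hy with h | h | h | h <;> simp [h]
      · exact Or.inr (Or.inr (Or.inr (Or.inr (Or.inr (Or.inr (Or.inr (Or.inr ⟨y, rfl, hy⟩)))))))
  have cb : D.IsCrossing b := by rw [na, isCrossing_next]; exact ca
  have cp : D.IsCrossing p.1 := by rw [← nb, isCrossing_next]; exact cb
  have cq : D.IsCrossing q.1 := by rw [← np, isCrossing_next]; exact cp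
  have ca' : D.IsCrossing a' := by rw [nb', isCrossing_next]; exact cb'
  have cQ : D.IsCrossing Q'.1 := by rw [← na', isCrossing_next]; exact ca'
  have cP : D.IsCrossing P'.1 := by rw [← nq', isCrossing_next]; exact cQ
  have hcase2 : ∀ x, ¬ D.IsCrossing x → ∃ y : {x // P x}, y.1 = x ∧ ¬ sp y := by
    intro x hx
    rcases hcase x with rfl | rfl | rfl | rfl | rfl | rfl | rfl | rfl | h <;>
      first | exact h | (exfalso; apply hx; assumption)
  have strand : ∀ x y, Relation.EqvGen (fun x y => y = op x ∨ (nx (nx x) = x ∧ y = nx x) ∨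
      (nx (nx x) ≠ x ∧ y = nx (nx x))) x y := by
    have hpP : Relation.EqvGen (fun x y => y = op x ∨ (nx (nx x) = x ∧ y = nx x) ∨
        (nx (nx x) ≠ x ∧ y = nx (nx x))) p P' :=
      .rel _ _ (Or.inr (Or.inl ⟨by rw [kp, kP], kp.symm⟩))
    have hqQ : Relation.EqvGen (fun x y => y = op x ∨ (nx (nx x) = x ∧ y = nx x) ∨
        (nx (nx x) ≠ x ∧ y = nx (nx x))) q Q' :=
      .rel _ _ (Or.inr (Or.inl ⟨by rw [kq, kQ], kq.symm⟩))
    refine strand_of_retraction r (fun x => ⟨x.1, rx x⟩) ?_ ?_ ?_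
    · intro x
      rcases hcase' x with rfl | rfl | rfl | rfl | ⟨x, rfl⟩
      · rw [oa, ra, ra']; exact .refl _
      · rw [ob, rb, rb']; exact .refl _
      · rw [oa', ra, ra']; exact .refl _
      · rw [ob', rb, rb']; exact .refl _
      · rw [ro, rx]
        exact .rel _ _ (Or.inl rfl)
    · intro x hx
      obtain ⟨x, rfl, hs⟩ := hcase2 x hx
      rw [← nn x hs, rx, rx]
      exact .rel _ _ (Or.inr (Or.inl ⟨(cr x hs).2 hx, rfl⟩))
    · intro x hx
      rcases hcase x with rfl | rfl | rfl | rfl | rfl | rfl | rfl | rfl | ⟨x, rfl, hs⟩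
      · rw [← na, nb, ra, rp]; exact .refl _
      · rw [nb, np, rb, rq]; exact .refl _
      · rw [np, nq, ra, rp]; exact .refl _
      · rw [nq, ← na, rb, rq]; exact .refl _
      · rw [na', nq', ra', rP]; exact hpP
      · rw [← nb', na', rb', rQ]; exact hqQ
      · rw [np', ← nb', ra', rP]; exact .symm _ _ hpP
      · rw [nq', np', rb', rQ]; exact .symm _ _ hqQ
      · rw [← nn2 x hs, rx, rx]
        exact .rel _ _ (Or.inr (Or.inr ⟨fun h => (cr x hs).1 h hx, rfl⟩))
  have J : JordanCurve nx op := by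
    intro x hxo hx4 hx2
    have xp : x P' = x p := by
      have := hx2 p (by rw [kp, kP])
      rw [kp] at this
      exact (add_eq_zero_iff_eq_neg'.1 this).trans (ZMod.neg_eq_self_mod_two _)
    have xq : x Q' = x q := by
      have := hx2 q (by rw [kq, kQ])
      rw [kq] at this
      exact (add_eq_zero_iff_eq_neg'.1 this).trans (ZMod.neg_eq_self_mod_two _)
    have j0 : ∀ y, x (r (D.opp y)) = x (r y) := by
      intro y
      rcases hcase' y with rfl | rfl | rfl | rfl | ⟨y, rfl⟩
      · rw [oa, ra, ra']
      · rw [ob, rb, rb']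
      · rw [oa', ra, ra']
      · rw [ob', rb, rb']
      · rw [ro, rx, hxo]
    have j1 : ∀ y, D.next (D.next y) ≠ y → x (r y) + x (r (D.next y)) + x (r (D.next (D.next y))) +
        x (r (D.next (D.next (D.next y)))) = 0 := by
      intro y hy
      rcases hcase y with h | h | h | h | h | h | h | h | ⟨y, rfl, hs⟩
      · rw [h, ← na, nb, np, ra, rb, rp, rq]
        linear_combination zmod_two_add_self (x p) + zmod_two_add_self (x q)
      · rw [h, nb, np, nq, ra, rb, rp, rq]
        linear_combination zmod_two_add_self (x p) + zmod_two_add_self (x q)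
      · rw [h, np, nq, ← na, ra, rb, rp, rq]
        linear_combination zmod_two_add_self (x p) + zmod_two_add_self (x q)
      · rw [h, nq, ← na, nb, ra, rb, rp, rq]
        linear_combination zmod_two_add_self (x p) + zmod_two_add_self (x q)
      · rw [h, na', nq', np', ra', rb', rP, rQ, xp, xq]
        linear_combination zmod_two_add_self (x p) + zmod_two_add_self (x q)
      · rw [h, ← nb', na', nq', ra', rb', rP, rQ, xp, xq]
        linear_combination zmod_two_add_self (x p) + zmod_two_add_self (x q)
      · rw [h, np', ← nb', na', ra', rb', rP, rQ, xp, xq]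
        linear_combination zmod_two_add_self (x p) + zmod_two_add_self (x q)
      · rw [h, nq', np', ← nb', ra', rb', rP, rQ, xp, xq]
        linear_combination zmod_two_add_self (x p) + zmod_two_add_self (x q)
      · rw [← nn3 y hs, ← nn2 y hs, ← nn y hs, rx, rx, rx, rx]
        exact hx4 y (fun h => (cr y hs).1 h hy)
    have j2 : ∀ y, D.next (D.next y) = y → x (r y) + x (r (D.next y)) = 0 := by
      intro y hy
      obtain ⟨y, rfl, hs⟩ := hcase2 y (not_not.2 hy)
      rw [← nn y hs, rx, rx]
      exact hx2 y ((cr y hs).2 (not_not.2 hy))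
    obtain ⟨h, hh⟩ := D.jordanCurve (fun d => x (r d)) j0 j1 j2
    refine ⟨fun e => h e.1, fun e => ?_⟩
    have ea := hh a
    have eb := hh b
    have ep := hh p.1
    have eq := hh q.1
    have ea' := hh a'
    have eb' := hh b'
    have eP := hh P'.1
    have eQ := hh Q'.1
    rw [← na, ob, rb] at ea
    rw [nb, rp] at eb
    rw [np, rq] at ep
    rw [nq, oa, ra] at eq
    rw [na', rQ, xq] at ea'
    rw [← nb', oa', ra'] at eb'
    rw [np', ob', rb'] at eP
    rw [nq', rP, xp] at eQ
    obtain ⟨k1, k2, k3, k4⟩ := unpoke_corners ea eb ep eq ea' eP eQ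
    by_cases hs : sp e
    · rcases hs with rfl | rfl | rfl | rfl
      · rw [kp, xp]; exact k1
      · rw [kP]; exact k2
      · rw [kq, xq]; exact k3
      · rw [kQ]; exact k4
    · constructor
      · change h (D.opp (nx e).1) = h e.1
        rw [nn e hs, (hh e.1).1]
      · change h (nx e).1 + h e.1 = x (nx e)
        rw [nn e hs, (hh e.1).2, ← nn e hs, rx]
  have hrange : ∀ x, x ∈ Set.range (Subtype.val : {x // P x} → D.Dart) ↔ P x :=
    fun d => ⟨fun ⟨y, hy⟩ => hy ▸ y.2, fun h => ⟨⟨d, h⟩, rfl⟩⟩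
  have nx_ne : ∀ x, nx x ≠ x := by
    intro x h
    by_cases hs : sp x
    · rcases hs with rfl | rfl | rfl | rfl
      · exact pP (h.symm.trans kp)
      · exact pP (kP.symm.trans h)
      · exact qQ (h.symm.trans kq)
      · exact qQ (kQ.symm.trans h)
    · exact n1 _ ((nn x hs).symm.trans (congrArg Subtype.val h))
  have ov_nx : ∀ x, nx (nx x) ≠ x → D.isOver (nx x).1 = !(D.isOver x.1) := by
    intro x hx
    have hs : ¬ sp x := fun h => hx (ksp x h)
    rw [nn x hs]
    exact D.isOver_next _ (not_not.1 (fun h => hx ((cr x hs).2 h)))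
  have lift : ∀ {e y : {x // P x}}, nx e = y → (nx e).1 = y.1 := fun h => congrArg Subtype.val h
  refine ⟨ofJordanCurve nx op (fun x => D.isOver x.1) ⟨D.outer, ho⟩
    (fun x h => D.opp_ne _ (congrArg Subtype.val h)) (fun x => Subtype.ext (D.opp_opp _))
    nx_ne four ov_nx strand J, Subtype.val, Subtype.val_injective, hrange, fun _ => rfl,
    fun e he => ?_, fun e he => ?_, fun e he => ?_, fun e he => ?_, fun e he1 he2 he3 he4 => ?_,
    fun _ _ => rfl, Equiv.Perm.SameCycle.refl _ _⟩
  · obtain rfl : e = p := Subtype.ext he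
    exact lift kp
  · obtain rfl : e = P' := Subtype.ext he
    exact lift kP
  · obtain rfl : e = q := Subtype.ext he
    exact lift kq
  · obtain rfl : e = Q' := Subtype.ext he
    exact lift kQ
  · refine nn e ?_
    rintro (rfl | rfl | rfl | rfl)
    · exact he1 rfl
    · exact he2 rfl
    · exact he3 rfl
    · exact he4 rfl

end KnotDiagram

/-! ### Crossings and darts decrease. -/

namespace KnotDiagram

variable {D E : KnotDiagram}

theorem map_next_of_isCrossing {f : E.Dart → D.Dart}
    (hn : ∀ e, E.IsCrossing e → f (E.next e) = D.next (f e)) {e : E.Dart} (he : E.IsCrossing e) :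
    f (E.next e) = D.next (f e) ∧ f (E.next (E.next e)) = D.next (D.next (f e)) ∧
      f (E.next (E.next (E.next e))) = D.next (D.next (D.next (f e))) := by
  have h1 := (isCrossing_next e).2 he
  have h2 := (isCrossing_next _).2 h1
  rw [hn _ h2, hn _ h1, hn _ he]
  exact ⟨rfl, rfl, rfl⟩

theorem isCrossing_of_vert_eq {d d' : D.Dart} (h : D.vert d = D.vert d') (hd : D.IsCrossing d) :
    D.IsCrossing d' := by
  rw [vert_eq_iff] at h
  rcases h with rfl | rfl | rfl | rfl <;> simpa [isCrossing_next] using hd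

theorem isCrossing_map {f : E.Dart → D.Dart} (hinj : Function.Injective f)
    (hn : ∀ e, E.IsCrossing e → f (E.next e) = D.next (f e)) {e : E.Dart} (he : E.IsCrossing e) :
    D.IsCrossing (f e) := by
  have := (map_next_of_isCrossing hn he).2.1
  rw [IsCrossing, ← this, hinj.ne_iff]
  exact he

/-- The orbit of the image of a crossing is the image of its orbit. -/
theorem exists_vert_eq_of_map {f : E.Dart → D.Dart}
    (hn : ∀ e, E.IsCrossing e → f (E.next e) = D.next (f e)) {e : E.Dart} (he : E.IsCrossing e)
    {x : D.Dart} (hx : D.vert (f e) = D.vert x) : ∃ e', f e' = x ∧ E.vert e = E.vert e' := by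
  obtain ⟨h1, h2, h3⟩ := map_next_of_isCrossing hn he
  rw [vert_eq_iff] at hx
  rcases hx with rfl | rfl | rfl | rfl
  · exact ⟨e, rfl, rfl⟩
  · exact ⟨_, h1, by simp [vert_next]⟩
  · exact ⟨_, h2, by simp [vert_next]⟩
  · exact ⟨_, h3, by simp [vert_next]⟩

/-- Where rotations are respected, a whole crossing goes onto a whole crossing, and different ones
stay different. A crossing of `D` with an end outside the range is therefore missed. -/
theorem crossingNumber_le_and_lt {f : E.Dart → D.Dart} (hinj : Function.Injective f)
    (hn : ∀ e, E.IsCrossing e → f (E.next e) = D.next (f e)) :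
    E.crossingNumber ≤ D.crossingNumber ∧
      ∀ a, D.IsCrossing a → a ∉ Set.range f → E.crossingNumber < D.crossingNumber := by
  have := D.finite
  have : Finite D.Vertex := Quotient.finite _
  let F : E.Vertex → D.Vertex := fun v => D.vert (f v.out)
  have hout : ∀ v : E.Vertex, E.vert v.out = v := fun v => Quotient.out_eq v
  have hcr : ∀ v ∈ {v : E.Vertex | ∃ d, E.vert d = v ∧ E.IsCrossing d}, E.IsCrossing v.out := by
    rintro v ⟨d, rfl, hd⟩
    exact isCrossing_of_vert_eq (hout _).symm hd
  have hF : Set.InjOn F {v : E.Vertex | ∃ d, E.vert d = v ∧ E.IsCrossing d} := by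
    intro v hv w hw h
    obtain ⟨e', he', h'⟩ := exists_vert_eq_of_map hn (hcr v hv) h
    rw [← hout v, h', hinj he', hout]
  have hsub : F '' {v : E.Vertex | ∃ d, E.vert d = v ∧ E.IsCrossing d} ⊆
      {v : D.Vertex | ∃ d, D.vert d = v ∧ D.IsCrossing d} := by
    rintro _ ⟨v, hv, rfl⟩
    exact ⟨_, rfl, isCrossing_map hinj hn (hcr v hv)⟩
  rw [crossingNumber, crossingNumber, ← hF.ncard_image]
  refine ⟨Set.ncard_le_ncard hsub (Set.toFinite _), fun a ha har => ?_⟩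
  refine Set.ncard_lt_ncard (hsub.ssubset_of_mem_notMem (a := D.vert a) ⟨a, rfl, ha⟩ ?_)
    (Set.toFinite _)
  rintro ⟨v, hv, h⟩
  obtain ⟨e', he', -⟩ := exists_vert_eq_of_map hn (hcr v hv) h
  exact har ⟨e', he'⟩

theorem card_lt_of_notMem {f : E.Dart → D.Dart} (hinj : Function.Injective f) {a : D.Dart}
    (ha : a ∉ Set.range f) : Nat.card E.Dart < Nat.card D.Dart := by
  have := D.finite
  have := E.finite
  have h1 := Set.ncard_lt_ncard (s := Set.range f) (t := Set.univ)
    (Set.ssubset_univ_iff.2 fun h => ha (h ▸ Set.mem_univ a)) (Set.toFinite _)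
  rwa [Set.ncard_univ, ← Set.image_univ, Set.ncard_image_of_injective _ hinj,
    Set.ncard_univ] at h1

theorem RemoveSubdivision.card_lt (h : RemoveSubdivision D E) :
    Nat.card E.Dart < Nat.card D.Dart ∧ E.crossingNumber ≤ D.crossingNumber := by
  obtain ⟨a, f, ha, hloop, hinj, hrange, hn, ho1, ho2, ho3, hs, _⟩ := h
  exact ⟨card_lt_of_notMem hinj (a := a) fun h => ((hrange a).1 h).1 rfl,
    (crossingNumber_le_and_lt hinj fun e _ => hn e).1⟩

theorem Untwist.card_lt (h : Untwist D E) :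
    Nat.card E.Dart < Nat.card D.Dart ∧ E.crossingNumber < D.crossingNumber := by
  obtain ⟨a, b, c, d, f, ha, rfl, rfl, rfl, hab, hinj, hrange, ho, hn1, hn2, hs, _⟩ := h
  have har : a ∉ Set.range f := fun h => ((hrange a).1 h).1 rfl
  refine ⟨card_lt_of_notMem hinj har, (crossingNumber_le_and_lt hinj fun e he => ?_).2 a ha har⟩
  refine hn2 e fun h => he ?_
  have h1 := hn1 e h
  refine hinj ?_
  rw [hn2 _ (by rw [h1]; exact (D.next_ne _).symm), h1, h]

theorem IsUnpokeMap.map_next_of_isCrossing {a b p q a' b' p' q' : D.Dart} {f : E.Dart → D.Dart}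
    (M : IsUnpokeMap D E a b p q a' b' p' q' f) {e : E.Dart} (he : E.IsCrossing e) :
    f (E.next e) = D.next (f e) := by
  refine M.map_next e ?_ ?_ ?_ ?_ <;> refine fun h => he (M.injective ?_) <;> rw [h]
  · exact M.map_p' _ (M.map_p _ h)
  · exact M.map_p _ (M.map_p' _ h)
  · exact M.map_q' _ (M.map_q _ h)
  · exact M.map_q _ (M.map_q' _ h)

theorem IsUnpokeMap.card_lt {a b p q a' b' p' q' : D.Dart} {f : E.Dart → D.Dart}
    (M : IsUnpokeMap D E a b p q a' b' p' q' f) (ha : D.IsCrossing a) :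
    Nat.card E.Dart < Nat.card D.Dart ∧ E.crossingNumber < D.crossingNumber := by
  have har : a ∉ Set.range f := fun h => ((M.range a).1 h).1 rfl
  exact ⟨card_lt_of_notMem M.injective har,
    (crossingNumber_le_and_lt M.injective fun e he => M.map_next_of_isCrossing he).2 a ha har⟩

end KnotDiagram

/-! ### Tree models under the moves. -/

namespace KnotDiagram

variable {D E : KnotDiagram} {V : Type*} {k : ℕ} {T : SimpleGraph (Fin k)} {bag : Fin k → Set V}

/-- A labeling of the darts by their vertices, such that the labels of adjacent vertices share. -/
structure IsVertexLabeling (D : KnotDiagram) (share : V → V → Prop) (μ : D.Dart → V) : Prop where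
  label_next : ∀ d, μ (D.next d) = μ d
  vert_eq : ∀ d d', μ d = μ d' → D.vert d = D.vert d'
  share_opp : ∀ d, share (μ d) (μ (D.opp d))

/-- A labeling of the darts by crossings: a dart at a crossing is labeled by this crossing, and a
dart at a subdivision point by the crossing that is reached in the opposite direction. -/
structure IsCrossingLabeling (D : KnotDiagram) (share : V → V → Prop) (μ : D.Dart → V) : Prop where
  label_next : ∀ d, D.IsCrossing d → μ (D.next d) = μ d
  label_opp_next : ∀ d, ¬ D.IsCrossing d → μ d = μ (D.opp (D.next d))
  vert_eq : ∀ d d', D.IsCrossing d → D.IsCrossing d' → μ d = μ d' → D.vert d = D.vert d'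
  share_opp : ∀ d, share (μ d) (μ (D.opp d))

theorem IsCrossingLabeling.isVertexLabeling {share : V → V → Prop} {μ : D.Dart → V}
    (h : D.IsCrossingLabeling share μ) (hD : ∀ d, D.IsCrossing d) : D.IsVertexLabeling share μ :=
  ⟨fun d => h.label_next d (hD d), fun d d' => h.vert_eq d d' (hD d) (hD d'), h.share_opp⟩

/-- The crossings of the diagram can be arranged along a tree, with at most three of them in a bag,
as in a tree decomposition of width 2. -/
def HasTreeModel (D : KnotDiagram) : Prop :=
  ∃ (V : Type) (k : ℕ) (T : SimpleGraph (Fin k)) (bag : Fin k → Set V) (μ : D.Dart → V),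
    IsTreeModel T bag ∧ (D.IsVertexLabeling (ShareBag bag) μ ∨ D.IsCrossingLabeling (ShareBag bag) μ)

theorem hasTreeModel_of_treewidth_le (h : D.graph.treewidth ≤ 2) : D.HasTreeModel := by
  obtain ⟨k, T, bag, M, hv, he⟩ := exists_isTreeModel_of_treewidth_le h
  refine ⟨D.Vertex, k, T, bag, D.vert, M, Or.inl ⟨vert_next, fun _ _ => id, fun d => ?_⟩⟩
  by_cases hd : D.vert d = D.vert (D.opp d)
  · obtain ⟨i, hi⟩ := hv (D.vert d)
    exact ⟨i, hi, hd ▸ hi⟩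
  · refine he _ _ ?_
    rw [graph, SimpleGraph.fromRel_adj]
    exact ⟨hd, Or.inl ⟨d, rfl, rfl⟩⟩

theorem IsVertexLabeling.label_eq {share : V → V → Prop} {μ : D.Dart → V}
    (h : D.IsVertexLabeling share μ) {d d' : D.Dart} : μ d = μ d' ↔ D.vert d = D.vert d' := by
  refine ⟨h.vert_eq d d', fun h' => ?_⟩
  rw [vert_eq_iff] at h'
  rcases h' with rfl | rfl | rfl | rfl <;> simp [h.label_next]

theorem vert_eq_of_map {f : E.Dart → D.Dart} (hinj : Function.Injective f)
    (hn : ∀ e, f (E.next e) = D.next (f e)) {e e' : E.Dart} (h : D.vert (f e) = D.vert (f e')) :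
    E.vert e = E.vert e' := by
  rw [vert_eq_iff] at h ⊢
  simpa only [← hn, hinj.eq_iff] using h

/-- With labels by vertices, the removed point is contracted into a neighbor. With labels by
crossings nothing has to change, because labels already look through subdivision points. -/
theorem RemoveSubdivision.hasTreeModel (h : RemoveSubdivision D E) (hD : D.HasTreeModel) :
    E.HasTreeModel := by
  classical
  obtain ⟨V, k, T, bag, μ, M, hμ⟩ := hD
  obtain ⟨a, f, ha, hloop, hinj, hrange, hn, ho1, ho2, ho3, hs, _⟩ := h
  have haa : D.next (D.next a) = a := not_not.1 ha
  have hlb : D.opp (D.next a) ≠ a := fun h => hloop (by rw [← D.opp_opp (D.next a), h])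
  have hfr : ∀ e, f e ≠ a ∧ f e ≠ D.next a := fun e => (hrange _).1 ⟨e, rfl⟩
  rcases hμ with hμ | hμ
  · have hx : ∀ x, x ≠ a → x ≠ D.next a → μ x ≠ μ a := by
      intro x h1 h2 h
      have := hμ.vert_eq _ _ h.symm
      rw [vert_eq_iff] at this
      rw [haa] at this
      tauto
    have hsh := hμ.share_opp a
    refine ⟨V, k, T, _, fun e => μ (f e), M.contract hsh, Or.inl ⟨fun e => ?_, fun e e' h => ?_,
      fun e => ?_⟩⟩
    · rw [hn, hμ.label_next]
    · exact vert_eq_of_map hinj hn (hμ.vert_eq _ _ h)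
    · have h1 : (if μ (f e) = μ a then μ (D.opp a) else μ (f e)) = μ (f e) :=
        if_neg (hx _ (hfr e).1 (hfr e).2)
      have h2 : (if μ (f (E.opp e)) = μ a then μ (D.opp a) else μ (f (E.opp e))) = μ (f (E.opp e)) :=
        if_neg (hx _ (hfr _).1 (hfr _).2)
      by_cases k1 : D.opp (f e) = a
      · have := (hμ.share_opp (D.next a)).image (fun v => if v = μ a then μ (D.opp a) else v)
        rw [← ho2 e k1] at this
        simp only [h2] at this
        rw [hμ.label_next, if_pos rfl] at this
        have hfe : f e = D.opp a := by rw [← k1, D.opp_opp]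
        rw [hfe]
        exact this
      by_cases k2 : D.opp (f e) = D.next a
      · have h4 : f e = D.opp (D.next a) := by rw [← k2, D.opp_opp]
        have h3 := (hμ.share_opp (D.next a)).symm.image (fun v => if v = μ a then μ (D.opp a) else v)
        rw [← h4] at h3
        simp only [h1] at h3
        rw [hμ.label_next, if_pos rfl] at h3
        rw [ho3 e k2]
        exact h3
      · have := (hμ.share_opp (f e)).image (fun v => if v = μ a then μ (D.opp a) else v)
        rw [← ho1 e k1 k2] at this
        simp only [h1, h2] at this
        exact this
  · have hc : ∀ e, E.IsCrossing e ↔ D.IsCrossing (f e) := by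
      intro e
      simp only [IsCrossing, ← hn, ne_eq, hinj.eq_iff]
    have ha1 : μ a = μ (D.opp (D.next a)) := hμ.label_opp_next a ha
    have ha2 : μ (D.next a) = μ (D.opp a) := by
      have := hμ.label_opp_next (D.next a) (by rwa [isCrossing_next])
      rwa [haa] at this
    have key : ∀ e, μ (f (E.opp e)) = μ (D.opp (f e)) := by
      intro e
      by_cases k1 : D.opp (f e) = a
      · rw [ho2 e k1, k1, ha1]
      by_cases k2 : D.opp (f e) = D.next a
      · rw [ho3 e k2, k2, ha2]
      rw [ho1 e k1 k2]
    refine ⟨V, k, T, bag, fun e => μ (f e), M, Or.inr ⟨fun e he => ?_, fun e he => ?_,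
      fun e e' he he' h => ?_, fun e => ?_⟩⟩
    · rw [hn, hμ.label_next _ ((hc e).1 he)]
    · rw [key, hn]
      exact hμ.label_opp_next _ (fun h => he ((hc e).2 h))
    · exact vert_eq_of_map hinj hn (hμ.vert_eq _ _ ((hc e).1 he) ((hc e').1 he') h)
    · rw [key]
      exact hμ.share_opp _

theorem Untwist.hasTreeModel (h : Untwist D E) {V' : Type}
    {bag : Fin k → Set V'} (M : IsTreeModel T bag) {μ : D.Dart → V'}
    (hμ : D.IsVertexLabeling (ShareBag bag) μ) : E.HasTreeModel := by
  obtain ⟨a, b, c, d, f, ha, rfl, rfl, rfl, hab, hinj, hrange, ho, hn1, hn2, hs, _⟩ := h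
  have n1 := D.next_ne
  have n2 : D.next (D.next a) ≠ a := ha
  have n3 := next_three_ne a
  have n4 := D.next_four
  have n2' : D.next (D.next (D.next a)) ≠ D.next a := fun h => n2 (D.next.injective h)
  refine ⟨V', k, T, bag, fun e => μ (f e), M, Or.inl ⟨fun e => ?_, fun e e' h => ?_,
    fun e => by rw [ho]; exact hμ.share_opp _⟩⟩
  · by_cases hd : f e = D.next (D.next (D.next a))
    · rw [hn1 e hd, hd, hμ.label_next (D.next (D.next a))]
    · rw [hn2 e hd, hμ.label_next]
  · have hv := hμ.vert_eq _ _ h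
    obtain ⟨ec, hec⟩ := (hrange (D.next (D.next a))).2 ⟨n2, n1 _⟩
    obtain ⟨ed, hed⟩ := (hrange (D.next (D.next (D.next a)))).2 ⟨n3, n2'⟩
    have hcn : E.next ec = ed := hinj (by
      rw [hn2 ec (by rw [hec]; exact (n1 _).symm), hec, hed])
    have hva : ∀ x, D.vert a = D.vert (f x) → E.vert x = E.vert ec := by
      intro x hx
      rw [vert_eq_iff] at hx
      have := (hrange (f x)).1 ⟨x, rfl⟩
      rcases hx with h | h | h | h
      · exact absurd h this.1
      · exact absurd h this.2
      · rw [hinj (h.trans hec.symm)]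
      · rw [hinj (h.trans hed.symm), ← hcn, vert_next]
    by_cases hve : D.vert a = D.vert (f e)
    · rw [hva e hve, hva e' (hve.trans hv)]
    · have key : ∀ x, D.vert a ≠ D.vert (f x) → f (E.next x) = D.next (f x) := fun x hx =>
        hn2 x (fun h => hx (by rw [h]; simp [vert_next]))
      have k1 := key e hve
      have k2 := key (E.next e) (by rwa [k1, vert_next])
      have k3 := key (E.next (E.next e)) (by rwa [k2, k1, vert_next, vert_next])
      rw [vert_eq_iff] at hv ⊢
      rw [← k1, ← k2, ← k3] at hv
      simpa only [hinj.eq_iff] using hv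

/-- The assumption that `p'` and `q'` lead to a common vertex `y` makes this work. The two strands
then become edges from the far ends of `p` and `q` to `y`, exactly as if both crossings were
contracted into `y`. The new subdivision points mix the ends of the two crossings, which is why
labels by crossings are used. The hypothesis `h3'` ensures that the far ends of `p` and `q` are
crossings that survive. -/
theorem IsUnpokeMap.hasTreeModel {a b p q a' b' p' q' : D.Dart}
    (S : UnpokeSite D a b p q a' b' p' q') {f : E.Dart → D.Dart}
    (F : IsUnpokeMap D E a b p q a' b' p' q' f) (hD : ∀ d, D.IsCrossing d) {V : Type}
    {bag : Fin k → Set V} (M : IsTreeModel T bag) {μ : D.Dart → V}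
    (hμ : D.IsVertexLabeling (ShareBag bag) μ) (hpq : μ (D.opp p') = μ (D.opp q'))
    (h1 : μ (D.opp p') ≠ μ a) (h2 : μ (D.opp p') ≠ μ a') (h3' : D.opp p ≠ q) :
    E.HasTreeModel := by
  classical
  obtain ⟨⟨d01, d02, d03, d12, d13, d23⟩, ⟨e01, e02, e03, e12, e13, e23⟩, ⟨f0, f1, f2, f3⟩,
    ⟨g0, g1, g2, g3⟩, ⟨h0, h1', h2', h4'⟩, i0, i1, i2, i3⟩ := S.distinct
  have va : ∀ x, μ x = μ a ↔ x = a ∨ x = b ∨ x = p ∨ x = q := by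
    intro x
    rw [eq_comm, hμ.label_eq, vert_eq_iff, ← S.next_a, ← S.next_b, ← S.next_p]
  have va' : ∀ x, μ x = μ a' ↔ x = b' ∨ x = a' ∨ x = q' ∨ x = p' := by
    intro x
    have : μ a' = μ b' := by rw [S.next_b', hμ.label_next]
    rw [this, eq_comm, hμ.label_eq, vert_eq_iff, ← S.next_b', ← S.next_a', ← S.next_q']
  have mp : μ p = μ a := (va p).2 (by simp)
  have mq : μ q = μ a := (va q).2 (by simp)
  have mp' : μ p' = μ a' := (va' p').2 (by simp)
  have mq' : μ q' = μ a' := (va' q').2 (by simp)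
  have oinj : ∀ {x y}, D.opp x = y → D.opp y = x := fun h => by rw [← h, D.opp_opp]
  have oa' := oinj S.opp_a
  have ob' := oinj S.opp_b
  have h3 : μ (D.opp q) ≠ μ a := by
    rw [Ne, va]
    rintro (h | h | h | h) <;> have h := oinj h
    · exact i0 (h.symm.trans S.opp_a)
    · exact i1 (h.symm.trans S.opp_b)
    · exact h3' h
    · exact D.opp_ne _ h
  have ext_p : μ (D.opp p) ≠ μ a ∧ μ (D.opp p) ≠ μ a' := by
    rw [Ne, va, Ne, va']
    refine ⟨?_, ?_⟩
    · rintro (h | h | h | h)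
      · exact h0 ((oinj h).symm.trans S.opp_a)
      · exact h1' ((oinj h).symm.trans S.opp_b)
      · exact D.opp_ne _ h
      · exact h3' h
    · rintro (h | h | h | h) <;> have h := oinj h
      · exact d12 (ob'.symm.trans h)
      · exact d02 (oa'.symm.trans h)
      · exact h1 (by rw [hpq, h, mp])
      · exact h1 (by rw [h, mp])
  have ext_q : μ (D.opp q) ≠ μ a' := by
    rw [Ne, va']
    rintro (h | h | h | h) <;> have h := oinj h
    · exact d13 (ob'.symm.trans h)
    · exact d03 (oa'.symm.trans h)
    · exact h1 (by rw [hpq, h, mq])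
    · exact h1 (by rw [h, mq])
  set y := μ (D.opp p') with hy
  have hne : μ a ≠ μ a' := fun h => S.vert_ne (hμ.vert_eq _ _ h)
  have sh1 : ShareBag bag (μ a') y := mp' ▸ hμ.share_opp p'
  have M1 := M.contract sh1
  -- Once `μ a'` has been contracted into `y`, its neighbor `μ a` shares a bag with `y` and can be
  -- contracted too.
  have sh2 := (hμ.share_opp a).image (fun v => if v = μ a' then y else v)
  rw [S.opp_a, if_pos rfl, if_neg hne] at sh2
  have M2 := M1.contract sh2
  have hsh : ∀ {u w}, ShareBag bag u w → ShareBag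
      (fun i => (fun v => if v = μ a then y else v) ''
        ((fun v => if v = μ a' then y else v) '' bag i))
      (if (if u = μ a' then y else u) = μ a then y else (if u = μ a' then y else u))
      (if (if w = μ a' then y else w) = μ a then y else (if w = μ a' then y else w)) :=
    fun h => (h.image (fun v => if v = μ a' then y else v)).image
      (fun v => if v = μ a then y else v)
  have hout : ∀ u, u ≠ μ a → u ≠ μ a' →
      (if (if u = μ a' then y else u) = μ a then y else (if u = μ a' then y else u)) = u :=
    fun u k1 k2 => by rw [if_neg k2, if_neg k1]
  have hina : (if (if μ a = μ a' then y else μ a) = μ a then y else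
      (if μ a = μ a' then y else μ a)) = y := by rw [if_neg hne, if_pos rfl]
  have hina' : (if (if μ a' = μ a' then y else μ a') = μ a then y else
      (if μ a' = μ a' then y else μ a')) = y := by rw [if_pos rfl, if_neg h1]
  let ν : E.Dart → V := fun e => if f e = p ∨ f e = q then y else
    if f e = p' then μ (D.opp p) else if f e = q' then μ (D.opp q) else μ (f e)
  have νp : ∀ e, f e = p → ν e = y := fun e h => by simp [ν, h]
  have νq : ∀ e, f e = q → ν e = y := fun e h => by simp [ν, h]
  have νp' : ∀ e, f e = p' → ν e = μ (D.opp p) := fun e h => by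
    simp [ν, h, h2'.symm, i2.symm]
  have νq' : ∀ e, f e = q' → ν e = μ (D.opp q) := fun e h => by
    simp [ν, h, h4'.symm, i3.symm, e23]
  have νx : ∀ e, f e ≠ p → f e ≠ p' → f e ≠ q → f e ≠ q' → ν e = μ (f e) := fun e k1 k2 k3 k4 => by
    simp [ν, k1, k2, k3, k4]
  have νo : ∀ e, μ (f e) ≠ μ a → μ (f e) ≠ μ a' → ν e = μ (f e) := fun e k1 k2 => by
    refine νx e ?_ ?_ ?_ ?_ <;> intro h
    · exact k1 (h ▸ mp)
    · exact k2 (h ▸ mp')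
    · exact k1 (h ▸ mq)
    · exact k2 (h ▸ mq')
  have hcr : ∀ e, E.IsCrossing e → f e ≠ p ∧ f e ≠ p' ∧ f e ≠ q ∧ f e ≠ q' := by
    intro e he
    refine ⟨?_, ?_, ?_, ?_⟩ <;> refine fun h => he (F.injective ?_) <;> rw [h]
    · exact F.map_p' _ (F.map_p _ h)
    · exact F.map_p _ (F.map_p' _ h)
    · exact F.map_q' _ (F.map_q _ h)
    · exact F.map_q _ (F.map_q' _ h)
  have hνcr : ∀ e, E.IsCrossing e → ν e = μ (f e) := fun e he => by
    obtain ⟨k1, k2, k3, k4⟩ := hcr e he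
    exact νx e k1 k2 k3 k4
  have hout' : ∀ e, f e ≠ p → f e ≠ p' → f e ≠ q → f e ≠ q' → μ (f e) ≠ μ a ∧ μ (f e) ≠ μ a' := by
    intro e k1 k2 k3 k4
    obtain ⟨r1, r2, r3, r4⟩ := (F.range (f e)).1 ⟨e, rfl⟩
    rw [Ne, va, Ne, va']
    tauto
  have hsp : ∀ e, ¬ E.IsCrossing e → f e = p ∨ f e = p' ∨ f e = q ∨ f e = q' := by
    intro e he
    by_contra hcon
    push Not at hcon
    obtain ⟨k1, k2, k3, k4⟩ := hcon
    have hm := hout' e k1 k2 k3 k4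
    have e1 := F.map_next e k1 k2 k3 k4
    have hm' : μ (f (E.next e)) ≠ μ a ∧ μ (f (E.next e)) ≠ μ a' := by
      rw [e1, hμ.label_next]; exact hm
    have e2 := F.map_next (E.next e) (fun h => hm'.1 (h ▸ mp)) (fun h => hm'.2 (h ▸ mp'))
      (fun h => hm'.1 (h ▸ mq)) (fun h => hm'.2 (h ▸ mq'))
    rw [not_not.1 he, e1] at e2
    exact hD (f e) e2.symm
  have oq' : μ (D.opp q') = y := hpq.symm
  have νop : ∀ e, f e = D.opp p → ν e = μ (D.opp p) := fun e h => by
    rw [νo e (by rw [h]; exact ext_p.1) (by rw [h]; exact ext_p.2), h]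
  have νoq : ∀ e, f e = D.opp q → ν e = μ (D.opp q) := fun e h => by
    rw [νo e (by rw [h]; exact h3) (by rw [h]; exact ext_q), h]
  have νop' : ∀ e, f e = D.opp p' → ν e = y := fun e h => by
    rw [νo e (by rw [h]; exact h1) (by rw [h]; exact h2), h]
  have νoq' : ∀ e, f e = D.opp q' → ν e = y := fun e h => by
    rw [νo e (by rw [h, oq']; exact h1) (by rw [h, oq']; exact h2), h, oq']
  have shp := hsh (hμ.share_opp p)
  rw [mp, hina, hout _ ext_p.1 ext_p.2] at shp
  have shq := hsh (hμ.share_opp q)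
  rw [mq, hina, hout _ h3 ext_q] at shq
  refine ⟨V, k, T, _, ν, M2, Or.inr ⟨fun e he => ?_, fun e he => ?_, fun e e' he he' h => ?_,
    fun e => ?_⟩⟩
  · rw [hνcr e he, hνcr _ ((isCrossing_next e).2 he), F.map_next_of_isCrossing he, hμ.label_next]
  · rcases hsp e he with h | h | h | h
    · rw [νp e h, νop' _ (by rw [F.map_opp, F.map_p e h])]
    · rw [νp' e h, νop _ (by rw [F.map_opp, F.map_p' e h])]
    · rw [νq e h, νoq' _ (by rw [F.map_opp, F.map_q e h])]
    · rw [νq' e h, νoq _ (by rw [F.map_opp, F.map_q' e h])]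
  · rw [hνcr e he, hνcr e' he'] at h
    obtain ⟨e'', h1, h2⟩ := exists_vert_eq_of_map (f := f) (fun e he => F.map_next_of_isCrossing he)
      he (hμ.vert_eq _ _ h)
    rw [h2, F.injective h1]
  · have hspec : ∀ e, (f e = p ∨ f e = p' ∨ f e = q ∨ f e = q') → ShareBag
        (fun i => (fun v => if v = μ a then y else v) ''
          ((fun v => if v = μ a' then y else v) '' bag i)) (ν e) (ν (E.opp e)) := by
      rintro e (h | h | h | h)
      · rw [νp e h, νop (E.opp e) (by rw [F.map_opp, h])]; exact shp
      · rw [νp' e h, νop' (E.opp e) (by rw [F.map_opp, h])]; exact shp.symm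
      · rw [νq e h, νoq (E.opp e) (by rw [F.map_opp, h])]; exact shq
      · rw [νq' e h, νoq' (E.opp e) (by rw [F.map_opp, h])]; exact shq.symm
    by_cases hs : f e = p ∨ f e = p' ∨ f e = q ∨ f e = q'
    · exact hspec e hs
    by_cases hs' : f (E.opp e) = p ∨ f (E.opp e) = p' ∨ f (E.opp e) = q ∨ f (E.opp e) = q'
    · have := (hspec _ hs').symm
      rwa [E.opp_opp] at this
    push Not at hs hs'
    obtain ⟨k1, k2, k3, k4⟩ := hs
    obtain ⟨k1', k2', k3', k4'⟩ := hs'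
    have hm := hout' e k1 k2 k3 k4
    have hm' := hout' _ k1' k2' k3' k4'
    have := hsh (hμ.share_opp (f e))
    rw [← F.map_opp, hout _ hm.1 hm.2, hout _ hm'.1 hm'.2] at this
    rw [νx e k1 k2 k3 k4, νx _ k1' k2' k3' k4']
    exact this

end KnotDiagram

/-! ### Cyclic numbering of a face, and the coloring of an alternating twist face. -/

/-- The orbit of `u`, with a cyclic numbering. -/
theorem exists_cyclic_numbering {α : Type*} [Finite α] {φ : α → α} (hφ : Function.Injective φ)
    (u : α) : ∃ (F : Set α) (m : ℕ) (k : α → ZMod m), u ∈ F ∧ (∀ c ∈ F, φ c ∈ F) ∧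
      (∀ c ∈ F, ∃ c' ∈ F, φ c' = c) ∧
      (∀ G : Set α, φ u ∈ G → (∀ c ∈ G, c ≠ u → φ c ∈ G) → F ⊆ G) ∧
      (∀ c ∈ F, k (φ c) = k c + 1) ∧ k u = 0 ∧ (φ u ≠ u → m ≠ 1) := by
  classical
  set m := Function.minimalPeriod φ u with hm
  have hpos : 0 < m := Function.minimalPeriod_pos_of_mem_periodicPts
    (Function.Injective.mem_periodicPts hφ u)
  have hper : φ^[m] u = u := Function.iterate_minimalPeriod
  have hwd : ∀ i j, φ^[i] u = φ^[j] u → (i : ZMod m) = j := by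
    intro i j h
    rw [ZMod.natCast_eq_natCast_iff']
    refine Function.iterate_injOn_Iio_minimalPeriod (Nat.mod_lt i hpos) (Nat.mod_lt j hpos) ?_
    simpa only [hm, Function.iterate_mod_minimalPeriod_eq] using h
  -- The shift by one starts the orbit at `φ u` with `u` as its last element; induction along the
  -- chain then never needs the step from `u`.
  let F : Set α := {c | ∃ i, φ^[i + 1] u = c}
  have huF : u ∈ F := ⟨m - 1, by rw [Nat.sub_add_cancel hpos, hper]⟩
  have hk : ∀ c : α, ∃ z : ZMod m, ∀ i, φ^[i] u = c → z = i := by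
    intro c
    by_cases h : ∃ i, φ^[i] u = c
    · obtain ⟨i, hi⟩ := h
      exact ⟨i, fun j hj => hwd _ _ (hi.trans hj.symm)⟩
    · exact ⟨0, fun i hi => absurd ⟨i, hi⟩ h⟩
  choose k hk using hk
  refine ⟨F, m, k, huF, ?_, ?_, ?_, ?_, ?_, ?_⟩
  · rintro _ ⟨i, rfl⟩
    exact ⟨i + 1, Function.iterate_succ_apply' _ _ _⟩
  · rintro _ ⟨i, rfl⟩
    cases i with
    | zero => exact ⟨u, huF, rfl⟩
    | succ i => exact ⟨φ^[i + 1] u, ⟨i, rfl⟩, (Function.iterate_succ_apply' _ _ _).symm⟩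
  · rintro G hu hG _ ⟨i, rfl⟩
    induction i with
    | zero => exact hu
    | succ i ih =>
      rw [Function.iterate_succ_apply']
      by_cases h : φ^[i + 1] u = u
      · rw [h]; exact hu
      · exact hG _ ih h
  · rintro _ ⟨i, rfl⟩
    rw [hk _ (i + 1) rfl, hk _ (i + 2) (Function.iterate_succ_apply' _ _ _)]
    push_cast
    ring
  · simpa using hk u 0 rfl
  · intro h h1
    rw [h1] at hper
    exact h hper

namespace KnotDiagram

variable {D E : KnotDiagram}

/-- A face `F` of a diagram without subdivision points, with corners at different crossings, all of
whose edges except that of `u` are adjacent to bigons. -/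
structure IsTwistFace (D : KnotDiagram) (F : Set D.Dart) (u : D.Dart) : Prop where
  mem : u ∈ F
  next_opp_mem : ∀ c ∈ F, D.next (D.opp c) ∈ F
  exists_next_opp : ∀ c ∈ F, ∃ c' ∈ F, D.next (D.opp c') = c
  subset : ∀ G : Set D.Dart, D.next (D.opp u) ∈ G →
    (∀ c ∈ G, c ≠ u → D.next (D.opp c) ∈ G) → F ⊆ G
  bigon : ∀ c ∈ F, c ≠ u → D.next (D.opp (D.next c)) = D.opp c
  vert_inj : ∀ c ∈ F, ∀ c' ∈ F, D.vert c = D.vert c' → c = c'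

theorem _root_.CrossingRelation.const {R : Type*} [CommRing R] {x : D.Dart} {g : D.Dart → R} {K : R}
    (h0 : g x = K) (h1 : g (D.next x) = K) (h2 : g (D.next (D.next x)) = K)
    (h3 : g (D.next (D.next (D.next x))) = K) : CrossingRelation D.next D.isOver g x := by
  rw [CrossingRelation, h0, h1, h2, h3]
  exact ⟨fun _ => ⟨rfl, by ring⟩, fun _ => ⟨rfl, by ring⟩⟩

/-- An alternating twist face gives a nonconstant Fox coloring modulo its length. -/
theorem IsTwistFace.isColorable {F : Set D.Dart} {u : D.Dart} (H : IsTwistFace D F u)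
    (hD : ∀ d, D.IsCrossing d) {m : ℕ} (hm : m ≠ 1) {k : D.Dart → ZMod m}
    (hk : ∀ c ∈ F, k (D.next (D.opp c)) = k c + 1) (hku : k u = 0)
    (halt : ∀ c ∈ F, c ≠ u → D.isOver c ≠ D.isOver (D.opp c)) : D.IsColorable m := by
  classical
  have n1 := D.next_ne
  have n2 : ∀ d, D.next (D.next d) ≠ d := hD
  have n3 := fun d => next_three_ne (D := D) d
  have n4 := D.next_four
  -- The level changes along the edge of `c` by alternation and changes back at the turn to the next
  -- edge.
  obtain ⟨B, hB⟩ : ∃ B, ∀ c ∈ F, D.isOver c = B := by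
    refine ⟨D.isOver (D.next (D.opp u)), fun c hc => (H.subset
      {c | c ∈ F ∧ D.isOver c = D.isOver (D.next (D.opp u))}
      ⟨H.next_opp_mem u H.mem, rfl⟩ ?_ hc).2⟩
    rintro c ⟨hc, hc'⟩ hcu
    refine ⟨H.next_opp_mem c hc, ?_⟩
    rw [← hc', D.isOver_next _ (hD _)]
    have := halt c hc hcu
    revert this
    cases D.isOver c <;> cases D.isOver (D.opp c) <;> simp
  have h01 : (0 : ZMod m) ≠ 1 := by
    intro h
    have : ((1 : ℕ) : ZMod m) = 0 := by push_cast; exact h.symm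
    rw [ZMod.natCast_eq_zero_iff] at this
    exact hm (Nat.dvd_one.1 this)
  -- The four ends at the corner `c` are to have colors `k c + s0`, ..., `k c + s3`. The first two
  -- equations match colors along the edge of `c` and along the other side of its bigon, and the
  -- last two are the crossing relation.
  obtain ⟨s0, s1, s2, s3, e03, e12, hs, hBt, hBf⟩ : ∃ s0 s1 s2 s3 : ZMod m, s0 = s3 + 1 ∧
      s1 = s2 + 1 ∧ s0 ≠ s1 ∧ (B = true → s2 = s0 ∧ s1 + s3 = 2 * s0) ∧
      (B = false → s3 = s1 ∧ s0 + s2 = 2 * s1) := by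
    cases B
    · exact ⟨2, 1, 0, 1, by norm_num, by norm_num, fun h => h01 (by linear_combination -h),
        by simp, fun _ => ⟨rfl, by norm_num⟩⟩
    · exact ⟨1, 2, 1, 0, by norm_num, by norm_num, fun h => h01 (by linear_combination h),
        fun _ => ⟨rfl, by norm_num⟩, by simp⟩
  have hg : ∀ x, ∃ z : ZMod m, (∀ c ∈ F, (x = c → z = k c + s0) ∧ (x = D.next c → z = k c + s1) ∧
      (x = D.next (D.next c) → z = k c + s2) ∧
      (x = D.next (D.next (D.next c)) → z = k c + s3)) ∧
      ((∀ c ∈ F, D.vert c ≠ D.vert x) → z = s1) := by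
    intro x
    by_cases hx : ∃ c ∈ F, D.vert c = D.vert x
    · obtain ⟨c, hc, hcx⟩ := hx
      have huniq : ∀ c' ∈ F, D.vert c' = D.vert x → c' = c := fun c' hc' h =>
        H.vert_inj c' hc' c hc (h.trans hcx.symm)
      have hz : ∀ z, ((x = c → z = k c + s0) ∧ (x = D.next c → z = k c + s1) ∧
          (x = D.next (D.next c) → z = k c + s2) ∧
          (x = D.next (D.next (D.next c)) → z = k c + s3)) → _ := fun z h =>
        (⟨z, fun c' hc' => ⟨fun h' => by
          obtain rfl := huniq c' hc' (by rw [h']); exact h.1 h', fun h' => by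
          obtain rfl := huniq c' hc' (by simp [h', vert_next]); exact h.2.1 h', fun h' => by
          obtain rfl := huniq c' hc' (by simp [h', vert_next]); exact h.2.2.1 h', fun h' => by
          obtain rfl := huniq c' hc' (by simp [h', vert_next]); exact h.2.2.2 h'⟩,
          fun h' => absurd hcx (h' c hc)⟩ : ∃ z : ZMod m, (∀ c ∈ F, (x = c → z = k c + s0) ∧
            (x = D.next c → z = k c + s1) ∧ (x = D.next (D.next c) → z = k c + s2) ∧
            (x = D.next (D.next (D.next c)) → z = k c + s3)) ∧
            ((∀ c ∈ F, D.vert c ≠ D.vert x) → z = s1))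
      rw [vert_eq_iff] at hcx
      rcases hcx with rfl | rfl | rfl | rfl
      · exact hz (k x + s0) ⟨fun _ => rfl, fun h => absurd h.symm (n1 _),
          fun h => absurd h.symm (n2 _), fun h => absurd h.symm (n3 _)⟩
      · exact hz (k c + s1) ⟨fun h => absurd h (n1 _), fun _ => rfl,
          fun h => absurd h.symm (n1 _), fun h => absurd h.symm (n2 _)⟩
      · exact hz (k c + s2) ⟨fun h => absurd h (n2 _), fun h => absurd h (n1 _), fun _ => rfl,
          fun h => absurd h.symm (n1 _)⟩
      · exact hz (k c + s3) ⟨fun h => absurd h (n3 _), fun h => absurd h (n2 _),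
          fun h => absurd h (n1 _), fun _ => rfl⟩
    · push Not at hx
      refine ⟨s1, fun c hc => ⟨fun h => ?_, fun h => ?_, fun h => ?_, fun h => ?_⟩, fun _ => rfl⟩ <;>
        exact absurd (by simp [h, vert_next]) (hx c hc)
  choose g hg using hg
  have g0 : ∀ c ∈ F, g c = k c + s0 := fun c hc => ((hg _).1 c hc).1 rfl
  have g1 : ∀ c ∈ F, g (D.next c) = k c + s1 := fun c hc => ((hg _).1 c hc).2.1 rfl
  have g2 : ∀ c ∈ F, g (D.next (D.next c)) = k c + s2 := fun c hc => ((hg _).1 c hc).2.2.1 rfl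
  have g3 : ∀ c ∈ F, g (D.next (D.next (D.next c))) = k c + s3 := fun c hc =>
    ((hg _).1 c hc).2.2.2 rfl
  have gx : ∀ x, (∀ c ∈ F, D.vert c ≠ D.vert x) → g x = s1 := fun x => (hg x).2
  have o3 : ∀ c, D.opp c = D.next (D.next (D.next (D.next (D.opp c)))) := fun c => (n4 _).symm
  have o2 : ∀ c ∈ F, c ≠ u → D.opp (D.next c) = D.next (D.next (D.next (D.opp c))) :=
    fun c hc hcu => by rw [← H.bigon c hc hcu, n4]
  have go0 : ∀ c ∈ F, g (D.opp c) = g c := fun c hc => by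
    rw [o3, g3 _ (H.next_opp_mem c hc), g0 c hc, hk c hc, e03]; ring
  have go1 : ∀ c ∈ F, c ≠ u → g (D.opp (D.next c)) = g (D.next c) := fun c hc hcu => by
    rw [o2 c hc hcu, g2 _ (H.next_opp_mem c hc), g1 c hc, hk c hc, e12]; ring
  let N : D.Dart → Prop := fun x => ∃ c ∈ F, x = c ∨ x = D.opp c ∨
    (c ≠ u ∧ (x = D.next c ∨ x = D.opp (D.next c)))
  have hN : ∀ x, N x → N (D.opp x) ∧ g (D.opp x) = g x := by
    rintro x ⟨c, hc, rfl | rfl | ⟨hcu, rfl | rfl⟩⟩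
    · exact ⟨⟨x, hc, Or.inr (Or.inl rfl)⟩, go0 x hc⟩
    · rw [D.opp_opp]
      exact ⟨⟨c, hc, Or.inl rfl⟩, (go0 c hc).symm⟩
    · exact ⟨⟨c, hc, Or.inr (Or.inr ⟨hcu, Or.inr rfl⟩)⟩, go1 c hc hcu⟩
    · rw [D.opp_opp]
      exact ⟨⟨c, hc, Or.inr (Or.inr ⟨hcu, Or.inl rfl⟩)⟩, (go1 c hc hcu).symm⟩
  -- The rest of the diagram has color `s1`. So do the two free ends of the chain: `next u`, where
  -- `k = 0`, and the end at the crossing after `u`, where `k = 1`.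
  have hN' : ∀ x, ¬ N x → g x = s1 := by
    intro x hx
    by_cases hcx : ∃ c ∈ F, D.vert c = D.vert x
    · obtain ⟨c, hc, hcx⟩ := hcx
      obtain ⟨c', hc', rfl⟩ := H.exists_next_opp c hc
      rw [vert_eq_iff] at hcx
      rcases hcx with rfl | rfl | rfl | rfl
      · exact absurd ⟨_, hc, Or.inl rfl⟩ hx
      · by_cases hcu : D.next (D.opp c') = u
        · rw [g1 _ hc, hcu, hku, zero_add]
        · exact absurd ⟨_, hc, Or.inr (Or.inr ⟨hcu, Or.inl rfl⟩)⟩ hx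
      · by_cases hcu : c' = u
        · rw [g2 _ hc, hk c' hc', hcu, hku, e12]; ring
        · exact absurd ⟨c', hc', Or.inr (Or.inr ⟨hcu, Or.inr (o2 c' hc' hcu).symm⟩)⟩ hx
      · exact absurd ⟨c', hc', Or.inr (Or.inl (n4 _))⟩ hx
    · push Not at hcx
      exact gx x hcx
  refine ⟨g, ⟨fun d => ?_, fun d hd => absurd (hD d) hd, fun d _ => ?_⟩, u, D.next u, ?_⟩
  · by_cases hd : N d
    · exact (hN d hd).2
    · have : ¬ N (D.opp d) := fun h => hd (by simpa [D.opp_opp] using (hN _ h).1)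
      rw [hN' d hd, hN' _ this]
  · by_cases hcx : ∃ c ∈ F, D.vert c = D.vert d
    · obtain ⟨c, hc, hcx⟩ := hcx
      rw [vert_eq_iff] at hcx
      refine crossing_rotate (hD c) ⟨fun h => ?_, fun h => ?_⟩ hcx
      · obtain ⟨h1, h2⟩ := hBt ((hB c hc).symm.trans h)
        rw [g0 c hc, g1 c hc, g2 c hc, g3 c hc]
        exact ⟨by rw [h1], by linear_combination h2⟩
      · obtain ⟨h1, h2⟩ := hBf ((hB c hc).symm.trans h)
        rw [g0 c hc, g1 c hc, g2 c hc, g3 c hc]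
        exact ⟨by rw [h1], by linear_combination h2⟩
    · push Not at hcx
      exact CrossingRelation.const (gx d hcx) (gx _ (by simpa [vert_next] using hcx))
        (gx _ (by simpa [vert_next] using hcx)) (gx _ (by simpa [vert_next] using hcx))
  · rw [g0 u H.mem, g1 u H.mem]
    exact fun h => hs (add_left_cancel h)

end KnotDiagram

/-! ### The reduction step and the induction. -/

namespace KnotDiagram

variable {D E : KnotDiagram}

theorem IsVertexLabeling.fourRegular {V : Type*} {share : V → V → Prop} {μ : D.Dart → V}
    (hμ : D.IsVertexLabeling share μ) (hD : ∀ d, D.IsCrossing d) : FourRegular D.next μ where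
  four := D.next_four
  ne_one := D.next_ne
  ne_two := hD
  label_next := hμ.label_next
  eq_of_label d d' h := by
    have := hμ.vert_eq _ _ h.symm
    rwa [vert_eq_iff] at this

theorem IsVertexLabeling.planarPiece {V : Type*} {share : V → V → Prop} {μ : D.Dart → V}
    (hμ : D.IsVertexLabeling share μ) (hD : ∀ d, D.IsCrossing d) [Fintype D.Dart] :
    PlanarPiece D.next μ share Finset.univ D.opp D.outer where
  next_mem _ _ := Finset.mem_univ _
  opp_mem _ _ := Finset.mem_univ _
  opp_opp d _ := D.opp_opp d
  opp_ne d _ := D.opp_ne d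
  root_mem := Finset.mem_univ _
  share_opp d _ := hμ.share_opp d
  jordan x h1 h2 := by
    obtain ⟨h, hh⟩ := D.jordanCurve x (fun d => h1 d (Finset.mem_univ _))
      (fun d _ => h2 d (Finset.mem_univ _)) (fun d hd => absurd hd (hD d))
    refine ⟨h, fun d _ => ?_⟩
    have := hh (D.next (D.next (D.next d)))
    rwa [D.next_four] at this

/-- In a diagram of treewidth 2 without subdivision points there is a twist face away from a given
edge. -/
theorem IsVertexLabeling.exists_isTwistFace {V : Type*} {k : ℕ} {T : SimpleGraph (Fin k)}
    {bag : Fin k → Set V} (M : IsTreeModel T bag) {μ : D.Dart → V}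
    (hμ : D.IsVertexLabeling (ShareBag bag) μ) (hD : ∀ d, D.IsCrossing d) :
    ∃ F u m, ∃ k : D.Dart → ZMod m, IsTwistFace D F u ∧
      (∀ c ∈ F, c ≠ D.outer ∧ D.opp c ≠ D.outer) ∧
      (∀ c ∈ F, c ≠ u → D.next c ≠ D.outer ∧ D.opp (D.next c) ≠ D.outer) ∧
      (∀ c ∈ F, k (D.next (D.opp c)) = k c + 1) ∧ k u = 0 ∧ (D.next (D.opp u) ≠ u → m ≠ 1) := by
  classical
  have := D.finite
  have := Fintype.ofFinite D.Dart
  obtain ⟨G, u, hu, h1, h2, h3⟩ := (hμ.planarPiece hD).hasTwistFace (hμ.fourRegular hD)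
    M.simplicialCover
  -- Only the orbit of `u` in the given invariant set is kept, which makes `F` a single face.
  obtain ⟨F, m, k, f1, f2, f3, f4, f5, f6, f7⟩ := exists_cyclic_numbering
    (φ := fun d => D.next (D.opp d)) (D.next.injective.comp D.opp.injective) u
  have hFG : F ⊆ G := f4 G (h1 u hu).2.2.2 fun c hc _ => (h1 c hc).2.2.2
  have hopp : ∀ {x}, x ≠ D.opp D.outer → D.opp x ≠ D.outer := fun h h' =>
    h (by rw [← h', D.opp_opp])
  exact ⟨F, u, m, k, ⟨f1, f2, f3, f4, fun c hc hcu => (h2 c (hFG hc) hcu).1,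
    fun c hc c' hc' h => h3 c (hFG hc) c' (hFG hc') (hμ.label_eq.2 h)⟩,
    fun c hc => ⟨(h1 c (hFG hc)).2.1, hopp (h1 c (hFG hc)).2.2.1⟩,
    fun c hc hcu => ⟨(h2 c (hFG hc) hcu).2.1, hopp (h2 c (hFG hc) hcu).2.2⟩, f5, f6, f7⟩

/-- The whole strand cannot pass through two crossings only twice, on opposite sides. -/
theorem IsTwistFace.next_opp_next_opp_ne {F : Set D.Dart} {u : D.Dart} (H : IsTwistFace D F u)
    (hD : ∀ d, D.IsCrossing d) {c : D.Dart} (hc : c ∈ F) (hcu : c ≠ u)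
    (h1 : D.next (D.opp c) = u) : D.next (D.opp u) ≠ c := by
  intro h2
  have n4 := D.next_four
  have hvu : D.vert c ≠ D.vert u := fun h => hcu (H.vert_inj c hc u H.mem h)
  have ou : D.opp u = D.next (D.next (D.next c)) := by rw [← h2, n4]
  have oc : D.opp (D.next c) = D.next (D.next u) := by
    rw [← h1, ← H.bigon c hc hcu, n4]
  have ou' : D.opp (D.next (D.next (D.next c))) = u := by rw [← ou, D.opp_opp]
  have oc' : D.opp (D.next (D.next u)) = D.next c := by rw [← oc, D.opp_opp]
  -- A closed strand that passes straight through both crossings and misses `c`.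
  let P : D.Dart → Prop := fun x => x = D.next c ∨ x = D.next (D.next (D.next c)) ∨
    x = u ∨ x = D.next (D.next u)
  have hopp : ∀ x, P x → P (D.opp x) := by
    rintro x (rfl | rfl | rfl | rfl) <;> simp [P, oc, ou, oc', ou']
  have hnn : ∀ x, P x → P (D.next (D.next x)) := by
    rintro x (rfl | rfl | rfl | rfl) <;> simp [P, n4]
  have := eq_of_eqvGen (f := P) ?_ (D.one_strand u c)
  · have hPc : P c := this ▸ Or.inr (Or.inr (Or.inl rfl))
    rcases hPc with h | h | h | h
    · exact D.next_ne _ h.symm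
    · exact next_three_ne _ h.symm
    · exact hcu h
    · exact hvu (by rw [h, vert_next, vert_next])
  · rintro x y (rfl | ⟨h, rfl⟩ | ⟨h, rfl⟩)
    · exact propext ⟨hopp x, fun h => by simpa [D.opp_opp] using hopp _ h⟩
    · exact absurd h (hD x)
    · exact propext ⟨hnn x, fun h => by simpa [n4] using hnn _ h⟩

theorem UnpokeSite.exists_unpoke {a b p q a' b' p' q' : D.Dart}
    (S : UnpokeSite D a b p q a' b' p' q')
    (ho : D.outer ≠ a ∧ D.outer ≠ b ∧ D.outer ≠ a' ∧ D.outer ≠ b')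
    (hD : ∀ d, D.IsCrossing d) {V : Type} {k : ℕ} {T : SimpleGraph (Fin k)} {bag : Fin k → Set V}
    (M : IsTreeModel T bag) {μ : D.Dart → V} (hμ : D.IsVertexLabeling (ShareBag bag) μ)
    (hpq : μ (D.opp p') = μ (D.opp q')) (h1 : μ (D.opp p') ≠ μ a) (h2 : μ (D.opp p') ≠ μ a')
    (h3 : D.opp p ≠ q) :
    ∃ E, Unpoke D E ∧ E.HasTreeModel ∧ Nat.card E.Dart < Nat.card D.Dart ∧
      E.crossingNumber < D.crossingNumber := by
  obtain ⟨E, f, F⟩ := S.exists_isUnpokeMap ho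
  exact ⟨E, S.unpoke F, F.hasTreeModel S hD M hμ hpq h1 h2 h3, F.card_lt (hD a)⟩

/-- If the two strands of some bigon along a twist face do not alternate, they can be pulled apart. -/
theorem IsTwistFace.exists_unpoke {F : Set D.Dart} {u : D.Dart} (H : IsTwistFace D F u)
    (hD : ∀ d, D.IsCrossing d) {V : Type} {k : ℕ} {T : SimpleGraph (Fin k)} {bag : Fin k → Set V}
    (M : IsTreeModel T bag) {μ : D.Dart → V} (hμ : D.IsVertexLabeling (ShareBag bag) μ)
    {c : D.Dart} (hc : c ∈ F) (hcu : c ≠ u) (ho : D.isOver c = D.isOver (D.opp c))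
    (o1 : c ≠ D.outer ∧ D.opp c ≠ D.outer) (o2 : D.next c ≠ D.outer ∧ D.opp (D.next c) ≠ D.outer) :
    ∃ E, Unpoke D E ∧ E.HasTreeModel ∧ Nat.card E.Dart < Nat.card D.Dart ∧
      E.crossingNumber < D.crossingNumber := by
  have n4 := D.next_four
  have hb := H.bigon c hc hcu
  have hc1 := H.next_opp_mem c hc
  obtain ⟨c0, hc0, h0⟩ := H.exists_next_opp c hc
  have hvinj : ∀ x ∈ F, ∀ y ∈ F, μ x = μ y → x = y := fun x hx y hy h =>
    H.vert_inj x hx y hy (hμ.vert_eq _ _ h)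
  have hopp : ∀ x, μ (D.opp x) = μ (D.next (D.opp x)) := fun x => (hμ.label_next _).symm
  -- A fixed corner other than `u` could not be reached from `u`.
  have fixed : ∀ x ∈ F, D.next (D.opp x) = x → x = u := by
    intro x hx h
    by_contra hxu
    have : F ⊆ {y | y ∈ F ∧ y ≠ x} := by
      refine H.subset _ ⟨H.next_opp_mem u H.mem, fun h' => hxu ?_⟩ ?_
      · exact D.opp.injective (D.next.injective (h.trans h'.symm))
      · rintro y ⟨hy, hyx⟩ -
        exact ⟨H.next_opp_mem y hy, fun h' => hyx
          (D.opp.injective (D.next.injective (h'.trans h.symm)))⟩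
    exact (this hx).2 rfl
  have hc1c : D.next (D.opp c) ≠ c := fun h => hcu (fixed c hc h)
  have hc0c : c0 ≠ c := fun h => hc1c (by rw [← h]; rw [h0, h])
  have oc : D.opp c0 = D.next (D.next (D.next c)) := by rw [← h0, n4]
  have hvne : D.vert c ≠ D.vert (D.opp c) := fun h => hc1c
    (H.vert_inj _ hc1 _ hc (by rw [vert_next, h]))
  -- The neighboring bigon supplies the common vertex of `p'` and `q'`. If the chain ends after `c`,
  -- it is the bigon before `c`, with the two crossings in exchanged roles; otherwise it is the
  -- bigon after.
  by_cases hc1u : D.next (D.opp c) = u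
  · have hc0u : c0 ≠ u := by
      rintro rfl
      exact H.next_opp_next_opp_ne hD hc hcu hc1u h0
    have S : UnpokeSite D (D.opp (D.next c)) (D.opp c) (D.next (D.opp c))
        (D.next (D.next (D.opp c))) (D.next c) c (D.next (D.next (D.next c)))
        (D.next (D.next c)) := by
      refine ⟨hD _, hb.symm, rfl, rfl, hD _, rfl, rfl, rfl, ?_, D.opp_opp _, D.opp_opp _, ?_⟩
      · rw [vert_next, ← vert_next (D.opp (D.next c)), hb]
        exact hvne.symm
      · have h1 := D.isOver_next (D.opp (D.next c)) (hD _)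
        rw [hb, ← ho] at h1
        rw [D.isOver_next c (hD _), h1, Bool.not_not]
    have e1 : D.opp (D.next (D.next (D.next c))) = c0 := by rw [← oc, D.opp_opp]
    have e2 : D.opp (D.next (D.next c)) = D.next c0 := by
      have := H.bigon c0 hc0 hc0u
      rw [oc] at this
      rw [← D.next.injective this, D.opp_opp]
    refine S.exists_unpoke ⟨o2.2.symm, o1.2.symm, o2.1.symm, o1.1.symm⟩ hD M hμ ?_ ?_ ?_ ?_
    · rw [e1, e2, hμ.label_next]
    · rw [e1, ← hμ.label_next (D.opp (D.next c)), hb, hopp, hc1u]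
      exact fun h => hc0u (hvinj _ hc0 _ H.mem h)
    · rw [e1, hμ.label_next]
      exact fun h => hc0c (hvinj _ hc0 _ hc h)
    · intro h
      rw [hc1u] at h
      have := hvinj _ (H.next_opp_mem u H.mem) _ H.mem (by
        rw [hμ.label_next, h, hμ.label_next])
      exact hcu (D.opp.injective (D.next.injective (hc1u.trans this.symm)))
  -- Otherwise `c` and its successor would form an orbit that misses `u`.
  · have hc2c : D.next (D.opp (D.next (D.opp c))) ≠ c := by
      intro h
      have : F ⊆ {y | y ∈ F ∧ y ≠ c ∧ y ≠ D.next (D.opp c)} := by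
        refine H.subset _ ⟨H.next_opp_mem u H.mem, fun h' => hc1u ?_, fun h' => hcu ?_⟩ ?_
        · exact D.opp.injective (D.next.injective (h.trans h'.symm))
        · exact D.opp.injective (D.next.injective h'.symm)
        · rintro y ⟨hy, hyc, hyc1⟩ -
          exact ⟨H.next_opp_mem y hy, fun h' => hyc1
            (D.opp.injective (D.next.injective (h'.trans h.symm))), fun h' => hyc
            (D.opp.injective (D.next.injective h'))⟩
      exact (this hc).2.1 rfl
    have S : UnpokeSite D c (D.next c) (D.next (D.next c)) (D.next (D.next (D.next c)))
        (D.opp c) (D.opp (D.next c)) (D.next (D.next (D.opp c))) (D.next (D.opp c)) :=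
      ⟨hD _, rfl, rfl, rfl, hD _, hb.symm, rfl, rfl, hvne, rfl, rfl, ho⟩
    refine S.exists_unpoke ⟨o1.1.symm, o2.1.symm, o1.2.symm, o2.2.symm⟩ hD M hμ ?_ ?_ ?_ ?_
    · rw [← hμ.label_next, H.bigon _ hc1 hc1u]
    · rw [← hμ.label_next, H.bigon _ hc1 hc1u, hopp]
      exact fun h => hc2c (hvinj _ (H.next_opp_mem _ hc1) _ hc h)
    · rw [← hμ.label_next, H.bigon _ hc1 hc1u, hopp, hopp c]
      exact fun h => hc1u (fixed _ hc1 (hvinj _ (H.next_opp_mem _ hc1) _ hc1 h))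
    · rw [← oc]
      intro h
      refine hc0c (hvinj _ hc0 _ hc ?_)
      rw [← D.opp.injective h, hμ.label_next, hμ.label_next]

/-- A nontrivial diagram of the unknot without subdivision points that has a tree model can be
untwisted or unpoked. -/
theorem exists_reduction (hD : ∀ d, D.IsCrossing d) (hT : D.HasTreeModel) (hU : D.IsUnknot) :
    ∃ E, (Untwist D E ∨ Unpoke D E) ∧ E.HasTreeModel ∧ Nat.card E.Dart < Nat.card D.Dart ∧
      E.crossingNumber < D.crossingNumber := by
  obtain ⟨V, k, T, bag, μ, M, hμ⟩ := hT
  have hμ : D.IsVertexLabeling (ShareBag bag) μ :=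
    hμ.elim id fun h => h.isVertexLabeling hD
  obtain ⟨F, u, m, κ, H, o1, o2, hk, hku, hm⟩ := hμ.exists_isTwistFace M hD
  by_cases hu : D.next (D.opp u) = u
  -- The face has one corner and is bounded by a loop.
  · obtain ⟨h1, h2⟩ := o1 u H.mem
    obtain ⟨E, hE⟩ := exists_untwist (a := D.opp u) (hD _) (by rw [D.opp_opp, hu]) h2.symm
      (by rw [hu]; exact h1.symm)
    exact ⟨E, Or.inl hE, hE.hasTreeModel M hμ, hE.card_lt⟩
  · by_cases halt : ∀ c ∈ F, c ≠ u → D.isOver c ≠ D.isOver (D.opp c)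
    · exact absurd (H.isColorable hD (hm hu) hk hku halt) hU.not_isColorable
    · push Not at halt
      obtain ⟨c, hc, hcu, ho⟩ := halt
      obtain ⟨E, hE, h⟩ := H.exists_unpoke hD M hμ hc hcu ho (o1 c hc) (o2 c hc hcu)
      exact ⟨E, Or.inr hE, h⟩

/-- The two ends are closed under all steps along the strand, so they are the whole diagram. This is
the one subdivision point that may not be removed. -/
theorem IsTrivial.of_opp_eq_next {a : D.Dart} (ha : ¬ D.IsCrossing a) (h : D.opp a = D.next a) :
    D.IsTrivial := by
  have haa : D.next (D.next a) = a := not_not.1 ha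
  have key : ∀ x, (x = a ∨ x = D.next a) → ¬ D.IsCrossing x := by
    rintro x (rfl | rfl)
    · exact ha
    · rwa [isCrossing_next]
  intro x
  refine key x ?_
  have hopp : ∀ x, (x = a ∨ x = D.next a) → (D.opp x = a ∨ D.opp x = D.next a) := by
    rintro x (rfl | rfl)
    · exact Or.inr h
    · rw [← h, D.opp_opp]; exact Or.inl rfl
  have hnext : ∀ x, (x = a ∨ x = D.next a) → (D.next x = a ∨ D.next x = D.next a) := by
    rintro x (rfl | rfl)
    · exact Or.inr rfl
    · exact Or.inl haa
  have := eq_of_eqvGen (f := fun x => x = a ∨ x = D.next a) ?_ (D.one_strand a x)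
  · exact this ▸ Or.inl rfl
  · rintro x y (rfl | ⟨h, rfl⟩ | ⟨h, rfl⟩)
    · exact propext ⟨hopp x, fun h => by simpa [D.opp_opp] using hopp _ h⟩
    · exact propext ⟨hnext x, fun h' => by simpa [h] using hnext _ h'⟩
    · refine propext ⟨fun h' => absurd h (key x h'), fun h' => absurd h ?_⟩
      have := key _ h'
      rwa [isCrossing_next, isCrossing_next] at this

theorem IsUnknot.of_step (h : D.IsUnknot) (hE : SameCurve E D ∨ ReidemeisterMove E D) :
    E.IsUnknot := by
  obtain ⟨F, hF, hDF⟩ := h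
  exact ⟨F, hF, .head hE hDF⟩

/-- A diagram of the unknot with a tree model is simplified by at most as many untwists and unpokes
as it has crossings. -/
theorem exists_twistPokeSequence (D : KnotDiagram) (hT : D.HasTreeModel) (hU : D.IsUnknot) :
    ∃ k ≤ D.crossingNumber, ∃ E : KnotDiagram, E.IsTrivial ∧ TwistPokeSequence k D E := by
  induction hN : Nat.card D.Dart using Nat.strong_induction_on generalizing D with
  | _ N IH =>
  subst hN
  by_cases htriv : D.IsTrivial
  · exact ⟨0, Nat.zero_le _, D, htriv, .refl D⟩
  by_cases hD : ∀ d, D.IsCrossing d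
  · obtain ⟨E, hE, hET, hcard, hcr⟩ := exists_reduction hD hT hU
    have hmove : TwistPokeMove D E := hE.elim Or.inl fun h => Or.inr (Or.inr (Or.inl h))
    -- The reverse move shows that `E` is again a diagram of the unknot.
    have hmove' : TwistPokeMove E D := hE.elim (fun h => Or.inr (Or.inl h))
      fun h => Or.inr (Or.inr (Or.inr h))
    obtain ⟨k, hk, E', hE', hs⟩ := IH _ hcard E hET (hU.of_step (Or.inr (Or.inl hmove'))) rfl
    exact ⟨k + 1, by omega, E', hE', .move hmove hs⟩
  · push Not at hD
    obtain ⟨a, ha⟩ := hD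
    obtain ⟨E, hE⟩ := exists_removeSubdivision ha fun h => htriv (IsTrivial.of_opp_eq_next ha h)
    obtain ⟨hcard, hcr⟩ := hE.card_lt
    obtain ⟨k, hk, E', hE', hs⟩ := IH _ hcard E (hE.hasTreeModel hT)
      (hU.of_step (Or.inl (Or.inr (Or.inr hE)))) rfl
    exact ⟨k, hk.trans hcr, E', hE', .same (Or.inr (Or.inl hE)) hs⟩

end KnotDiagram

theorem theorem2 (D : KnotDiagram) (htw : D.graph.treewidth ≤ 2) (hD : D.IsUnknot) :
    ∃ k ≤ D.crossingNumber, ∃ E : KnotDiagram,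
      E.IsTrivial ∧ KnotDiagram.TwistPokeSequence k D E :=
  KnotDiagram.exists_twistPokeSequence D (KnotDiagram.hasTreeModel_of_treewidth_le htw) hD
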